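/- For real numbers $c<0$ and $\theta<0$ let $E(z;c,\theta)=\sum_{n\ge 1} e^{c n^{\theta}}(-z)^n$ for $|z|<1$. This function has a (unique) analytic continuation to $\mathbb{C}\setminus(-\infty,-1]$, also denoted by $E(z;c,\theta)$. Put $$A_1=-(c\theta)^{\frac{1}{2(\theta-1)}}\sqrt{\tfrac{2}{\pi(1-\theta)}},\qquad A_2=(1-\theta^{-1})(c\theta)^{\frac1{1-\theta}}\cos\tfrac{\pi}{1-\theta},$$ $$A_3=(1-\theta^{-1})(c\theta)^{\frac1{1-\theta}}\sin\tfrac{\pi}{1-\theta},\qquad A_4=\tfrac{\pi}{2(\theta-1)},$$ and, for $\varepsilon>0$, let $\mu=\frac{\theta}{2(\theta-1)}-\varepsilon$ if $\theta\ge-2$ and $\mu=\frac1{1-\theta}$ if $\theta<-2$. Then, for every $\varepsilon>0$, $$E(z;c,\theta)=A_1\exp\!\left(A_2(\log z)^{\frac{\theta}{\theta-1}}\right)(\log z)^{\frac{\theta}{2(1-\theta)}}\cos\!\left(A_3(\log z)^{\frac{\theta}{\theta-1}}+A_4\right)+O\!\left(\exp\!\left(A_2(\log z)^{\frac{\theta}{\theta-1}}\right)(\log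 z)^{\frac{\theta}{2(1-\theta)}-\mu}\right)$$ as $z\to\infty$ in an arbitrary sector $\{z\ne0:\alpha<\arg z<\beta\}$ with $-\pi\le\alpha<\beta\le\pi$, that is, a sector with vertex at zero that does not contain the negative real axis. The estimate is uniform in the sector, the implied constant depends only on $c,\theta,\varepsilon$ and the sector, and logarithms and powers have their principal values. Moreover, $A_2$ is negative for $-1<\theta<0$, zero for $\theta=-1$, and positive for $\theta<-1$. In particular, for every $\varepsilon>0$, as $z\to\infty$ in such a sector, $$E(z;-1,-1)=-\pi^{-1/2}(\log z)^{-1/4}\cos\!\left(2\sqrt{\log z}-\tfrac{\pi}{4}\right)+O\!\left((\log z)^{-1/2+\varepsilon}\right).$$ -/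

import Mathlib

open Complex Filter Asymptotics

noncomputable section

namespace GenExp

/-- The complex plane slit along `(-∞, -1]`. -/
def slitDomain : Set ℂ := {z | z + 1 ∈ Complex.slitPlane}

/-- `E` is (the analytic continuation to the plane slit along `(-∞, -1]` of) the generalized
exponential `E(z; c, θ) = ∑_{n ≥ 1} exp (c n ^ θ) (-z) ^ n`: it is analytic on the slit plane, and
it is the sum of the power series in the open unit disc.  As the slit plane is connected, this
determines `E` there. -/
structure IsGeneralizedExp (c θ : ℝ) (E : ℂ → ℂ) : Prop where
  analytic : AnalyticOnNhd ℂ E slitDomain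
  hasSum : ∀ z : ℂ, ‖z‖ < 1 →
    HasSum (fun n : ℕ => (Real.exp (c * ((n + 1 : ℕ) : ℝ) ^ θ) : ℂ) * (-z) ^ (n + 1)) (E z)

/-- The open sector with vertex at zero of all `z ≠ 0` with `α < arg z < β`, where `arg` is the
principal argument.  The sectors that do not meet the negative real axis are those
with `-π ≤ α` and `β ≤ π`. -/
def sector (α β : ℝ) : Set ℂ := {z | z ≠ 0 ∧ α < z.arg ∧ z.arg < β}

def A₁ (c θ : ℝ) : ℝ :=
  -((c * θ) ^ (1 / (2 * (θ - 1)))) * Real.sqrt (2 / (Real.pi * (1 - θ)))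

def A₂ (c θ : ℝ) : ℝ :=
  (1 - θ⁻¹) * (c * θ) ^ (1 / (1 - θ)) * Real.cos (Real.pi / (1 - θ))

def A₃ (c θ : ℝ) : ℝ :=
  (1 - θ⁻¹) * (c * θ) ^ (1 / (1 - θ)) * Real.sin (Real.pi / (1 - θ))

def A₄ (θ : ℝ) : ℝ := Real.pi / (2 * (θ - 1))

/-- The exponent of the error term. -/
def errorExponent (θ ε : ℝ) : ℝ :=
  if -2 ≤ θ then θ / (2 * (θ - 1)) - ε else 1 / (1 - θ)

/-- `(log z) ^ (θ / (θ - 1))`, with principal values. -/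
def logPow (θ : ℝ) (z : ℂ) : ℂ := Complex.log z ^ ((θ / (θ - 1) : ℝ) : ℂ)

def mainTerm (c θ : ℝ) (z : ℂ) : ℂ :=
  (A₁ c θ : ℂ) * Complex.exp ((A₂ c θ : ℂ) * logPow θ z)
    * Complex.log z ^ ((θ / (2 * (1 - θ)) : ℝ) : ℂ)
    * Complex.cos ((A₃ c θ : ℂ) * logPow θ z + (A₄ θ : ℂ))

def errorTerm (c θ ε : ℝ) (z : ℂ) : ℂ :=
  Complex.exp ((A₂ c θ : ℂ) * logPow θ z)
    * Complex.log z ^ ((θ / (2 * (1 - θ)) - errorExponent θ ε : ℝ) : ℂ)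

end GenExp

end

noncomputable section

namespace GenExp

open MeasureTheory Set Topology


/-! Put θ = -a and write W for `wright a c 0`. In the variable s = e^w the Hankel integral W(t) is
the inverse Laplace integral (2πi)⁻¹ ∫ e^{ts} e^{c s^{-a}} ds/s, so that n ∫₀^∞ e^{-nt} W(t) dt =
e^{c n^{-a}} (`laplace_wright`). Multiplying by (-z)^n and summing under the integral sign gives
E(z) = -∫₀^∞ W(t) f_z(t) dt with f_z(t) = z e^{-t} / (1 + z e^{-t})² (`hasSum_genExp`). The right
side is analytic off (-∞, -1], hence it is the continuation, unique by the identity theorem.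

The kernel f_z has total mass z/(1 + z) and decays like e^{-|t - log|z||} away from t = log|z|.
Hence E(z) is -W(log|z|), up to the increments of W over bounded distances, that is, up to the size
of W' (`exists_norm_genExp_add_wright_le`). The poles of f_z have imaginary parts arg z ± π and come
close to the real line when z is close to the cut. As W is analytic in Re t > 0, the line of
integration can be shifted by ±i away from the nearer pole, which makes the bound uniform in arg z,
so that all sectors are treated at once.

W and W' at ℓ = log|z| are estimated by steepest descent. Translating w by Λ with ℓ e^Λ = -ac
e^{-aΛ} = M turns the exponent into M psi(w), where M is of order ℓ^{a/(1+a)}. The conjugate saddle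
points ±iπ/(1 + a) together produce the cosine. The global input is `psi_path_re_lt`: on the
straight segment through the saddle, from the real axis to Im w = π, the real part of psi is largest
at the saddle.

Relative to the amplitude, Laplace's method costs M^{-1/2}, of order ℓ^{-a/(2(1+a))}; passing from E
to W, and from log|z| to log z, costs ℓ^{-1/(1+a)}. The exponent of the error term is at most each
of these two savings. -/

/-! ### Hankel contours and primitives -/

/-- The integral of `g` along the Hankel-type contour coming from `+∞ - π i` along a horizontal
line to `X - π i`, then up to `X + π i`, then back to `+∞ + π i`. -/
def hankel (g : ℂ → ℂ) (X : ℝ) : ℂ :=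
  (∫ x in Ioi X, (g (x + Real.pi * I) - g (x - Real.pi * I)))
    + I * ∫ τ in (-Real.pi)..Real.pi, g (X + τ * I)

theorem intervalIntegral_horizontal {F g : ℂ → ℂ} (hF : ∀ w, HasDerivAt F (g w) w)
    (hg : Continuous g) (x y : ℝ) (q : ℂ) :
    ∫ u in x..y, g (u + q) = F (y + q) - F (x + q) := by
  have h : ∀ u ∈ uIcc x y, HasDerivAt (fun v : ℝ => F (v + q)) (g (u + q)) u := fun u _ => by
    have h1 : HasDerivAt (fun v : ℝ => (v : ℂ) + q) 1 u := (ofRealCLM.hasDerivAt).add_const q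
    simpa using HasDerivAt.congr_deriv (f := fun v : ℝ => F (v + q)) ((hF (u + q)).scomp u h1) rfl
  exact intervalIntegral.integral_eq_sub_of_hasDerivAt h
    (Continuous.intervalIntegrable (by fun_prop) _ _)

theorem intervalIntegral_line {F g : ℂ → ℂ} (hF : ∀ w, HasDerivAt F (g w) w)
    (hg : Continuous g) (x y : ℝ) (q d : ℂ) :
    d * ∫ u in x..y, g (q + u * d) = F (q + y * d) - F (q + x * d) := by
  have h : ∀ u ∈ uIcc x y, HasDerivAt (fun v : ℝ => F (q + v * d)) (d * g (q + u * d)) u :=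
    fun u _ => by
    have h1 : HasDerivAt (fun v : ℝ => q + (v : ℂ) * d) d u := by
      simpa using ((ofRealCLM.hasDerivAt (x := u)).mul_const d).const_add q
    simpa using HasDerivAt.congr_deriv (f := fun v : ℝ => F (q + v * d))
      ((hF (q + u * d)).scomp u h1) rfl
  rw [← intervalIntegral.integral_const_mul]
  exact intervalIntegral.integral_eq_sub_of_hasDerivAt h
    (Continuous.intervalIntegrable (by fun_prop) _ _)

/-- For an entire integrand the finite part of the contour matters only through its end points, so
it may be replaced by any path between Y - πi and Y + πi. This is how the contour is later led
through the saddle points. -/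
theorem hankel_eq_of_primitive {F g : ℂ → ℂ} (hF : ∀ w, HasDerivAt F (g w) w)
    (hg : Continuous g) (X Y : ℝ)
    (hp : ∀ Z : ℝ, IntegrableOn (fun x : ℝ => g (x + Real.pi * I)) (Ioi Z))
    (hm : ∀ Z : ℝ, IntegrableOn (fun x : ℝ => g (x - Real.pi * I)) (Ioi Z)) :
    hankel g X = (∫ x in Ioi Y, (g (x + Real.pi * I) - g (x - Real.pi * I)))
      + (F (Y + Real.pi * I) - F (Y - Real.pi * I)) := by
  have h1 := intervalIntegral.integral_interval_add_Ioi ((hp X).sub (hm X)) ((hp Y).sub (hm Y))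
  have h2 := intervalIntegral_horizontal hF hg X Y (Real.pi * I)
  have h3 := intervalIntegral_horizontal hF hg X Y (-(Real.pi * I))
  have h4 := intervalIntegral_line hF hg (-Real.pi) Real.pi X I
  simp only [← sub_eq_add_neg] at h3
  simp only [Pi.sub_apply] at h1
  rw [intervalIntegral.integral_sub
    (Continuous.intervalIntegrable (by fun_prop) _ _)
    (Continuous.intervalIntegrable (by fun_prop) _ _), h2, h3] at h1
  rw [hankel, ← h1, h4]
  push_cast
  rw [neg_mul, ← sub_eq_add_neg]
  ring

/-! ### The function W, its derivatives and a first bound -/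

/-- The kernel of the contour integral representing the `j`-th derivative of `wright`. -/
def kern (a c : ℝ) (j : ℕ) (t w : ℂ) : ℂ :=
  Complex.exp w ^ j * Complex.exp (t * Complex.exp w + c * Complex.exp (-a * w))

theorem differentiable_kern (a c : ℝ) (j : ℕ) (t : ℂ) : Differentiable ℂ (kern a c j t) := by
  unfold kern; fun_prop

@[fun_prop]
theorem continuous_kern (a c : ℝ) (j : ℕ) (t : ℂ) : Continuous (kern a c j t) :=
  (differentiable_kern a c j t).continuous

theorem continuous_kern_uncurry (a c : ℝ) (j : ℕ) :
    Continuous (fun p : ℂ × ℂ => kern a c j p.1 p.2) := by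
  unfold kern; fun_prop

theorem hasDerivAt_kern (a c : ℝ) (j : ℕ) (t w : ℂ) :
    HasDerivAt (fun t => kern a c j t w) (kern a c (j + 1) t w) t := by
  unfold kern
  have h : HasDerivAt (fun t => t * Complex.exp w + c * Complex.exp (-a * w)) (Complex.exp w) t := by
    simpa using ((hasDerivAt_id t).mul_const (Complex.exp w)).add_const (c * Complex.exp (-a * w))
  exact (h.cexp.const_mul (Complex.exp w ^ j)).congr_deriv (by ring)

theorem norm_kern (a c : ℝ) (j : ℕ) (t w : ℂ) :
    ‖kern a c j t w‖ = Real.exp w.re ^ j *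
      Real.exp ((t * Complex.exp w).re + c * (Real.exp (-a * w.re) * Real.cos (a * w.im))) := by
  unfold kern
  rw [norm_mul, norm_pow, Complex.norm_exp, Complex.norm_exp, add_re, re_ofReal_mul,
    Complex.exp_re]
  congr 3
  simp

theorem exp_horizontal (x : ℝ) : Complex.exp (x + Real.pi * I) = -Real.exp x := by
  rw [Complex.exp_add, Complex.exp_pi_mul_I]; simp

theorem exp_horizontal' (x : ℝ) : Complex.exp (x - Real.pi * I) = -Real.exp x := by
  rw [Complex.exp_sub, Complex.exp_pi_mul_I]; simp [div_neg]

theorem exp_cos_le {a c X x : ℝ} (ha : 0 < a) (hx : X ≤ x) (y : ℝ) :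
    c * (Real.exp (-a * x) * Real.cos y) ≤ |c| * Real.exp (-a * X) := by
  calc c * (Real.exp (-a * x) * Real.cos y) ≤ |c * (Real.exp (-a * x) * Real.cos y)| := le_abs_self _
    _ = |c| * (Real.exp (-a * x) * |Real.cos y|) := by
        rw [abs_mul, abs_mul, abs_of_pos (Real.exp_pos _)]
    _ ≤ |c| * (Real.exp (-a * X) * 1) := by
        gcongr ?_ * (?_ * ?_)
        · exact Real.exp_le_exp.2 (by nlinarith)
        · exact Real.abs_cos_le_one y
    _ = _ := by ring

theorem norm_kern_horizontal_le {a c X x : ℝ} (ha : 0 < a) (j : ℕ) (t : ℂ) (hx : X ≤ x) {w : ℂ}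
    (hw : w = x + Real.pi * I ∨ w = x - Real.pi * I) :
    ‖kern a c j t w‖ ≤ Real.exp (|c| * Real.exp (-a * X)) *
      (Real.exp x ^ j * Real.exp (-(t.re * Real.exp x))) := by
  have hre : w.re = x := by rcases hw with rfl | rfl <;> simp
  have he : Complex.exp w = -Real.exp x := by
    rcases hw with rfl | rfl
    exacts [exp_horizontal x, exp_horizontal' x]
  rw [norm_kern, he, hre, Real.exp_add]
  have h1 : (t * -(Real.exp x : ℂ)).re = -(t.re * Real.exp x) := by
    rw [← ofReal_neg, re_mul_ofReal]; ring
  rw [h1]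
  have := Real.exp_le_exp.2 (exp_cos_le (c := c) ha hx (a * w.im))
  calc _ ≤ Real.exp x ^ j * (Real.exp (-(t.re * Real.exp x)) *
        Real.exp (|c| * Real.exp (-a * X))) := by gcongr
    _ = _ := by ring

theorem tendsto_exp_neg_mul_exp {b : ℝ} (hb : 0 < b) :
    Tendsto (fun x : ℝ => Real.exp (-(b * Real.exp x))) atTop (𝓝 0) :=
  Real.tendsto_exp_neg_atTop_nhds_zero.comp (Real.tendsto_exp_atTop.const_mul_atTop hb)

theorem hasDerivAt_exp_neg_mul_exp (b x : ℝ) :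
    HasDerivAt (fun x => -Real.exp (-(b * Real.exp x)))
      (b * (Real.exp x * Real.exp (-(b * Real.exp x)))) x := by
  exact (((Real.hasDerivAt_exp x).const_mul b).neg.exp).neg.congr_deriv (by simp; ring)

theorem integrableOn_exp_mul_exp_neg {b : ℝ} (hb : 0 < b) (X : ℝ) :
    IntegrableOn (fun x => Real.exp x * Real.exp (-(b * Real.exp x))) (Ioi X) := by
  have := integrableOn_Ioi_deriv_of_nonneg' (a := X) (l := -0)
    (fun x _ => hasDerivAt_exp_neg_mul_exp b x) (fun x _ => by positivity)
    (tendsto_exp_neg_mul_exp hb).neg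
  simpa [IntegrableOn, hb.ne'] using this.const_mul b⁻¹

theorem integral_exp_mul_exp_neg {b : ℝ} (hb : 0 < b) (X : ℝ) :
    ∫ x in Ioi X, Real.exp x * Real.exp (-(b * Real.exp x)) = Real.exp (-(b * Real.exp X)) / b := by
  have := integral_Ioi_of_hasDerivAt_of_nonneg' (a := X) (l := -0)
    (fun x _ => hasDerivAt_exp_neg_mul_exp b x) (fun x _ => by positivity)
    (tendsto_exp_neg_mul_exp hb).neg
  rw [integral_const_mul] at this
  rw [eq_div_iff hb.ne', mul_comm, this]; simp

theorem integrableOn_exp_pow_mul_exp_neg {b : ℝ} (hb : 0 < b) (X : ℝ) (j : ℕ) :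
    IntegrableOn (fun x => Real.exp x ^ j * Real.exp (-(b * Real.exp x))) (Ioi X) := by
  have h2 : 0 < b / 2 := by positivity
  -- Half of the decay pays for the power of e^x. The remaining half must keep one factor e^x so
  -- that it has an explicit primitive; for j = 0 that factor is inserted using e^{x - X} ≥ 1.
  obtain ⟨C, hC⟩ : ∃ C : ℝ, ∀ x ∈ Ioi X, Real.exp x ^ j ≤ C * (Real.exp x *
      Real.exp (b / 2 * Real.exp x)) := by
    refine ⟨Real.exp (-X) * ((j.factorial : ℝ) / (b / 2) ^ j), fun x hx => ?_⟩
    have h3 : (b / 2 * Real.exp x) ^ j / j.factorial ≤ Real.exp (b / 2 * Real.exp x) :=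
      Real.pow_div_factorial_le_exp _ (by positivity) j
    have h4 : 1 ≤ Real.exp (-X) * Real.exp x := by
      rw [← Real.exp_add]; exact Real.one_le_exp (by linarith [mem_Ioi.1 hx])
    calc Real.exp x ^ j = 1 * ((j.factorial : ℝ) / (b / 2) ^ j) *
          ((b / 2 * Real.exp x) ^ j / j.factorial) := by
          rw [mul_pow]; field_simp
      _ ≤ (Real.exp (-X) * Real.exp x) * ((j.factorial : ℝ) / (b / 2) ^ j) *
          Real.exp (b / 2 * Real.exp x) := by gcongr
      _ = _ := by ring
  refine ((integrableOn_exp_mul_exp_neg h2 X).const_mul C).mono'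
    (Continuous.aestronglyMeasurable (by fun_prop)) ?_
  filter_upwards [ae_restrict_mem measurableSet_Ioi] with x hx
  rw [Real.norm_of_nonneg (by positivity)]
  calc _ ≤ C * (Real.exp x * Real.exp (b / 2 * Real.exp x)) * Real.exp (-(b * Real.exp x)) := by
        gcongr; exact hC x hx
    _ = C * (Real.exp x * Real.exp (b / 2 * Real.exp x + -(b * Real.exp x))) := by
        rw [Real.exp_add]; ring
    _ = _ := by congr 3; ring

theorem integrableOn_kern {a c : ℝ} (ha : 0 < a) (j : ℕ) {t : ℂ} (ht : 0 < t.re) (X : ℝ) :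
    IntegrableOn (fun x : ℝ => kern a c j t (x + Real.pi * I)) (Ioi X) ∧
    IntegrableOn (fun x : ℝ => kern a c j t (x - Real.pi * I)) (Ioi X) := by
  have h := (integrableOn_exp_pow_mul_exp_neg ht X j).const_mul (Real.exp (|c| * Real.exp (-a * X)))
  constructor
  all_goals
    refine h.mono' (Continuous.aestronglyMeasurable (by fun_prop)) ?_
    filter_upwards [ae_restrict_mem measurableSet_Ioi] with x hx
    exact norm_kern_horizontal_le ha j t (le_of_lt hx) (by tauto)

/-- The function `∑ k, c ^ k t ^ (a k) / (k! Γ(a k + 1))` (for `j = 0`) and its derivatives, through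
their integral representation. -/
def wright (a c : ℝ) (j : ℕ) (t : ℂ) : ℂ :=
  (2 * Real.pi * I)⁻¹ * hankel (kern a c j t) (Real.log 2⁻¹)

theorem wright_eq_of_primitive {a c : ℝ} (ha : 0 < a) (j : ℕ) {t : ℂ} (ht : 0 < t.re) (X : ℝ)
    {F : ℂ → ℂ} (hF : ∀ w, HasDerivAt F (kern a c j t w) w) :
    wright a c j t = (2 * Real.pi * I)⁻¹ * ((∫ x in Ioi X, (kern a c j t (x + Real.pi * I) -
      kern a c j t (x - Real.pi * I))) + (F (X + Real.pi * I) - F (X - Real.pi * I))) := by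
  rw [wright, hankel_eq_of_primitive hF (continuous_kern a c j t) _ X
    (fun Z => (integrableOn_kern ha j ht Z).1) (fun Z => (integrableOn_kern ha j ht Z).2)]

theorem exists_primitive_kern (a c : ℝ) (j : ℕ) (t : ℂ) :
    ∃ F : ℂ → ℂ, ∀ w, HasDerivAt F (kern a c j t w) w := by
  obtain ⟨F, hF⟩ := (differentiable_kern a c j t).isExactOn_univ
  exact ⟨F, fun w => hF w (mem_univ w)⟩

/-- Each differentiation in t multiplies the kernel by e^w. Restricting to Re u > Re t / 2 gives an
integrable majorant on the half-lines, and compactness bounds the vertical side. -/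
theorem hasDerivAt_wright {a c : ℝ} (ha : 0 < a) (j : ℕ) {t : ℂ} (ht : 0 < t.re) :
    HasDerivAt (wright a c j) (wright a c (j + 1) t) t := by
  have hs : {u : ℂ | t.re / 2 < u.re} ∈ 𝓝 t :=
    (isOpen_lt continuous_const Complex.continuous_re).mem_nhds (by simp; linarith)
  set X : ℝ := Real.log 2⁻¹
  refine HasDerivAt.const_mul _ (HasDerivAt.add ?_ (HasDerivAt.const_mul _ ?_))
  · refine (hasDerivAt_integral_of_dominated_loc_of_deriv_le (μ := volume.restrict (Ioi X))
      (F := fun t (x : ℝ) => kern a c j t (x + Real.pi * I) - kern a c j t (x - Real.pi * I))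
      (F' := fun t (x : ℝ) => kern a c (j + 1) t (x + Real.pi * I) -
        kern a c (j + 1) t (x - Real.pi * I))
      (bound := fun x => 2 * (Real.exp (|c| * Real.exp (-a * X)) *
        (Real.exp x ^ (j + 1) * Real.exp (-(t.re / 2 * Real.exp x)))))
      hs (Eventually.of_forall fun u => Continuous.aestronglyMeasurable (by fun_prop))
      ((integrableOn_kern ha j ht X).1.sub (integrableOn_kern ha j ht X).2)
      (Continuous.aestronglyMeasurable (by fun_prop)) ?_ ?_ ?_).2
    · filter_upwards [ae_restrict_mem measurableSet_Ioi] with x hx u hu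
      have h1 := norm_kern_horizontal_le (c := c) ha (j + 1) u (le_of_lt (mem_Ioi.1 hx)) (.inl rfl)
      have h2 := norm_kern_horizontal_le (c := c) ha (j + 1) u (le_of_lt (mem_Ioi.1 hx)) (.inr rfl)
      refine (norm_sub_le _ _).trans ((add_le_add h1 h2).trans ?_)
      rw [← two_mul]
      have : t.re / 2 < u.re := hu
      gcongr
    · exact ((integrableOn_exp_pow_mul_exp_neg (by positivity) X (j + 1)).const_mul _).const_mul 2
    · exact Eventually.of_forall fun x u _ =>
        (hasDerivAt_kern a c j u _).sub (hasDerivAt_kern a c j u _)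
  · obtain ⟨C, hC⟩ : ∃ C, ∀ p ∈ Metric.closedBall t 1 ×ˢ Icc (-Real.pi) Real.pi,
        ‖kern a c (j + 1) p.1 (X + p.2 * I)‖ ≤ C :=
      ((isCompact_closedBall t 1).prod isCompact_Icc).exists_bound_of_continuousOn
        (((continuous_kern_uncurry a c (j + 1)).comp
          (f := fun p : ℂ × ℝ => (p.1, (X : ℂ) + p.2 * I)) (by fun_prop)).continuousOn)
    refine (intervalIntegral.hasDerivAt_integral_of_dominated_loc_of_deriv_le
      (F := fun t (τ : ℝ) => kern a c j t (X + τ * I))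
      (F' := fun t (τ : ℝ) => kern a c (j + 1) t (X + τ * I)) (bound := fun _ => C)
      (Metric.closedBall_mem_nhds t one_pos)
      (Eventually.of_forall fun u => Continuous.aestronglyMeasurable (by fun_prop))
      (Continuous.intervalIntegrable (by fun_prop) _ _)
      (Continuous.aestronglyMeasurable (by fun_prop)) ?_ (by simp) ?_).2
    · refine Eventually.of_forall fun τ hτ u hu => hC (u, τ) ⟨hu, ?_⟩
      rw [uIoc_of_le (by linarith [Real.pi_pos])] at hτ
      exact Ioc_subset_Icc_self hτ
    · exact Eventually.of_forall fun τ _ u _ => hasDerivAt_kern a c j u _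

theorem exp_neg_le_rpow {y : ℝ} (hy : 0 < y) : Real.exp (-y) ≤ y ^ (-(1 / 2) : ℝ) := by
  rw [Real.rpow_def_of_pos hy]
  apply Real.exp_le_exp.2
  have := Real.log_le_sub_one_of_pos hy
  linarith

theorem exp_neg_mul_exp_le {r x : ℝ} (hr : 0 < r) :
    Real.exp (-(r * Real.exp x)) ≤ r ^ (-(1 / 2) : ℝ) * Real.exp (-(1 / 2) * x) := by
  refine (exp_neg_le_rpow (by positivity)).trans_eq ?_
  rw [Real.mul_rpow hr.le (Real.exp_pos x).le, ← Real.exp_mul]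
  ring_nf

theorem norm_kern_vertical_le {a c : ℝ} (ha : 0 < a) (X τ : ℝ) {r : ℝ} (hr : 0 < r) :
    ‖kern a c 0 r (X + τ * I)‖ ≤ Real.exp (|c| * Real.exp (-a * X)) *
      Real.exp (r * Real.exp X) := by
  rw [norm_kern, pow_zero, one_mul, ← Real.exp_add]
  have h2 := exp_cos_le (c := c) ha (le_refl X) (a * ((X : ℂ) + τ * I).im)
  have hre : ((X : ℂ) + τ * I).re = X := by simp
  have h1 : ((r : ℂ) * Complex.exp (X + τ * I)).re ≤ r * Real.exp X := by
    rw [re_ofReal_mul]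
    gcongr
    refine (re_le_norm _).trans_eq ?_
    rw [Complex.norm_exp, hre]
  rw [hre]
  apply Real.exp_le_exp.2
  linarith

/-- The vertical side lies over |s| = e^X = 1/2, whence the factor e^{r/2}, which e^{-r} beats in
the Laplace integral. For the horizontal sides e^{-y} ≤ y^{-1/2} yields a power of r that is
integrable at 0 and a factor e^{-x/2} that is integrable at infinity. -/
theorem exists_wright_zero_bound {a c : ℝ} (ha : 0 < a) :
    ∃ C : ℝ, 0 ≤ C ∧ ∀ r : ℝ, 0 < r →
      ‖wright a c 0 r‖ ≤ C * (r ^ (-(1 / 2) : ℝ) + Real.exp (r / 2)) := by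
  set X : ℝ := Real.log 2⁻¹ with hX
  set D := Real.exp (|c| * Real.exp (-a * X)) with hD
  set J := ∫ x in Ioi X, Real.exp (-(1 / 2) * x) with hJ
  have hJ0 : 0 ≤ J := integral_nonneg fun x => (Real.exp_pos _).le
  have hJi : IntegrableOn (fun x => Real.exp (-(1 / 2) * x)) (Ioi X) :=
    integrableOn_exp_mul_Ioi (by norm_num) X
  have hD0 : 0 < D := Real.exp_pos _
  refine ⟨‖(2 * Real.pi * I : ℂ)⁻¹‖ * (2 * D * J + D * (2 * Real.pi)), by positivity, fun r hr => ?_⟩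
  have h1 : ‖∫ x in Ioi X, (kern a c 0 r (x + Real.pi * I) - kern a c 0 r (x - Real.pi * I))‖
      ≤ 2 * D * J * r ^ (-(1 / 2) : ℝ) := by
    have : 2 * D * J * r ^ (-(1 / 2) : ℝ) =
        ∫ x in Ioi X, 2 * D * r ^ (-(1 / 2) : ℝ) * Real.exp (-(1 / 2) * x) := by
      rw [integral_const_mul]; ring
    rw [this]
    refine norm_integral_le_of_norm_le (hJi.const_mul _) ?_
    filter_upwards [ae_restrict_mem measurableSet_Ioi] with x hx
    have h1 := norm_kern_horizontal_le (c := c) ha 0 r (le_of_lt (mem_Ioi.1 hx)) (.inl rfl)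
    have h2 := norm_kern_horizontal_le (c := c) ha 0 r (le_of_lt (mem_Ioi.1 hx)) (.inr rfl)
    refine (norm_sub_le _ _).trans ((add_le_add h1 h2).trans ?_)
    rw [ofReal_re, pow_zero, one_mul]
    have := exp_neg_mul_exp_le (x := x) hr
    nlinarith
  have h2 : ‖I * ∫ τ in (-Real.pi)..Real.pi, kern a c 0 r (X + τ * I)‖
      ≤ D * (2 * Real.pi) * Real.exp (r / 2) := by
    rw [norm_mul, norm_I, one_mul]
    refine (intervalIntegral.norm_integral_le_of_norm_le_const (C := D * Real.exp (r / 2))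
      fun τ _ => ?_).trans_eq ?_
    · refine (norm_kern_vertical_le ha X τ hr).trans_eq ?_
      rw [hX, Real.exp_log (by norm_num)]
      rfl
    · rw [sub_neg_eq_add, abs_of_pos (by linarith [Real.pi_pos])]; ring
  rw [wright, hankel, norm_mul, mul_assoc ‖(2 * Real.pi * I : ℂ)⁻¹‖]
  refine mul_le_mul_of_nonneg_left ?_ (norm_nonneg _)
  refine (norm_add_le _ _).trans ((add_le_add h1 h2).trans ?_)
  have e1 : 0 ≤ r ^ (-(1 / 2) : ℝ) := by positivity
  have e2 := Real.exp_pos (r / 2)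
  have e3 : 0 ≤ 2 * D * J := by positivity
  have e4 : 0 ≤ D * (2 * Real.pi) := by have := Real.pi_pos; positivity
  nlinarith [mul_nonneg e3 e2.le, mul_nonneg e4 e1]


/-! ### The residue at w = ν and the Laplace transform of W -/

/-- In the closed strip |Im w| ≤ π the equation e^w = e^ν has only the solution w = ν, and it is a
simple one; dividing by this divided difference therefore creates no pole. -/
theorem dslope_exp_ne_zero {ν : ℝ} {w : ℂ} (hw : |w.im| ≤ Real.pi) :
    dslope Complex.exp (ν : ℂ) w ≠ 0 := by
  by_cases h : w = ν
  · rw [h, dslope_same, Complex.deriv_exp]; exact Complex.exp_ne_zero _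
  rw [dslope_of_ne _ h, slope_def_field]
  refine div_ne_zero (fun h1 => h ?_) (sub_ne_zero.2 h)
  obtain ⟨n, hn⟩ := Complex.exp_eq_exp_iff_exists_int.1 (sub_eq_zero.1 h1)
  have him : w.im = n * (2 * Real.pi) := by rw [hn]; simp
  have hn0 : n = 0 := by
    by_contra h0
    have h2 : (1 : ℝ) ≤ |(n : ℝ)| := by exact_mod_cast Int.one_le_abs h0
    rw [him, abs_mul, abs_of_pos (by positivity : 0 < 2 * Real.pi)] at hw
    nlinarith [Real.pi_pos]
  simpa [hn0] using hn

theorem dslope_div_dslope_exp (f : ℂ → ℂ) {ν : ℝ} {w : ℂ} (h : w ≠ ν) :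
    -(Complex.exp ν * (dslope f ν w / dslope Complex.exp ν w)) =
      (f w - f ν) * (Complex.exp ν / (Complex.exp ν - Complex.exp w)) := by
  rw [dslope_of_ne _ h, dslope_of_ne _ h, slope_def_field, slope_def_field,
    div_div_div_cancel_right₀ (sub_ne_zero.2 h), ← neg_sub (Complex.exp w), div_neg]
  ring

/-- As a function of s = e^w the integrand is holomorphic on |s| ≤ e^X < e^ν with value 1 at s = 0,
so this is the mean value property. -/
theorem integral_vertical_eq {X ν : ℝ} (h : X < ν) :
    ∫ τ in (-Real.pi)..Real.pi, Complex.exp ν / (Complex.exp ν - Complex.exp (X + τ * I))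
      = 2 * Real.pi := by
  have hX := Real.exp_pos X
  have hd : DiffContOnCl ℂ (fun s => Complex.exp ν / (Complex.exp ν - s))
      (Metric.ball 0 |Real.exp X|) := by
    apply DifferentiableOn.diffContOnCl
    intro s hs
    rw [abs_of_pos hX, closure_ball _ hX.ne', mem_closedBall_zero_iff] at hs
    refine (DifferentiableAt.div (by fun_prop) (by fun_prop) ?_).differentiableWithinAt
    intro h0
    have : ‖s‖ = Real.exp ν := by
      rw [← sub_eq_zero.1 h0, Complex.norm_exp, ofReal_re]
    linarith [Real.exp_lt_exp.2 h]
  have h1 := hd.circleAverage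
  rw [Real.circleAverage_def] at h1
  simp only [sub_zero, div_self (Complex.exp_ne_zero _)] at h1
  have hper : Function.Periodic
      (fun τ : ℝ => Complex.exp ν / (Complex.exp ν - Complex.exp (X + τ * I))) (2 * Real.pi) := by
    intro τ
    have : Complex.exp (X + ((τ + 2 * Real.pi : ℝ) : ℂ) * I) = Complex.exp (X + τ * I) := by
      rw [← Complex.exp_periodic (X + τ * I)]; push_cast; ring_nf
    simp only [this]
  have h2 := hper.intervalIntegral_add_eq (-Real.pi) 0
  rw [show -Real.pi + 2 * Real.pi = Real.pi by ring, zero_add] at h2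
  rw [h2]
  have h3 : (fun τ : ℝ => Complex.exp ν / (Complex.exp ν - Complex.exp (X + τ * I))) =
      fun τ : ℝ => Complex.exp ν / (Complex.exp ν - circleMap 0 (Real.exp X) τ) := by
    ext τ; rw [circleMap, Complex.exp_add, zero_add, ofReal_exp]
  rw [h3]
  have := congrArg (fun u : ℂ => (2 * Real.pi : ℝ) • u) h1
  simp only [smul_smul] at this
  rw [mul_inv_cancel₀ (by positivity), one_smul] at this
  rw [this]; simp

/-- The residue theorem for the simple pole of `exp ν / (exp ν - exp w)` at `w = ν`. -/
theorem hankel_eq_residue {f : ℂ → ℂ} (hf : Differentiable ℂ f) {B X ν : ℝ}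
    (hB : ∀ w : ℂ, X ≤ w.re → ‖f w‖ ≤ B) (hν : X < ν) :
    hankel (fun w => f w * (Complex.exp ν / (Complex.exp ν - Complex.exp w))) X
      = 2 * Real.pi * I * f ν := by
  set N : ℝ := Real.exp ν with hN
  have hN0 : 0 < N := Real.exp_pos _
  -- Removal of the pole: away from ν this is (f - f ν) times the kernel, and the divided
  -- differences make it holomorphic at ν too. Its contour integral vanishes by Cauchy, and the
  -- constant f ν is integrated separately.
  set p : ℂ → ℂ := fun w => -(Complex.exp ν * (dslope f ν w / dslope Complex.exp ν w)) with hp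
  have hpi := Real.pi_pos
  have hp_eq : ∀ w : ℂ, w ≠ ν → p w = (f w - f ν) *
      (Complex.exp ν / (Complex.exp ν - Complex.exp w)) := fun w hw => dslope_div_dslope_exp f hw
  have hdp : ∀ w : ℂ, |w.im| ≤ Real.pi → DifferentiableAt ℂ p w := by
    intro w hw
    have h1 : Differentiable ℂ (dslope f ν) := fun w =>
      (((differentiableOn_dslope univ_mem).2 hf.differentiableOn).differentiableAt univ_mem)
    have h2 : Differentiable ℂ (dslope Complex.exp ν) := fun w =>
      (((differentiableOn_dslope univ_mem).2
        Complex.differentiable_exp.differentiableOn).differentiableAt univ_mem)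
    exact (((h1 w).div (h2 w) (dslope_exp_ne_zero hw)).const_mul _).neg
  have him1 : ∀ x : ℝ, ((x : ℂ) + Real.pi * I).im = Real.pi := by intro x; simp
  have him2 : ∀ x : ℝ, ((x : ℂ) - Real.pi * I).im = -Real.pi := by intro x; simp
  have hne : ∀ x : ℝ, ((x : ℂ) + Real.pi * I) ≠ ν ∧ ((x : ℂ) - Real.pi * I) ≠ ν := by
    intro x
    constructor <;> intro h <;> have := congrArg Complex.im h
    · rw [him1] at this; simp at this
    · rw [him2] at this; simp at this
  have hB0 : 0 ≤ B := (norm_nonneg _).trans (hB ν (by simpa using hν.le))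
  have hfd : ∀ w : ℂ, X ≤ w.re → ‖f w - f ν‖ ≤ 2 * B := fun w hw =>
    (norm_sub_le _ _).trans (by linarith [hB w hw, hB ν (by simpa using hν.le)])
  -- horizontal bound
  have hhor : ∀ x : ℝ, X ≤ x → ∀ w : ℂ, (w = x + Real.pi * I ∨ w = x - Real.pi * I) →
      ‖p w‖ ≤ 2 * B * N * Real.exp (-1 * x) := by
    intro x hx w hw
    have he : Complex.exp w = -Real.exp x := by
      rcases hw with rfl | rfl
      exacts [exp_horizontal x, exp_horizontal' x]
    have hw1 : w ≠ ν := by rcases hw with rfl | rfl; exacts [(hne x).1, (hne x).2]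
    have hw2 : w.re = x := by rcases hw with rfl | rfl <;> simp
    rw [hp_eq w hw1, he, norm_mul, mul_assoc (2 * B)]
    have h1 : Complex.exp ν / (Complex.exp ν - -(Real.exp x : ℂ)) =
        ((N / (N + Real.exp x) : ℝ) : ℂ) := by
      rw [hN]; push_cast; rw [sub_neg_eq_add]
    have hx0 := Real.exp_pos x
    rw [h1, Complex.norm_real, Real.norm_of_nonneg (by positivity)]
    have h2 : N / (N + Real.exp x) ≤ N * Real.exp (-1 * x) := by
      rw [neg_one_mul, Real.exp_neg, ← div_eq_mul_inv]
      gcongr; linarith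
    exact mul_le_mul (hfd w (by rw [hw2]; exact hx)) h2 (by positivity) (by positivity)
  have hi0 := (integrableOn_exp_mul_Ioi (show (-1 : ℝ) < 0 by norm_num) X).const_mul (2 * B * N)
  have hcp : Continuous (fun x : ℝ => p (x + Real.pi * I)) := by
    refine continuous_iff_continuousAt.2 fun x => ?_
    exact ContinuousAt.comp (f := fun x : ℝ => (x : ℂ) + Real.pi * I)
      (hdp _ (by rw [him1, abs_of_pos hpi])).continuousAt (by fun_prop)
  have hcm : Continuous (fun x : ℝ => p (x - Real.pi * I)) := by
    refine continuous_iff_continuousAt.2 fun x => ?_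
    exact ContinuousAt.comp (f := fun x : ℝ => (x : ℂ) - Real.pi * I)
      (hdp _ (by rw [him2, abs_neg, abs_of_pos hpi])).continuousAt (by fun_prop)
  have hip : IntegrableOn (fun x : ℝ => p (x + Real.pi * I)) (Ioi X) := by
    refine hi0.mono' hcp.aestronglyMeasurable ?_
    filter_upwards [ae_restrict_mem measurableSet_Ioi] with x hx
    exact hhor x (le_of_lt hx) _ (.inl rfl)
  have him : IntegrableOn (fun x : ℝ => p (x - Real.pi * I)) (Ioi X) := by
    refine hi0.mono' hcm.aestronglyMeasurable ?_
    filter_upwards [ae_restrict_mem measurableSet_Ioi] with x hx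
    exact hhor x (le_of_lt hx) _ (.inr rfl)
  -- Cauchy's theorem on rectangles
  have hrect : ∀ R : ℝ, (∫ x in X..R, (p (x + Real.pi * I) - p (x - Real.pi * I))) =
      I * (∫ y in (-Real.pi)..Real.pi, p (R + y * I)) -
      I * (∫ y in (-Real.pi)..Real.pi, p (X + y * I)) := by
    intro R
    have h := Complex.integral_boundary_rect_eq_zero_of_differentiableOn p
      ((X : ℂ) - Real.pi * I) ((R : ℂ) + Real.pi * I) (by
        intro w hw
        refine (hdp w ?_).differentiableWithinAt
        have h2 := hw.2
        rw [mem_preimage, him1, him2, uIcc_of_le (by linarith)] at h2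
        exact abs_le.2 h2)
    have r1 : ((X : ℂ) - Real.pi * I).re = X := by simp
    have r2 : ((R : ℂ) + Real.pi * I).re = R := by simp
    rw [him1, him2, r1, r2] at h
    simp only [smul_eq_mul, ofReal_neg, neg_mul, ← sub_eq_add_neg] at h
    rw [intervalIntegral.integral_sub (hcp.intervalIntegrable _ _) (hcm.intervalIntegrable _ _)]
    linear_combination -h
  have hlim : Tendsto (fun R : ℝ => ∫ y in (-Real.pi)..Real.pi, p (R + y * I)) atTop (𝓝 0) := by
    have hb : ∀ᶠ R : ℝ in atTop, ‖∫ y in (-Real.pi)..Real.pi, p (R + y * I)‖ ≤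
        (2 * B) * (N / (Real.exp R - N)) * (2 * Real.pi) := by
      filter_upwards [eventually_gt_atTop ν] with R hR
      have hR' : N < Real.exp R := Real.exp_lt_exp.2 hR
      refine (intervalIntegral.norm_integral_le_of_norm_le_const
        (C := (2 * B) * (N / (Real.exp R - N))) fun y _ => ?_).trans_eq ?_
      · have hre : ((R : ℂ) + y * I).re = R := by simp
        have hw1 : (R : ℂ) + y * I ≠ ν := by
          intro h
          have := congrArg Complex.re h
          rw [hre, ofReal_re] at this
          exact hR.ne' this
        rw [hp_eq _ hw1, norm_mul, norm_div]
        have e1 : ‖Complex.exp ν‖ = N := by rw [Complex.norm_exp, ofReal_re]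
        have e2 : ‖Complex.exp (R + y * I)‖ = Real.exp R := by rw [Complex.norm_exp, hre]
        have e3 : Real.exp R - N ≤ ‖Complex.exp ν - Complex.exp (R + y * I)‖ := by
          rw [← e1, ← e2, norm_sub_rev]; exact norm_sub_norm_le _ _
        rw [e1]
        have : 0 < Real.exp R - N := by linarith
        exact mul_le_mul (hfd _ (by rw [hre]; linarith)) (by gcongr) (by positivity) (by positivity)
      · rw [sub_neg_eq_add, abs_of_pos (by linarith)]; ring
    refine squeeze_zero_norm' hb ?_
    have h1 : Tendsto (fun R : ℝ => N / (Real.exp R - N)) atTop (𝓝 0) :=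
      Tendsto.div_atTop tendsto_const_nhds
        (tendsto_atTop_add_const_right _ (-N) Real.tendsto_exp_atTop)
    simpa using (h1.const_mul (2 * B)).mul_const (2 * Real.pi)
  have hkey : (∫ x in Ioi X, (p (x + Real.pi * I) - p (x - Real.pi * I))) =
      -(I * ∫ y in (-Real.pi)..Real.pi, p (X + y * I)) := by
    refine tendsto_nhds_unique
      (intervalIntegral_tendsto_integral_Ioi X (hip.sub him) tendsto_id) ?_
    simp only [id, hrect]
    simpa using (hlim.const_mul I).sub_const (I * ∫ y in (-Real.pi)..Real.pi, p (X + y * I))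
  have hden : ∀ τ : ℝ, Complex.exp ν - Complex.exp (X + τ * I) ≠ 0 := by
    intro τ h
    have e1 : ‖Complex.exp ν‖ = N := by rw [Complex.norm_exp, ofReal_re]
    have e2 : ‖Complex.exp (X + τ * I)‖ = Real.exp X := by rw [Complex.norm_exp]; simp
    rw [sub_eq_zero.1 h, e2] at e1
    exact (Real.exp_lt_exp.2 hν).ne e1
  have hcf : Continuous f := hf.continuous
  have hcv : Continuous (fun τ : ℝ => Complex.exp ν / (Complex.exp ν - Complex.exp (X + τ * I))) :=
    Continuous.div (by fun_prop) (by fun_prop) hden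
  have hneX : ∀ τ : ℝ, (X : ℂ) + τ * I ≠ ν := by
    intro τ h
    have := congrArg Complex.re h
    simp at this
    exact hν.ne this
  rw [hankel]
  -- On the two horizontal lines e^w takes the same value, so the contributions of the constant f ν
  -- cancel there and only the vertical side retains one.
  have h1 : (∫ x : ℝ in Ioi X, (f (x + Real.pi * I) *
        (Complex.exp ν / (Complex.exp ν - Complex.exp (x + Real.pi * I))) - f (x - Real.pi * I) *
        (Complex.exp ν / (Complex.exp ν - Complex.exp (x - Real.pi * I))))) =
      ∫ x : ℝ in Ioi X, (p (x + Real.pi * I) - p (x - Real.pi * I)) := by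
    congr 1; ext x
    rw [hp_eq _ (hne x).1, hp_eq _ (hne x).2, exp_horizontal, exp_horizontal']
    ring
  have h2 : (∫ y in (-Real.pi)..Real.pi, p (X + y * I)) =
      (∫ τ in (-Real.pi)..Real.pi, f (X + τ * I) *
        (Complex.exp ν / (Complex.exp ν - Complex.exp (X + τ * I)))) - f ν * (2 * Real.pi) := by
    rw [← integral_vertical_eq hν, ← intervalIntegral.integral_const_mul,
      ← intervalIntegral.integral_sub]
    · congr 1; ext τ
      rw [hp_eq _ (hneX τ)]; ring
    · exact Continuous.intervalIntegrable (by fun_prop) _ _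
    · exact Continuous.intervalIntegrable (by fun_prop) _ _
  rw [h1, hkey, h2]
  ring

/-- The value `exp (c e ^ (-a w))`. -/
def coeff (a c : ℝ) (w : ℂ) : ℂ := Complex.exp (c * Complex.exp (-a * w))

theorem kern_zero (a c : ℝ) (t w : ℂ) :
    kern a c 0 t w = Complex.exp (t * Complex.exp w) * coeff a c w := by
  rw [kern, coeff, pow_zero, one_mul, Complex.exp_add]

theorem norm_coeff_le {a c X : ℝ} (ha : 0 < a) {w : ℂ} (hw : X ≤ w.re) :
    ‖coeff a c w‖ ≤ Real.exp (|c| * Real.exp (-a * X)) := by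
  have := norm_kern a c 0 0 w
  rw [kern_zero] at this
  simp only [zero_mul, Complex.exp_zero, one_mul, pow_zero, zero_re, zero_add] at this
  rw [this]
  exact Real.exp_le_exp.2 (exp_cos_le ha hw _)

theorem integral_exp_mul_kern (a c ν : ℝ) {w : ℂ} (hw : (Complex.exp w).re < Real.exp ν) :
    ∫ t in Ioi (0 : ℝ), (Real.exp ν * Real.exp (-(Real.exp ν * t)) : ℝ) * kern a c 0 t w =
      coeff a c w * (Complex.exp ν / (Complex.exp ν - Complex.exp w)) := by
  have h := integral_exp_mul_complex_Ioi (a := Complex.exp w - Complex.exp ν)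
    (by rw [sub_re, ← ofReal_exp, ofReal_re]; linarith) 0
  have h1 : (fun t : ℝ => ((Real.exp ν * Real.exp (-(Real.exp ν * t)) : ℝ) : ℂ) * kern a c 0 t w) =
      fun t : ℝ => (coeff a c w * Complex.exp ν) *
        Complex.exp ((Complex.exp w - Complex.exp ν) * t) := by
    ext t
    rw [kern_zero, sub_mul, sub_eq_add_neg, Complex.exp_add]
    push_cast
    rw [mul_comm (t : ℂ)]
    ring
  rw [h1, integral_const_mul, h, ofReal_zero, mul_zero, Complex.exp_zero, ← neg_sub, neg_div_neg_eq]
  ring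

theorem integrableOn_exp_neg_mul {b : ℝ} (hb : 0 < b) :
    IntegrableOn (fun t : ℝ => Real.exp (-(b * t))) (Ioi 0) := by
  simpa using integrableOn_exp_mul_Ioi (neg_lt_zero.2 hb) 0

theorem integrableOn_rpow_mul_exp {b : ℝ} (hb : 0 < b) :
    IntegrableOn (fun t : ℝ => t ^ (-(1 / 2) : ℝ) * Real.exp (-(b * t))) (Ioi 0) := by
  have := integrableOn_rpow_mul_exp_neg_mul_rpow (p := 1) (s := -(1 / 2)) (by norm_num) one_pos hb
  simpa using this

/-- Fubini, with e^{-t e^x} ≤ t^{-1/2} e^{-x/2} as a majorant that separates the variables and is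
integrable both at t = 0 and at x = ∞. The offset q stands for πi or -πi. -/
theorem laplace_horizontal {a c : ℝ} (ha : 0 < a) (X : ℝ) {ν : ℝ} {q : ℂ}
    (hq : ∀ x : ℝ, Complex.exp (x + q) = -Real.exp x ∧ ((x : ℂ) + q).re = x) :
    IntegrableOn (fun t : ℝ => (Real.exp ν * Real.exp (-(Real.exp ν * t)) : ℝ) *
      ∫ x in Ioi X, kern a c 0 t (x + q)) (Ioi 0) ∧
    ∫ t in Ioi (0 : ℝ), (Real.exp ν * Real.exp (-(Real.exp ν * t)) : ℝ) *
      (∫ x in Ioi X, kern a c 0 t (x + q)) =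
      ∫ x in Ioi X, coeff a c (x + q) * (Complex.exp ν / (Complex.exp ν - Complex.exp (x + q))) ∧
    IntegrableOn (fun x : ℝ => coeff a c (x + q) *
      (Complex.exp ν / (Complex.exp ν - Complex.exp (x + q)))) (Ioi X) := by
  set N := Real.exp ν with hN
  have hN0 : 0 < N := Real.exp_pos _
  set D := Real.exp (|c| * Real.exp (-a * X))
  have hint : Integrable (Function.uncurry fun (t x : ℝ) =>
      ((N * Real.exp (-(N * t)) : ℝ) : ℂ) * kern a c 0 t (x + q))
      ((volume.restrict (Ioi 0)).prod (volume.restrict (Ioi X))) := by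
    have h1 : Integrable (fun z : ℝ × ℝ => (N * (z.1 ^ (-(1 / 2) : ℝ) * Real.exp (-(N * z.1)))) *
        (D * Real.exp (-(1 / 2) * z.2)))
        ((volume.restrict (Ioi 0)).prod (volume.restrict (Ioi X))) :=
      Integrable.mul_prod ((integrableOn_rpow_mul_exp hN0).const_mul N)
        ((integrableOn_exp_mul_Ioi (by norm_num) X).const_mul D)
    refine h1.mono' (Continuous.aestronglyMeasurable ?_) ?_
    · have := continuous_kern_uncurry a c 0
      exact Continuous.mul (by fun_prop) (this.comp
        (f := fun z : ℝ × ℝ => ((z.1 : ℂ), (z.2 : ℂ) + q)) (by fun_prop))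
    · rw [Measure.prod_restrict]
      filter_upwards [ae_restrict_mem (measurableSet_Ioi.prod measurableSet_Ioi)] with z hz
      have hz1 : 0 < z.1 := hz.1
      have hz2 : X < z.2 := hz.2
      simp only [Function.uncurry]
      rw [norm_mul, Complex.norm_real, Real.norm_of_nonneg (by positivity), kern_zero, norm_mul,
        (hq z.2).1, Complex.norm_exp]
      have e1 : ((z.1 : ℂ) * -(Real.exp z.2 : ℂ)).re = -(z.1 * Real.exp z.2) := by
        rw [re_ofReal_mul, ← ofReal_neg, ofReal_re]; ring
      rw [e1]
      have e2 := exp_neg_mul_exp_le (x := z.2) hz1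
      have e3 : ‖coeff a c (z.2 + q)‖ ≤ D := norm_coeff_le ha (by rw [(hq z.2).2]; exact hz2.le)
      calc _ ≤ N * Real.exp (-(N * z.1)) *
            ((z.1 ^ (-(1 / 2) : ℝ) * Real.exp (-(1 / 2) * z.2)) * D) := by gcongr
        _ = _ := by ring
  have hswap := integral_integral_swap hint
  have hleft := hint.integral_prod_left
  have hright := hint.integral_prod_right
  have hval : ∀ x : ℝ, ∫ t in Ioi (0 : ℝ), ((N * Real.exp (-(N * t)) : ℝ) : ℂ) *
      kern a c 0 t (x + q) =
      coeff a c (x + q) * (Complex.exp ν / (Complex.exp ν - Complex.exp (x + q))) := by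
    intro x
    refine integral_exp_mul_kern a c ν ?_
    rw [(hq x).1, ← ofReal_neg, ofReal_re]
    linarith [Real.exp_pos x, Real.exp_pos ν]
  simp only [Function.uncurry, integral_const_mul, hval] at hswap hleft hright
  exact ⟨hleft, hswap, hright⟩

/-- Fubini again: on Re w = X the kernel grows at most like e^{t e^X}, which e^{-t e^ν} absorbs
because X < ν. -/
theorem laplace_vertical {a c : ℝ} (ha : 0 < a) {X ν : ℝ} (hν : X < ν) :
    IntegrableOn (fun t : ℝ => (Real.exp ν * Real.exp (-(Real.exp ν * t)) : ℝ) *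
      ∫ τ in (-Real.pi)..Real.pi, kern a c 0 t (X + τ * I)) (Ioi 0) ∧
    ∫ t in Ioi (0 : ℝ), (Real.exp ν * Real.exp (-(Real.exp ν * t)) : ℝ) *
      (∫ τ in (-Real.pi)..Real.pi, kern a c 0 t (X + τ * I)) =
      ∫ τ in (-Real.pi)..Real.pi, coeff a c (X + τ * I) *
        (Complex.exp ν / (Complex.exp ν - Complex.exp (X + τ * I))) := by
  simp only [intervalIntegral.integral_of_le (show -Real.pi ≤ Real.pi by linarith [Real.pi_pos])]
  set N := Real.exp ν with hN
  have hN0 : 0 < N := Real.exp_pos _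
  have hNX : Real.exp X < N := Real.exp_lt_exp.2 hν
  set D := Real.exp (|c| * Real.exp (-a * X)) with hD
  have hint : Integrable (Function.uncurry fun (t τ : ℝ) =>
      ((N * Real.exp (-(N * t)) : ℝ) : ℂ) * kern a c 0 t (X + τ * I))
      ((volume.restrict (Ioi 0)).prod (volume.restrict (Ioc (-Real.pi) Real.pi))) := by
    have h1 : Integrable (fun z : ℝ × ℝ => (N * Real.exp (-((N - Real.exp X) * z.1))) * D)
        ((volume.restrict (Ioi 0)).prod (volume.restrict (Ioc (-Real.pi) Real.pi))) :=
      Integrable.mul_prod ((integrableOn_exp_neg_mul (sub_pos.2 hNX)).const_mul N)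
        (integrable_const D)
    refine h1.mono' (Continuous.aestronglyMeasurable ?_) ?_
    · have := continuous_kern_uncurry a c 0
      exact Continuous.mul (by fun_prop) (this.comp
        (f := fun z : ℝ × ℝ => ((z.1 : ℂ), (X : ℂ) + z.2 * I)) (by fun_prop))
    · rw [Measure.prod_restrict]
      filter_upwards [ae_restrict_mem (measurableSet_Ioi.prod measurableSet_Ioc)] with z hz
      have hz1 : 0 < z.1 := hz.1
      simp only [Function.uncurry]
      rw [norm_mul, Complex.norm_real, Real.norm_of_nonneg (by positivity)]
      have e1 := norm_kern_vertical_le (c := c) ha X z.2 hz1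
      calc _ ≤ N * Real.exp (-(N * z.1)) * (D * Real.exp (z.1 * Real.exp X)) := by gcongr
        _ = N * (Real.exp (-(N * z.1)) * Real.exp (z.1 * Real.exp X)) * D := by ring
        _ = _ := by rw [← Real.exp_add]; ring_nf
  have hswap := integral_integral_swap hint
  have hleft := hint.integral_prod_left
  simp only [Function.uncurry, integral_const_mul] at hswap hleft
  refine ⟨hleft, hswap.trans ?_⟩
  congr 1; ext τ
  refine integral_exp_mul_kern a c ν ?_
  refine (re_le_norm _).trans_lt ?_
  rw [Complex.norm_exp]; simpa using hν

theorem integral_mul_sub_add {A B V : ℝ → ℂ} {μ : Measure ℝ} (hA : Integrable A μ)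
    (hB : Integrable B μ) (hV : Integrable V μ) (k : ℂ) :
    ∫ t, k * ((A t - B t) + I * V t) ∂μ =
      k * ((∫ t, A t ∂μ) - (∫ t, B t ∂μ) + I * ∫ t, V t ∂μ) := by
  rw [integral_const_mul, integral_add (f := fun t => A t - B t) (hA.sub hB) (hV.const_mul I),
    integral_sub hA hB, integral_const_mul]

/-- The Laplace transform of `wright a c 0`. -/
theorem laplace_wright {a c : ℝ} (ha : 0 < a) {ν : ℝ} (hν : Real.log 2⁻¹ < ν) :
    ∫ t in Ioi (0 : ℝ), (Real.exp ν * Real.exp (-(Real.exp ν * t)) : ℝ) * wright a c 0 t =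
      coeff a c ν := by
  set X := Real.log 2⁻¹
  have hp := laplace_horizontal (c := c) ha X (ν := ν) (q := Real.pi * I)
    (fun x => ⟨exp_horizontal x, by simp⟩)
  have hm := laplace_horizontal (c := c) ha X (ν := ν) (q := -(Real.pi * I))
    (fun x => ⟨by rw [← sub_eq_add_neg]; exact exp_horizontal' x, by simp⟩)
  have hv := laplace_vertical (c := c) ha hν
  have hres := hankel_eq_residue (f := coeff a c) (by unfold coeff; fun_prop)
    (fun w hw => norm_coeff_le (c := c) ha hw) hν
  have hsplit : ∀ᵐ t : ℝ ∂volume.restrict (Ioi (0 : ℝ)),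
      ((Real.exp ν * Real.exp (-(Real.exp ν * t)) : ℝ) : ℂ) * wright a c 0 t =
      (2 * Real.pi * I)⁻¹ * ((((Real.exp ν * Real.exp (-(Real.exp ν * t)) : ℝ) : ℂ) *
        (∫ x in Ioi X, kern a c 0 t (x + Real.pi * I)) -
        ((Real.exp ν * Real.exp (-(Real.exp ν * t)) : ℝ) : ℂ) *
        (∫ x in Ioi X, kern a c 0 t (x + -(Real.pi * I)))) +
        I * (((Real.exp ν * Real.exp (-(Real.exp ν * t)) : ℝ) : ℂ) *
        ∫ τ in (-Real.pi)..Real.pi, kern a c 0 t (X + τ * I))) := by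
    filter_upwards [ae_restrict_mem measurableSet_Ioi] with t ht
    have hi := integrableOn_kern (c := c) ha 0 (t := t) (by simpa using ht) X
    rw [wright, hankel, integral_sub hi.1 hi.2]
    simp only [sub_eq_add_neg]
    ring
  have hm3 := hm.2.2
  simp only [← sub_eq_add_neg] at hm3
  rw [integral_congr_ae hsplit, integral_mul_sub_add hp.1 hm.1 hv.1, hp.2.1, hm.2.1, hv.2]
  rw [hankel, integral_sub hp.2.2 hm3] at hres
  simp only [sub_eq_add_neg (_ : ℂ) (Real.pi * I)] at hres
  rw [hres]
  field_simp


/-! ### The analytic continuation of the series -/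

/-- The kernel `z e^t / (z + e^t)^2`. -/
def fermi (z t : ℂ) : ℂ := z * Complex.exp (-t) / (1 + z * Complex.exp (-t)) ^ 2

theorem measurable_fermi (z : ℂ) : Measurable (fun t : ℝ => fermi z t) := by
  unfold fermi; fun_prop

theorem continuousOn_wright {a c : ℝ} (ha : 0 < a) (j : ℕ) :
    ContinuousOn (fun t : ℝ => wright a c j t) (Ioi 0) := by
  intro t ht
  exact (ContinuousAt.comp (f := fun t : ℝ => (t : ℂ)) (g := wright a c j)
    (hasDerivAt_wright ha j (t := t) (by simpa using ht)).continuousAt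
    (by fun_prop)).continuousWithinAt

theorem aestronglyMeasurable_wright {a c : ℝ} (ha : 0 < a) (j : ℕ) :
    AEStronglyMeasurable (fun t : ℝ => wright a c j t) (volume.restrict (Ioi 0)) :=
  (continuousOn_wright ha j).aestronglyMeasurable measurableSet_Ioi

theorem integrableOn_exp_mul_wright {a c : ℝ} (ha : 0 < a) :
    IntegrableOn (fun t : ℝ => Real.exp (-t) * ‖wright a c 0 t‖) (Ioi 0) := by
  obtain ⟨C, hC0, hC⟩ := exists_wright_zero_bound (c := c) ha
  have h1 : IntegrableOn (fun t : ℝ => C * (t ^ (-(1 / 2) : ℝ) * Real.exp (-(1 * t)) +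
      Real.exp (-(1 / 2 * t)))) (Ioi 0) :=
    ((integrableOn_rpow_mul_exp one_pos).add (integrableOn_exp_neg_mul (by norm_num))).const_mul C
  refine h1.mono' ((Continuous.aestronglyMeasurable (by fun_prop)).mul
    (aestronglyMeasurable_wright ha 0).norm) ?_
  filter_upwards [ae_restrict_mem measurableSet_Ioi] with t ht
  rw [Real.norm_of_nonneg (by positivity)]
  calc _ ≤ Real.exp (-t) * (C * (t ^ (-(1 / 2) : ℝ) + Real.exp (t / 2))) := by
        gcongr; exact hC t ht
    _ = C * (t ^ (-(1 / 2) : ℝ) * Real.exp (-(1 * t)) + Real.exp (-t) * Real.exp (t / 2)) := by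
        rw [one_mul]; ring
    _ = _ := by rw [← Real.exp_add]; congr 3; ring

/-- The analytic continuation of `∑ n ≥ 1, exp (c n ^ (-a)) (-z) ^ n`. -/
def genExp (a c : ℝ) (z : ℂ) : ℂ := -∫ t in Ioi (0 : ℝ), wright a c 0 t * fermi z t

theorem coeff_log (a c : ℝ) {x : ℝ} (hx : 0 < x) :
    coeff a c (Real.log x : ℝ) = (Real.exp (c * x ^ (-a)) : ℝ) := by
  rw [coeff, Real.rpow_def_of_pos hx]
  push_cast
  ring_nf

/-- With r = -z e^{-t}, ∑ n rⁿ = r / (1 - r)², which is minus the kernel `fermi`; the factor n is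
the normalisation of the Laplace transform. Interchange of sum and integral is paid for by ∑ n |z|ⁿ
< ∞. -/
theorem hasSum_genExp {a c : ℝ} (ha : 0 < a) {z : ℂ} (hz : ‖z‖ < 1) :
    HasSum (fun n : ℕ => (Real.exp (c * ((n + 1 : ℕ) : ℝ) ^ (-a)) : ℂ) * (-z) ^ (n + 1))
      (genExp a c z) := by
  set F : ℕ → ℝ → ℂ := fun n t => (-z) ^ (n + 1) *
    (((Real.exp (Real.log ((n + 1 : ℕ) : ℝ)) *
      Real.exp (-(Real.exp (Real.log ((n + 1 : ℕ) : ℝ)) * t)) : ℝ) : ℂ) * wright a c 0 t) with hF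
  have hpos : ∀ n : ℕ, (0 : ℝ) < ((n + 1 : ℕ) : ℝ) := fun n => by positivity
  have hFb : ∀ n, ∀ t ∈ Ioi (0 : ℝ), ‖F n t‖ ≤
      (((n + 1 : ℕ) : ℝ) * ‖z‖ ^ (n + 1)) * (Real.exp (-t) * ‖wright a c 0 t‖) := by
    intro n t ht
    have ht : 0 < t := ht
    simp only [hF]
    rw [Real.exp_log (hpos n), norm_mul, norm_mul, norm_pow, norm_neg, Complex.norm_real,
      Real.norm_of_nonneg (by positivity)]
    have h1 : Real.exp (-(((n + 1 : ℕ) : ℝ) * t)) ≤ Real.exp (-t) := by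
      apply Real.exp_le_exp.2
      push_cast
      nlinarith [(Nat.cast_nonneg n : (0 : ℝ) ≤ n)]
    calc _ ≤ ‖z‖ ^ (n + 1) * (((n + 1 : ℕ) : ℝ) * Real.exp (-t) * ‖wright a c 0 t‖) := by gcongr
      _ = _ := by ring
  have hW := integrableOn_exp_mul_wright (c := c) ha
  have hFm : ∀ n, AEStronglyMeasurable (F n) (volume.restrict (Ioi 0)) := fun n =>
    ((Continuous.aestronglyMeasurable (by fun_prop)).mul
      (aestronglyMeasurable_wright ha 0)).const_mul _
  have hFi : ∀ n, IntegrableOn (F n) (Ioi 0) := fun n => by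
    refine (hW.const_mul (((n + 1 : ℕ) : ℝ) * ‖z‖ ^ (n + 1))).mono' (hFm n) ?_
    filter_upwards [ae_restrict_mem measurableSet_Ioi] with t ht using hFb n t ht
  have hsum : Summable fun n => ∫ t in Ioi (0 : ℝ), ‖F n t‖ := by
    have h0 : Summable fun n : ℕ => (n : ℝ) * ‖z‖ ^ n :=
      (hasSum_coe_mul_geometric_of_norm_lt_one (r := ‖z‖) (by simpa using hz)).summable
    have h1 := ((summable_nat_add_iff 1).2 h0).mul_right
      (∫ t in Ioi (0 : ℝ), Real.exp (-t) * ‖wright a c 0 t‖)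
    refine h1.of_nonneg_of_le (fun n => integral_nonneg fun t => norm_nonneg _) fun n => ?_
    rw [← integral_const_mul]
    refine setIntegral_mono_on (hFi n).norm (hW.const_mul _) measurableSet_Ioi fun t ht => ?_
    exact hFb n t ht
  have hmain := hasSum_integral_of_summable_integral_norm hFi hsum
  have e1 : (fun n => ∫ t in Ioi (0 : ℝ), F n t) = fun n : ℕ =>
      (Real.exp (c * ((n + 1 : ℕ) : ℝ) ^ (-a)) : ℂ) * (-z) ^ (n + 1) := by
    ext n
    simp only [hF]
    rw [integral_const_mul, laplace_wright ha, coeff_log a c (hpos n), mul_comm]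
    -- The abscissa log 2⁻¹ of the contour lies to the left of every ν = log (n + 1) ≥ 0.
    · refine Real.log_lt_log (by norm_num) ?_
      have : (1 : ℝ) ≤ ((n + 1 : ℕ) : ℝ) := by push_cast; linarith [(Nat.cast_nonneg n : (0 : ℝ) ≤ n)]
      linarith [show (2 : ℝ)⁻¹ < 1 by norm_num]
  have e2 : ∫ t in Ioi (0 : ℝ), (∑' n, F n t) = genExp a c z := by
    rw [genExp, ← integral_neg]
    refine setIntegral_congr_fun measurableSet_Ioi fun t ht => ?_
    have ht : 0 < t := ht
    set r : ℂ := -(z * Complex.exp (-t)) with hr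
    have hr1 : ‖r‖ < 1 := by
      rw [hr, norm_neg, norm_mul, Complex.norm_exp]
      have : Real.exp (-(t : ℂ)).re ≤ 1 := Real.exp_le_one_iff.2 (by simp; exact ht.le)
      nlinarith [norm_nonneg z, Real.exp_pos (-(t : ℂ)).re]
    -- Shifting the index by one loses nothing, since the term of ∑ n rⁿ at n = 0 vanishes.
    have h2 := (hasSum_nat_add_iff (f := fun n : ℕ => (n : ℂ) * r ^ n) 1).2
      (by simpa using hasSum_coe_mul_geometric_of_norm_lt_one hr1)
    have h3 := (h2.mul_right (wright a c 0 t)).tsum_eq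
    have h4 : ∀ n, F n t = (((n + 1 : ℕ) : ℂ) * r ^ (n + 1)) * wright a c 0 t := by
      intro n
      simp only [hF]
      have hrn : r ^ (n + 1) = (-z) ^ (n + 1) * Complex.exp (-((n + 1) * t)) := by
        rw [hr, neg_mul_eq_neg_mul, mul_pow, ← Complex.exp_nat_mul]
        push_cast
        ring_nf
      rw [Real.exp_log (hpos n), hrn]
      push_cast
      ring
    simp only [h4]
    rw [h3, fermi, hr]
    ring
  rwa [e1, e2] at hmain

theorem isOpen_slitDomain : IsOpen slitDomain :=
  Complex.isOpen_slitPlane.preimage (by fun_prop)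

theorem isPreconnected_slitDomain : IsPreconnected slitDomain := by
  have h : slitDomain = (fun z : ℂ => z - 1) '' Complex.slitPlane := by
    ext z
    simp only [slitDomain, mem_ofPred_eq, mem_image]
    exact ⟨fun h => ⟨z + 1, h, by ring⟩, by rintro ⟨w, hw, rfl⟩; simpa using hw⟩
  rw [h]
  have h1 : IsPreconnected Complex.slitPlane :=
    (Complex.starConvex_one_slitPlane.isPathConnected
      Complex.one_mem_slitPlane).isConnected.isPreconnected
  exact h1.image _ (by fun_prop)

/-- Here u plays the role of e^{-t}: 1 + zu = 0 with 0 < u ≤ 1 forces z = -1/u ≤ -1, so the kernel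
is singular only for z on the cut. -/
theorem one_add_mul_ne_zero {z : ℂ} (hz : z ∈ slitDomain) {u : ℝ} (hu : u ∈ Icc (0 : ℝ) 1) :
    1 + z * u ≠ 0 := by
  intro h
  have hre := congrArg Complex.re h
  have him := congrArg Complex.im h
  rw [add_re, one_re, re_mul_ofReal, zero_re] at hre
  rw [add_im, one_im, im_mul_ofReal, zero_im, zero_add] at him
  have hu0 : u ≠ 0 := by rintro rfl; simp at hre
  have hu1 : 0 < u := lt_of_le_of_ne hu.1 (Ne.symm hu0)
  have hz0 : z.im = 0 := by simpa [hu0] using him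
  rcases Complex.mem_slitPlane_iff.1 hz with h1 | h1
  · rw [add_re, one_re] at h1
    nlinarith [hu.2]
  · apply h1; simp [hz0]

theorem exists_lower_bound {z₀ : ℂ} (hz : z₀ ∈ slitDomain) :
    ∃ m : ℝ, 0 < m ∧ ∀ z ∈ Metric.ball z₀ m, ∀ u ∈ Icc (0 : ℝ) 1, m ≤ ‖1 + z * u‖ := by
  obtain ⟨u₀, hu₀, hmin⟩ := isCompact_Icc.exists_isMinOn (nonempty_Icc.2 zero_le_one)
    (f := fun u : ℝ => ‖1 + z₀ * u‖) (s := Icc (0 : ℝ) 1) (by fun_prop)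
  have hm : 0 < ‖1 + z₀ * u₀‖ := norm_pos_iff.2 (one_add_mul_ne_zero hz hu₀)
  refine ⟨‖1 + z₀ * u₀‖ / 2, by positivity, fun z hz u hu => ?_⟩
  have h1 : ‖1 + z₀ * u₀‖ ≤ ‖1 + z₀ * u‖ := hmin hu
  have h2 : ‖(z - z₀) * u‖ ≤ ‖1 + z₀ * u₀‖ / 2 := by
    rw [norm_mul, Complex.norm_real, Real.norm_of_nonneg hu.1]
    have h3 : ‖z - z₀‖ < ‖1 + z₀ * u₀‖ / 2 := by simpa [dist_eq_norm] using hz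
    nlinarith [hu.2, hu.1, norm_nonneg (z - z₀)]
  have h3 : 1 + z₀ * u = (1 + z * u) - (z - z₀) * u := by ring
  have h4 := norm_sub_le (1 + z * u) ((z - z₀) * u)
  rw [← h3] at h4
  linarith

theorem exp_neg_mem_Icc {t : ℝ} (ht : 0 < t) : Real.exp (-t) ∈ Icc (0 : ℝ) 1 :=
  ⟨(Real.exp_pos _).le, Real.exp_le_one_iff.2 (by linarith)⟩

/-- The kernel and its z-derivative are O(e^{-t}) locally uniformly in z, by the lower bound for |1
+ zu| on the compact range of u, and e^{-t} |W(t)| is integrable. -/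
theorem differentiableOn_genExp {a c : ℝ} (ha : 0 < a) :
    DifferentiableOn ℂ (genExp a c) slitDomain := by
  intro z₀ hz₀
  obtain ⟨m, hm, hlow⟩ := exists_lower_bound hz₀
  have hW := integrableOn_exp_mul_wright (c := c) ha
  have hWm := aestronglyMeasurable_wright (c := c) ha 0
  have hlow' : ∀ z ∈ Metric.ball z₀ m, ∀ t ∈ Ioi (0 : ℝ), m ≤ ‖1 + z * Complex.exp (-t)‖ := by
    intro z hz t ht
    have := hlow z hz _ (exp_neg_mem_Icc ht)
    simpa using this
  have hball : ∀ z ∈ Metric.ball z₀ m, ‖z‖ ≤ ‖z₀‖ + m := by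
    intro z hz
    have h1 : ‖z - z₀‖ < m := by simpa [dist_eq_norm] using hz
    have := norm_add_le z₀ (z - z₀)
    rw [add_sub_cancel] at this
    linarith
  have hnexp : ∀ t : ℝ, ‖Complex.exp (-(t : ℂ))‖ = Real.exp (-t) := fun t => by
    rw [Complex.norm_exp]; simp
  set F' : ℂ → ℝ → ℂ := fun z t => wright a c 0 t *
    (Complex.exp (-t) * (1 - z * Complex.exp (-t)) / (1 + z * Complex.exp (-t)) ^ 3) with hF'
  have key := (hasDerivAt_integral_of_dominated_loc_of_deriv_le (μ := volume.restrict (Ioi (0 : ℝ)))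
      (F := fun z (t : ℝ) => wright a c 0 t * fermi z t) (F' := F')
      (bound := fun t => ((1 + (‖z₀‖ + m)) / m ^ 3) * (Real.exp (-t) * ‖wright a c 0 t‖))
      (Metric.ball_mem_nhds z₀ hm)
      (Eventually.of_forall fun z => hWm.mul (measurable_fermi z).aestronglyMeasurable)
      ?_ (hWm.mul (Measurable.aestronglyMeasurable (by fun_prop))) ?_ (hW.const_mul _) ?_).2
  · exact (key.neg.differentiableAt).differentiableWithinAt
  · refine (hW.const_mul ((‖z₀‖ + m) / m ^ 2)).mono'
      (hWm.mul (measurable_fermi z₀).aestronglyMeasurable) ?_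
    filter_upwards [ae_restrict_mem measurableSet_Ioi] with t ht
    have h1 := hlow' z₀ (Metric.mem_ball_self hm) t ht
    rw [fermi, norm_mul, norm_div, norm_mul, norm_pow, hnexp]
    calc _ ≤ ‖wright a c 0 t‖ * ((‖z₀‖ + m) * Real.exp (-t) / m ^ 2) := by gcongr; linarith
      _ = _ := by ring
  · filter_upwards [ae_restrict_mem measurableSet_Ioi] with t ht z hz
    have h1 := hlow' z hz t ht
    simp only [hF']
    rw [norm_mul, norm_div, norm_mul, norm_pow, hnexp]
    have h2 : ‖1 - z * Complex.exp (-(t : ℂ))‖ ≤ 1 + (‖z₀‖ + m) := by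
      refine (norm_sub_le _ _).trans ?_
      rw [norm_one, norm_mul, hnexp]
      have := hball z hz
      have h3 := (exp_neg_mem_Icc ht).2
      nlinarith [norm_nonneg z, Real.exp_pos (-t)]
    calc _ ≤ ‖wright a c 0 t‖ * (Real.exp (-t) * (1 + (‖z₀‖ + m)) / m ^ 3) := by gcongr
      _ = _ := by ring
  · filter_upwards [ae_restrict_mem measurableSet_Ioi] with t ht z hz
    have h1 : 1 + z * Complex.exp (-(t : ℂ)) ≠ 0 := by
      have := hlow' z hz t ht
      intro h0
      rw [h0, norm_zero] at this
      linarith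
    have hd1 : HasDerivAt (fun z : ℂ => z * Complex.exp (-(t : ℂ))) (Complex.exp (-(t : ℂ))) z := by
      simpa using (hasDerivAt_id z).mul_const (Complex.exp (-(t : ℂ)))
    have hd2 := hd1.div ((hd1.const_add 1).pow 2) (pow_ne_zero 2 h1)
    refine HasDerivAt.congr_deriv (hd2.const_mul (wright a c 0 t)) ?_
    simp only [hF', Pi.pow_apply]
    congr 1
    rw [div_eq_div_iff (pow_ne_zero 2 (pow_ne_zero 2 h1)) (pow_ne_zero 3 h1)]
    push_cast
    ring

theorem isGeneralizedExp_genExp {a c : ℝ} (ha : 0 < a) :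
    IsGeneralizedExp c (-a) (genExp a c) :=
  ⟨(differentiableOn_genExp ha).analyticOnNhd isOpen_slitDomain, fun _ hz => hasSum_genExp ha hz⟩

theorem IsGeneralizedExp.eqOn_genExp {a c : ℝ} (ha : 0 < a) {E : ℂ → ℂ}
    (hE : IsGeneralizedExp c (-a) E) : EqOn E (genExp a c) slitDomain := by
  have hG := isGeneralizedExp_genExp (c := c) ha
  refine hE.analytic.eqOn_of_preconnected_of_eventuallyEq hG.analytic isPreconnected_slitDomain
    (z₀ := 0) (by simp [slitDomain]) ?_
  filter_upwards [Metric.ball_mem_nhds (0 : ℂ) one_pos] with z hz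
  have hz : ‖z‖ < 1 := by simpa using hz
  exact (hE.hasSum z hz).unique (hG.hasSum z hz)


/-! ### Geometry of the steepest descent segment -/

/-- The phase function; its saddle points in the strip `|Im w| ≤ π` are `± i π / (1 + a)`. -/
def psi (a : ℝ) (w : ℂ) : ℂ := Complex.exp w - Complex.exp (-a * w) / a

/-- Half of the argument of the upper saddle point. -/
def halfAngle (a : ℝ) : ℝ := Real.pi / (2 * (1 + a))

/-- At the saddle w₀ = iπ/(1 + a) one has psi''(w₀) = (1 + a) e^{w₀}; this is a unit vector with
e^{w₀} dir² = -1, so the second derivative along it is real and negative. -/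
def dir (a : ℝ) : ℂ := Real.sin (halfAngle a) + Real.cos (halfAngle a) * I

/-- The line of steepest descent through the upper saddle point. -/
def path (a v : ℝ) : ℂ := ((2 * halfAngle a : ℝ) : ℂ) * I + v * dir a

/-- `lo` and `hi` are the parameters at which the line through the saddle meets Im w = 0 and Im w =
π. -/
def lo (a : ℝ) : ℝ := -(2 * halfAngle a) / Real.cos (halfAngle a)

def hi (a : ℝ) : ℝ := (2 * a * halfAngle a) / Real.cos (halfAngle a)

section
variable {a : ℝ} (ha : 0 < a)
include ha

theorem halfAngle_pos : 0 < halfAngle a := by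
  have := Real.pi_pos; unfold halfAngle; positivity

theorem halfAngle_eq : 2 * a * halfAngle a = Real.pi - 2 * halfAngle a := by
  unfold halfAngle; field_simp; ring

theorem halfAngle_lt : halfAngle a < Real.pi / 2 := by
  have := halfAngle_pos ha
  have := halfAngle_eq ha
  nlinarith

theorem cos_halfAngle_pos : 0 < Real.cos (halfAngle a) :=
  Real.cos_pos_of_mem_Ioo ⟨by linarith [halfAngle_pos ha, Real.pi_pos], halfAngle_lt ha⟩

theorem sin_halfAngle_pos : 0 < Real.sin (halfAngle a) :=
  Real.sin_pos_of_pos_of_lt_pi (halfAngle_pos ha) (by linarith [halfAngle_lt ha, Real.pi_pos])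

theorem lo_neg : lo a < 0 :=
  div_neg_of_neg_of_pos (by linarith [halfAngle_pos ha]) (cos_halfAngle_pos ha)

theorem hi_pos : 0 < hi a :=
  div_pos (by have := halfAngle_pos ha; positivity) (cos_halfAngle_pos ha)

theorem path_lo : path a (lo a) = ((lo a * Real.sin (halfAngle a) : ℝ) : ℂ) := by
  have h := (cos_halfAngle_pos ha).ne'
  apply Complex.ext
  · simp [path, dir, -ofReal_sin, -ofReal_cos]
  · simp only [path, dir]
    simp [-ofReal_sin, -ofReal_cos, -ofReal_mul]
    rw [lo]; field_simp; ring

theorem path_hi : path a (hi a) = ((hi a * Real.sin (halfAngle a) : ℝ) : ℂ) + Real.pi * I := by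
  have h := (cos_halfAngle_pos ha).ne'
  have h2 := halfAngle_eq ha
  apply Complex.ext
  · simp [path, dir, -ofReal_sin, -ofReal_cos]
  · simp only [path, dir]
    simp [-ofReal_sin, -ofReal_cos, -ofReal_mul]
    rw [hi]; field_simp; linarith

/-- At the saddle e^{-a w₀} = -e^{w₀}, because 2aβ = π - 2β for the half angle β; hence e^{w₀}
factors out and both exponentials get the same sign. -/
theorem psi_path (v : ℝ) : psi a (path a v) = Complex.exp ((2 * halfAngle a : ℝ) * I) *
    (Complex.exp (v * dir a) + Complex.exp (-a * v * dir a) / a) := by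
  have h : Complex.exp (-a * (((2 * halfAngle a : ℝ) : ℂ) * I)) =
      -Complex.exp ((2 * halfAngle a : ℝ) * I) := by
    rw [show -(a : ℂ) * (((2 * halfAngle a : ℝ) : ℂ) * I) =
      ((-(2 * a * halfAngle a) : ℝ) : ℂ) * I by push_cast; ring, halfAngle_eq ha,
      show ((-(Real.pi - 2 * halfAngle a) : ℝ) : ℂ) * I =
        ((2 * halfAngle a : ℝ) : ℂ) * I - Real.pi * I by push_cast; ring, Complex.exp_sub,
      Complex.exp_pi_mul_I]
    ring
  rw [psi, path, mul_add, Complex.exp_add, Complex.exp_add, h, ← mul_assoc]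
  ring

theorem psi_path_zero : psi a (path a 0) = Complex.exp ((2 * halfAngle a : ℝ) * I) * (1 + 1 / a) := by
  rw [psi_path ha]; simp

theorem psi_path_zero_re : (psi a (path a 0)).re = (1 + 1 / a) * Real.cos (2 * halfAngle a) := by
  rw [psi_path_zero ha, show (1 + 1 / (a : ℂ)) = ((1 + 1 / a : ℝ) : ℂ) by push_cast; ring,
    re_mul_ofReal, Complex.exp_ofReal_mul_I_re]; ring

theorem psi_path_zero_im : (psi a (path a 0)).im = (1 + 1 / a) * Real.sin (2 * halfAngle a) := by
  rw [psi_path_zero ha, show (1 + 1 / (a : ℂ)) = ((1 + 1 / a : ℝ) : ℂ) by push_cast; ring,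
    im_mul_ofReal, Complex.exp_ofReal_mul_I_im]; ring

omit ha in
theorem re_exp_rot (β x y : ℝ) :
    (Complex.exp ((2 * β : ℝ) * I) * Complex.exp (x + y * I)).re =
      Real.exp x * Real.cos (2 * β + y) := by
  rw [← Complex.exp_add, Complex.exp_re]; simp

theorem psi_path_re (v : ℝ) : (psi a (path a v)).re =
    Real.exp (v * Real.sin (halfAngle a)) *
        Real.cos (2 * halfAngle a + v * Real.cos (halfAngle a)) +
      Real.exp (-a * v * Real.sin (halfAngle a)) *
        Real.cos (2 * halfAngle a + -a * v * Real.cos (halfAngle a)) / a := by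
  rw [psi_path ha, mul_add, add_re, ← mul_div_assoc, div_ofReal_re]
  congr 2
  · rw [← re_exp_rot, dir]
    congr 3; push_cast; ring
  · rw [← re_exp_rot, dir]
    congr 3; push_cast; ring

omit ha in
theorem hasDerivAt_exp_mul_cos (β k v : ℝ) :
    HasDerivAt (fun v : ℝ => Real.exp (k * v * Real.sin β) * Real.cos (2 * β + k * v * Real.cos β))
      (-k * (Real.exp (k * v * Real.sin β) * Real.sin (β + k * v * Real.cos β))) v := by
  have h1 : HasDerivAt (fun v : ℝ => k * v * Real.sin β) (k * Real.sin β) v := by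
    simpa using ((hasDerivAt_id v).const_mul k).mul_const (Real.sin β)
  have h2 : HasDerivAt (fun v : ℝ => 2 * β + k * v * Real.cos β) (k * Real.cos β) v := by
    simpa using (((hasDerivAt_id v).const_mul k).mul_const (Real.cos β)).const_add (2 * β)
  refine (h1.exp.mul h2.cos).congr_deriv ?_
  have h3 : Real.sin (β + k * v * Real.cos β) =
      Real.sin (2 * β + k * v * Real.cos β) * Real.cos β -
      Real.cos (2 * β + k * v * Real.cos β) * Real.sin β := by
    rw [← Real.sin_sub]; ring_nf
  rw [h3]; ring

/-- The two terms cancel at v = 0, where both sines equal that of the half angle. Monotonicity on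
either side amounts to comparing each term with this common value. -/
theorem hasDerivAt_psi_path_re (v : ℝ) : HasDerivAt (fun v => (psi a (path a v)).re)
    (-(Real.exp (v * Real.sin (halfAngle a)) *
        Real.sin (halfAngle a + v * Real.cos (halfAngle a))) +
      Real.exp (-(a * (v * Real.sin (halfAngle a)))) *
        Real.sin (halfAngle a - a * (v * Real.cos (halfAngle a)))) v := by
  simp only [psi_path_re ha]
  have h1 := hasDerivAt_exp_mul_cos (halfAngle a) 1 v
  have h2 := (hasDerivAt_exp_mul_cos (halfAngle a) (-a) v).div_const a
  simp only [one_mul] at h1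
  refine (h1.add h2).congr_deriv ?_
  rw [show -a * v * Real.sin (halfAngle a) = -(a * (v * Real.sin (halfAngle a))) by ring,
    show halfAngle a + -a * v * Real.cos (halfAngle a) =
      halfAngle a - a * (v * Real.cos (halfAngle a)) by ring]
  field_simp

theorem sin_halfAngle_lt {δ : ℝ} (h0 : 0 < δ) (h1 : δ < Real.pi - 2 * halfAngle a) :
    Real.sin (halfAngle a) < Real.sin (halfAngle a + δ) := by
  have hb := halfAngle_pos ha
  have h : Real.sin (halfAngle a + δ) - Real.sin (halfAngle a) =
      2 * Real.sin (δ / 2) * Real.cos (halfAngle a + δ / 2) := by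
    rw [Real.sin_sub_sin]; ring_nf
  have h2 : 0 < Real.sin (δ / 2) := Real.sin_pos_of_pos_of_lt_pi (by linarith) (by linarith)
  have h3 : 0 < Real.cos (halfAngle a + δ / 2) :=
    Real.cos_pos_of_mem_Ioo ⟨by linarith [Real.pi_pos], by linarith⟩
  have : 0 < 2 * Real.sin (δ / 2) * Real.cos (halfAngle a + δ / 2) := by positivity
  linarith

theorem sin_sub_le_sin_halfAngle {y : ℝ} (h0 : 0 ≤ y) (h1 : y ≤ Real.pi + 2 * halfAngle a) :
    Real.sin (halfAngle a - y) ≤ Real.sin (halfAngle a) := by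
  have hb := halfAngle_pos ha
  have hb2 := halfAngle_lt ha
  have h : Real.sin (halfAngle a) - Real.sin (halfAngle a - y) =
      2 * Real.sin (y / 2) * Real.cos (halfAngle a - y / 2) := by
    rw [Real.sin_sub_sin]; ring_nf
  have h2 : 0 ≤ Real.sin (y / 2) := Real.sin_nonneg_of_nonneg_of_le_pi (by linarith) (by linarith)
  have h3 : 0 ≤ Real.cos (halfAngle a - y / 2) :=
    Real.cos_nonneg_of_mem_Icc ⟨by linarith, by linarith⟩
  have : 0 ≤ 2 * Real.sin (y / 2) * Real.cos (halfAngle a - y / 2) := by positivity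
  linarith

theorem sin_add_lt_sin_halfAngle {δ : ℝ} (h0 : δ < 0) (h1 : -(2 * halfAngle a) < δ) :
    Real.sin (halfAngle a + δ) < Real.sin (halfAngle a) :=
  Real.sin_lt_sin_of_lt_of_le_pi_div_two (by linarith [halfAngle_lt ha]) (halfAngle_lt ha).le
    (by linarith)

/-- Let β be the half angle. For lo < v < 0 the angle β + v cos β drops below β and has weight at
most 1, while β - a v cos β lies in (β, π - β), where the sine exceeds sin β, and has weight at
least 1. So the derivative is positive. -/
theorem psi_path_re_lt_of_neg {v : ℝ} (h0 : lo a ≤ v) (h1 : v < 0) :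
    (psi a (path a v)).re < (psi a (path a 0)).re := by
  have hC := cos_halfAngle_pos ha
  have hS := sin_halfAngle_pos ha
  have hmono : StrictMonoOn (fun v => (psi a (path a v)).re) (Icc (lo a) 0) := by
    refine strictMonoOn_of_deriv_pos (convex_Icc _ _)
      (fun v _ => (hasDerivAt_psi_path_re ha v).continuousAt.continuousWithinAt) fun v hv => ?_
    rw [interior_Icc] at hv
    rw [(hasDerivAt_psi_path_re ha v).deriv]
    have hδ0 : v * Real.cos (halfAngle a) < 0 := mul_neg_of_neg_of_pos hv.2 hC
    have hδ1 : -(2 * halfAngle a) < v * Real.cos (halfAngle a) := by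
      have := hv.1; rw [lo, div_lt_iff₀ hC] at this; exact this
    have hx : v * Real.sin (halfAngle a) < 0 := mul_neg_of_neg_of_pos hv.2 hS
    have e1 : Real.sin (halfAngle a) < Real.sin (halfAngle a - a * (v * Real.cos (halfAngle a))) := by
      rw [sub_eq_add_neg]
      refine sin_halfAngle_lt ha (by nlinarith) ?_
      rw [← halfAngle_eq ha]; nlinarith
    have e2 := sin_add_lt_sin_halfAngle ha hδ0 hδ1
    have e3 : 1 ≤ Real.exp (-(a * (v * Real.sin (halfAngle a)))) := Real.one_le_exp (by nlinarith)
    have e4 : Real.exp (v * Real.sin (halfAngle a)) ≤ 1 := Real.exp_le_one_iff.2 hx.le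
    have e5 := Real.exp_pos (v * Real.sin (halfAngle a))
    have e6 : Real.exp (v * Real.sin (halfAngle a)) *
        Real.sin (halfAngle a + v * Real.cos (halfAngle a)) < Real.sin (halfAngle a) := by
      rcases le_or_gt (Real.sin (halfAngle a + v * Real.cos (halfAngle a))) 0 with h | h <;>
        nlinarith
    nlinarith
  exact hmono ⟨h0, h1.le⟩ ⟨(lo_neg ha).le, le_rfl⟩ h1

theorem exp_mul_sin_gt {v : ℝ} (h0 : 0 < v) (h1 : v < hi a) :
    Real.sin (halfAngle a) < Real.exp (v * Real.sin (halfAngle a)) *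
      Real.sin (halfAngle a + v * Real.cos (halfAngle a)) := by
  have hC := cos_halfAngle_pos ha
  have hS := sin_halfAngle_pos ha
  have hδ1 : v * Real.cos (halfAngle a) < Real.pi - 2 * halfAngle a := by
    rw [hi, lt_div_iff₀ hC, halfAngle_eq ha] at h1; exact h1
  have e1 := sin_halfAngle_lt ha (mul_pos h0 hC) hδ1
  have e2 : 1 ≤ Real.exp (v * Real.sin (halfAngle a)) := Real.one_le_exp (by positivity)
  nlinarith

/-- The first sine term stays above sin β up to the end of the segment. The second stays at most sin
β as long as its angle has turned by no more than π + 2β, so on this range the derivative is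
negative. -/
theorem psi_path_re_lt_of_small {v : ℝ} (h0 : 0 < v) (h1 : v ≤ hi a)
    (h2 : a * (v * Real.cos (halfAngle a)) ≤ Real.pi + 2 * halfAngle a) :
    (psi a (path a v)).re < (psi a (path a 0)).re := by
  have hC := cos_halfAngle_pos ha
  have hS := sin_halfAngle_pos ha
  have hmono : StrictAntiOn (fun v => (psi a (path a v)).re) (Icc 0 v) := by
    refine strictAntiOn_of_deriv_neg (convex_Icc _ _)
      (fun v _ => (hasDerivAt_psi_path_re ha v).continuousAt.continuousWithinAt) fun u hu => ?_
    rw [interior_Icc] at hu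
    rw [(hasDerivAt_psi_path_re ha u).deriv]
    have e1 := exp_mul_sin_gt ha hu.1 (hu.2.trans_le h1)
    have hu0 := hu.1
    have e2 : Real.sin (halfAngle a - a * (u * Real.cos (halfAngle a))) ≤
        Real.sin (halfAngle a) :=
      sin_sub_le_sin_halfAngle ha (by positivity) (le_trans (by gcongr; exact hu.2.le) h2)
    have e3 : Real.exp (-(a * (u * Real.sin (halfAngle a)))) ≤ 1 :=
      Real.exp_le_one_iff.2 (by have : 0 ≤ a * (u * Real.sin (halfAngle a)) := by positivity
                                linarith)
    have e4 := Real.exp_pos (-(a * (u * Real.sin (halfAngle a))))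
    have e5 : Real.exp (-(a * (u * Real.sin (halfAngle a)))) *
        Real.sin (halfAngle a - a * (u * Real.cos (halfAngle a))) ≤ Real.sin (halfAngle a) := by
      rcases le_or_gt (Real.sin (halfAngle a - a * (u * Real.cos (halfAngle a)))) 0 with h | h <;>
        nlinarith
    linarith
  exact hmono ⟨le_rfl, h0.le⟩ ⟨h0.le, le_rfl⟩ h0

/-- Once the second angle has turned further, the sign of the derivative is no longer clear, and the
two terms of Re psi are bounded separately: the first is decreasing, hence at most cos 2β, and in
the second the exponential alone has fallen below cos 2β. -/
theorem psi_path_re_lt_of_large {v : ℝ} (h0 : 0 < v) (h1 : v ≤ hi a)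
    (h2 : Real.pi + 2 * halfAngle a < a * (v * Real.cos (halfAngle a))) :
    (psi a (path a v)).re < (psi a (path a 0)).re := by
  have hC := cos_halfAngle_pos ha
  have hS := sin_halfAngle_pos ha
  have hb := halfAngle_pos ha
  have heq := halfAngle_eq ha
  set β := halfAngle a with hβ
  have hδ1 : v * Real.cos β ≤ 2 * a * β := by
    rw [hi, le_div_iff₀ hC] at h1; exact h1
  -- As π = 2β(1 + a) and v cos β ≤ 2aβ, the case hypothesis gives 2 + a < a².
  have ha2 : 2 < a := by
    have e1 : a * (v * Real.cos β) ≤ a * (2 * a * β) := by gcongr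
    have e2 : 2 * β * (2 + a) < 2 * β * (a * a) := by nlinarith
    have e3 := lt_of_mul_lt_mul_left e2 (by positivity)
    nlinarith
  have hβ6 : 6 * β < Real.pi := by nlinarith
  have hanti : AntitoneOn (fun v : ℝ => Real.exp (1 * v * Real.sin β) *
      Real.cos (2 * β + 1 * v * Real.cos β)) (Icc 0 v) := by
    refine antitoneOn_of_deriv_nonpos (convex_Icc _ _)
      (fun v _ => (hasDerivAt_exp_mul_cos β 1 v).continuousAt.continuousWithinAt)
      (fun v _ => (hasDerivAt_exp_mul_cos β 1 v).differentiableAt.differentiableWithinAt)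
      fun u hu => ?_
    rw [interior_Icc] at hu
    rw [(hasDerivAt_exp_mul_cos β 1 u).deriv]
    have := exp_mul_sin_gt ha hu.1 (hu.2.trans_le h1)
    simp only [one_mul, neg_mul]
    linarith
  have f1 := hanti ⟨le_rfl, h0.le⟩ ⟨h0.le, le_rfl⟩ h0.le
  simp only [one_mul, zero_mul, Real.exp_zero, add_zero] at f1
  rw [psi_path_re ha, psi_path_zero_re ha]
  have hx : Real.pi * β ≤ a * v * Real.sin β := by
    have e1 : β * Real.cos β ≤ Real.sin β := by
      have := Real.lt_tan hb (halfAngle_lt ha)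
      rw [Real.tan_eq_sin_div_cos, lt_div_iff₀ hC] at this
      exact this.le
    have e2 : a * v * (β * Real.cos β) ≤ a * v * Real.sin β := by gcongr
    have e3 : (Real.pi + 2 * β) * β ≤ a * (v * Real.cos β) * β := by gcongr
    nlinarith
  -- The chain is e^{-πβ} ≤ 1/(1 + πβ) < 1 - 2β² ≤ cos 2β. Its middle inequality amounts to π - 2β -
  -- 2πβ² > 0, which holds for β < π/6.
  have g1 : Real.exp (-a * v * Real.sin β) < Real.cos (2 * β) := by
    have e1 : Real.exp (-a * v * Real.sin β) ≤ Real.exp (-(Real.pi * β)) :=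
      Real.exp_le_exp.2 (by linarith)
    have e2 : Real.pi * β + 1 ≤ Real.exp (Real.pi * β) := Real.add_one_le_exp _
    have e3 : 1 - (2 * β) ^ 2 / 2 ≤ Real.cos (2 * β) := Real.one_sub_sq_div_two_le_cos
    have hp := Real.pi_pos
    have hp3 := Real.pi_gt_three
    have hp4 := Real.pi_lt_d2
    have e4 : Real.exp (-(Real.pi * β)) ≤ 1 / (Real.pi * β + 1) := by
      rw [Real.exp_neg, ← one_div]
      exact one_div_le_one_div_of_le (by positivity) e2
    have e5 : 1 / (Real.pi * β + 1) < 1 - (2 * β) ^ 2 / 2 := by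
      rw [div_lt_iff₀ (by positivity)]
      have hβs : β < 0.525 := by linarith
      have hq : 0 < Real.pi - 2 * β - 2 * Real.pi * β ^ 2 := by nlinarith
      nlinarith
    linarith
  have g2 : Real.exp (-a * v * Real.sin β) * Real.cos (2 * β + -a * v * Real.cos β) ≤
      Real.exp (-a * v * Real.sin β) := by
    have := Real.cos_le_one (2 * β + -a * v * Real.cos β)
    have := Real.exp_pos (-a * v * Real.sin β)
    nlinarith
  have g3 : Real.exp (-a * v * Real.sin β) * Real.cos (2 * β + -a * v * Real.cos β) / a <
      Real.cos (2 * β) / a := by gcongr; linarith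
  have : (1 + 1 / a) * Real.cos (2 * β) = Real.cos (2 * β) + Real.cos (2 * β) / a := by ring
  linarith

theorem psi_path_re_lt {v : ℝ} (hv : v ∈ Icc (lo a) (hi a)) (h0 : v ≠ 0) :
    (psi a (path a v)).re < (psi a (path a 0)).re := by
  rcases lt_or_gt_of_ne h0 with h | h
  · exact psi_path_re_lt_of_neg ha hv.1 h
  rcases le_or_gt (a * (v * Real.cos (halfAngle a))) (Real.pi + 2 * halfAngle a) with h2 | h2
  · exact psi_path_re_lt_of_small ha h hv.2 h2
  · exact psi_path_re_lt_of_large ha h hv.2 h2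

omit ha in
theorem norm_dir : ‖dir a‖ = 1 := by
  rw [dir, Complex.norm_add_mul_I, Real.sin_sq_add_cos_sq, Real.sqrt_one]

omit ha in
theorem exp_mul_dir_sq : Complex.exp ((2 * halfAngle a : ℝ) * I) * dir a ^ 2 = -1 := by
  have h : dir a = I * Complex.exp (-(halfAngle a : ℝ) * I) := by
    rw [Complex.exp_mul_I, dir, Complex.cos_neg, Complex.sin_neg]
    push_cast
    linear_combination (Complex.sin (halfAngle a)) * I_sq
  rw [h, mul_pow, I_sq, ← Complex.exp_nat_mul, mul_left_comm, ← Complex.exp_add]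
  push_cast
  rw [show 2 * (halfAngle a : ℂ) * I + 2 * (-(halfAngle a : ℂ) * I) = 0 by ring, Complex.exp_zero]
  ring

omit ha in
theorem norm_exp_sub_quadratic_le (z : ℂ) :
    ‖Complex.exp z - (1 + z + z ^ 2 / 2)‖ ≤ ‖z‖ ^ 3 * Real.exp ‖z‖ := by
  have := Complex.norm_exp_sub_sum_le_norm_mul_exp z 3
  simpa [Finset.sum_range_succ, Nat.factorial] using this

theorem psi_path_taylor (v : ℝ) :
    ‖psi a (path a v) - psi a (path a 0) + (1 + a) / 2 * v ^ 2‖ ≤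
      |v| ^ 3 * (Real.exp |v| + a ^ 2 * Real.exp (a * |v|)) := by
  have h1 := norm_exp_sub_quadratic_le (v * dir a)
  have h2 := norm_exp_sub_quadratic_le (-a * v * dir a)
  rw [norm_mul, norm_dir, mul_one, Complex.norm_real, Real.norm_eq_abs] at h1
  rw [norm_mul, norm_dir, mul_one, norm_mul, norm_neg, Complex.norm_real, Complex.norm_real,
    Real.norm_eq_abs, Real.norm_eq_abs, abs_of_pos ha] at h2
  have ha' : (a : ℂ) ≠ 0 := by exact_mod_cast ha.ne'
  have hd := exp_mul_dir_sq (a := a)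
  have key : psi a (path a v) - psi a (path a 0) + (1 + a) / 2 * v ^ 2 =
      Complex.exp ((2 * halfAngle a : ℝ) * I) *
        ((Complex.exp (v * dir a) - (1 + v * dir a + (v * dir a) ^ 2 / 2)) +
        (Complex.exp (-a * v * dir a) - (1 + -a * v * dir a + (-a * v * dir a) ^ 2 / 2)) / a) := by
    rw [psi_path_zero ha, psi_path ha]
    field_simp
    linear_combination ((a * v ^ 2 + a ^ 2 * v ^ 2) : ℂ) * hd
  rw [key, norm_mul, Complex.norm_exp_ofReal_mul_I, one_mul]
  refine (norm_add_le _ _).trans ?_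
  rw [norm_div, Complex.norm_real, Real.norm_of_nonneg ha.le]
  have h3 : (a * |v|) ^ 3 * Real.exp (a * |v|) / a = |v| ^ 3 * (a ^ 2 * Real.exp (a * |v|)) := by
    field_simp
  have h4 := div_le_div_of_nonneg_right h2 ha.le
  rw [h3] at h4
  linarith

omit ha in
theorem continuous_psi_path : Continuous fun v => psi a (path a v) := by
  unfold psi path; fun_prop

/-- Near the saddle the cubic Taylor remainder loses to the quadratic term. Elsewhere strict
maximality and compactness leave a gap g, which is at least g v²/V² because |v| ≤ V. -/
theorem exists_psi_path_bounds : ∃ C κ : ℝ, 0 < C ∧ 0 < κ ∧ κ ≤ (1 + a) / 2 ∧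
    ∀ v ∈ Icc (lo a) (hi a),
      ‖psi a (path a v) - psi a (path a 0) + (1 + a) / 2 * v ^ 2‖ ≤ C * |v| ^ 3 ∧
      (psi a (path a v)).re ≤ (psi a (path a 0)).re - κ * v ^ 2 := by
  obtain ⟨V, hV0, hV⟩ : ∃ V : ℝ, 0 < V ∧ ∀ v ∈ Icc (lo a) (hi a), |v| ≤ V := by
    refine ⟨max (-lo a) (hi a), lt_max_of_lt_right (hi_pos ha), fun v hv => abs_le.2 ⟨?_, ?_⟩⟩
    · linarith [le_max_left (-lo a) (hi a), hv.1]
    · exact hv.2.trans (le_max_right _ _)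
  set C := Real.exp V + a ^ 2 * Real.exp (a * V) with hC
  have hC0 : 0 < C := by positivity
  have htay : ∀ v ∈ Icc (lo a) (hi a),
      ‖psi a (path a v) - psi a (path a 0) + (1 + a) / 2 * v ^ 2‖ ≤ C * |v| ^ 3 := by
    intro v hv
    refine (psi_path_taylor ha v).trans ?_
    have := hV v hv
    rw [mul_comm C]
    gcongr ?_ * ?_
    rw [hC]
    gcongr
  -- For |v| < r the cubic error eats at most half of the quadratic term (1 + a) v²/2.
  set r := (1 + a) / (4 * C) with hr
  have hr0 : 0 < r := by positivity
  obtain ⟨g, hg0, hg⟩ : ∃ g : ℝ, 0 < g ∧ ∀ v ∈ Icc (lo a) (hi a) ∩ {v | r ≤ |v|},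
      (psi a (path a v)).re ≤ (psi a (path a 0)).re - g := by
    have hK : IsCompact (Icc (lo a) (hi a) ∩ {v | r ≤ |v|}) :=
      isCompact_Icc.inter_right (isClosed_le continuous_const continuous_abs)
    rcases (Icc (lo a) (hi a) ∩ {v | r ≤ |v|}).eq_empty_or_nonempty with he | he
    · exact ⟨1, one_pos, by simp [he]⟩
    · obtain ⟨u, hu, hmax⟩ := hK.exists_isMaxOn he
        (Complex.continuous_re.comp continuous_psi_path).continuousOn
      have hu0 : u ≠ 0 := by
        rintro rfl
        have : r ≤ |(0 : ℝ)| := hu.2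
        rw [abs_zero] at this
        linarith
      refine ⟨(psi a (path a 0)).re - (psi a (path a u)).re,
        sub_pos.2 (psi_path_re_lt ha hu.1 hu0), fun v hv => ?_⟩
      have : (psi a (path a v)).re ≤ (psi a (path a u)).re := hmax hv
      linarith
  refine ⟨C, min ((1 + a) / 4) (g / V ^ 2), hC0, by positivity,
    (min_le_left _ _).trans (by linarith), fun v hv => ⟨htay v hv, ?_⟩⟩
  rcases le_or_gt r |v| with h | h
  · have h1 := hg v ⟨hv, h⟩
    have h2 : v ^ 2 ≤ V ^ 2 := by rw [← sq_abs]; gcongr; exact hV v hv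
    have h3 : min ((1 + a) / 4) (g / V ^ 2) * v ^ 2 ≤ g / V ^ 2 * V ^ 2 := by
      gcongr; exact min_le_right _ _
    rw [div_mul_cancel₀ _ (by positivity)] at h3
    linarith
  · have h1 := (abs_le.1 ((abs_re_le_norm _).trans (htay v hv))).2
    have e : ((1 + a) / 2 * v ^ 2 : ℂ) = (((1 + a) / 2 * v ^ 2 : ℝ) : ℂ) := by push_cast; ring
    rw [e, add_re, sub_re, ofReal_re] at h1
    have h2 : C * |v| ^ 3 ≤ (1 + a) / 4 * v ^ 2 := by
      calc C * |v| ^ 3 = C * |v| * |v| ^ 2 := by ring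
        _ ≤ C * r * |v| ^ 2 := by gcongr
        _ = _ := by rw [hr, sq_abs]; field_simp
    have h3 : min ((1 + a) / 4) (g / V ^ 2) * v ^ 2 ≤ (1 + a) / 4 * v ^ 2 := by
      gcongr; exact min_le_left _ _
    linarith

end


/-! ### Laplace's method and the asymptotics of W and W' -/

theorem norm_exp_sub_exp_le {R : ℝ} {A B : ℂ} (hA : A.re ≤ R) (hB : B.re ≤ R) :
    ‖Complex.exp A - Complex.exp B‖ ≤ Real.exp R * ‖A - B‖ := by
  refine (convex_halfSpace_re_le R).norm_image_sub_le_of_norm_deriv_le (𝕜 := ℂ)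
    (fun z _ => Complex.differentiableAt_exp) (fun z hz => ?_) hB hA
  rw [Complex.deriv_exp, Complex.norm_exp]
  exact Real.exp_le_exp.2 hz

theorem integrable_abs_mul_exp {b : ℝ} (hb : 0 < b) :
    Integrable (fun v : ℝ => |v| * Real.exp (-b * v ^ 2)) := by
  refine (integrable_mul_exp_neg_mul_sq hb).norm.congr (Eventually.of_forall fun v => ?_)
  simp

theorem integral_abs_mul_exp {b : ℝ} (hb : 0 < b) :
    ∫ v : ℝ, |v| * Real.exp (-b * v ^ 2) = 1 / b := by
  have h1 := integral_mul_cexp_neg_mul_sq (b := b) (by simpa using hb)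
  have h2 : ∫ r in Ioi (0 : ℝ), r * Real.exp (-b * r ^ 2) = (2 * b)⁻¹ := by
    have : ((∫ r in Ioi (0 : ℝ), r * Real.exp (-b * r ^ 2) : ℝ) : ℂ) = ((2 * b : ℝ)⁻¹ : ℝ) := by
      rw [← integral_complex_ofReal]
      push_cast
      exact h1
    exact_mod_cast this
  have h3 := integral_comp_abs (f := fun v : ℝ => v * Real.exp (-b * v ^ 2))
  simp only [sq_abs] at h3
  rw [h3, h2]
  field_simp

section
variable {a c : ℝ} (ha : 0 < a)
include ha

/-- Laplace's method on the line of steepest descent. -/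
theorem exists_integral_psi_path_sub_le : ∃ C : ℝ, 0 < C ∧ ∀ M : ℝ, 0 < M →
    ‖(∫ v in lo a..hi a, Complex.exp (M * psi a (path a v))) -
      Complex.exp (M * psi a (path a 0)) * (Real.sqrt (2 * Real.pi / ((1 + a) * M)) : ℝ)‖ ≤
      C * Real.exp (M * (psi a (path a 0)).re) / M := by
  obtain ⟨C, κ, hC, hκ, hκb, hbd⟩ := exists_psi_path_bounds ha
  set b := (1 + a) / 2 with hb
  have hb0 : 0 < b := by positivity
  have hlo := lo_neg ha
  have hhi := hi_pos ha
  set r := min (-lo a) (hi a) with hr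
  have hr0 : 0 < r := lt_min (by linarith) hhi
  have hrout : ∀ v : ℝ, v ∉ Ioc (lo a) (hi a) → r ≤ |v| := by
    intro v hv
    rw [mem_Ioc, not_and_or, not_lt, not_le] at hv
    rcases hv with h | h
    · exact (min_le_left _ _).trans (by linarith [neg_le_abs v])
    · exact (min_le_right _ _).trans (h.le.trans (le_abs_self v))
  set C' := 2 * C / κ + 1 / r with hC'
  have hC'0 : 0 < C' := by positivity
  refine ⟨C' * (2 / κ), by positivity, fun M hM => ?_⟩
  set h₀ := (psi a (path a 0)).re with hh₀
  set P := psi a (path a 0) with hP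
  set E₀ := Real.exp (M * h₀) with hE₀
  have hE₀' : ‖Complex.exp (M * P)‖ = E₀ := by
    rw [Complex.norm_exp, re_ofReal_mul]
  set f : ℝ → ℂ := (Ioc (lo a) (hi a)).indicator fun v => Complex.exp (M * psi a (path a v)) with hf
  set g : ℝ → ℂ := fun v => Complex.exp (M * P) * (Real.exp (-(b * M) * v ^ 2) : ℝ) with hg
  have hcont : Continuous fun v : ℝ => Complex.exp (M * psi a (path a v)) := by
    have := continuous_psi_path (a := a)
    fun_prop
  have hfi : Integrable f := by
    rw [hf, integrable_indicator_iff measurableSet_Ioc]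
    exact (hcont.integrableOn_Icc).mono_set Ioc_subset_Icc_self
  have hgi : Integrable g := ((integrable_exp_neg_mul_sq (by positivity)).ofReal).const_mul _
  have hfint : ∫ v, f v = ∫ v in lo a..hi a, Complex.exp (M * psi a (path a v)) := by
    rw [hf, integral_indicator measurableSet_Ioc, intervalIntegral.integral_of_le (by linarith)]
  have hgint : ∫ v, g v = Complex.exp (M * P) * (Real.sqrt (2 * Real.pi / ((1 + a) * M)) : ℝ) := by
    rw [hg, integral_const_mul, integral_complex_ofReal, integral_gaussian,
      show Real.pi / (b * M) = 2 * Real.pi / ((1 + a) * M) by rw [hb]; field_simp]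
  rw [← hfint, ← hgint, ← integral_sub hfi hgi]
  have hpt : ∀ v, ‖f v - g v‖ ≤ E₀ * C' * (|v| * Real.exp (-(κ / 2 * M) * v ^ 2)) := by
    intro v
    have hκM : 0 < κ * M := by positivity
    have hvabs := abs_nonneg v
    have hx1 : Real.exp (-(b * M) * v ^ 2) ≤ Real.exp (-(κ / 2 * M) * v ^ 2) := by
      apply Real.exp_le_exp.2
      have : κ / 2 * M * v ^ 2 ≤ b * M * v ^ 2 := by gcongr; linarith
      linarith
    by_cases hv : v ∈ Ioc (lo a) (hi a)
    · obtain ⟨h1, h2⟩ := hbd v (Ioc_subset_Icc_self hv)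
      have e1 : f v - g v = Complex.exp (M * psi a (path a v)) -
          Complex.exp (M * P - (b * M * v ^ 2 : ℝ)) := by
        rw [hf, indicator_of_mem hv]
        simp only [hg]
        rw [ofReal_exp, ← Complex.exp_add]
        push_cast
        ring_nf
      rw [e1]
      have e2 : ((M : ℂ) * psi a (path a v)).re ≤ M * (h₀ - κ * v ^ 2) := by
        rw [re_ofReal_mul]; gcongr
      have e3 : ((M : ℂ) * P - (b * M * v ^ 2 : ℝ)).re ≤ M * (h₀ - κ * v ^ 2) := by
        rw [sub_re, re_ofReal_mul, ofReal_re]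
        have : M * κ * v ^ 2 ≤ b * M * v ^ 2 := by rw [mul_comm b]; gcongr
        nlinarith
      refine (norm_exp_sub_exp_le e2 e3).trans ?_
      have e4 : (M : ℂ) * psi a (path a v) - (M * P - (b * M * v ^ 2 : ℝ)) =
          M * (psi a (path a v) - P + (1 + a) / 2 * v ^ 2) := by
        rw [hb]; push_cast; ring
      rw [e4, norm_mul, Complex.norm_real, Real.norm_of_nonneg hM.le]
      -- One half of the Gaussian absorbs the M v² of the cubic error through x e^{-x} ≤ 1; the
      -- other half leaves |v| times a Gaussian, whose integral is of order 1/M.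
      have e5 : Real.exp (M * (h₀ - κ * v ^ 2)) = E₀ * (Real.exp (-(κ / 2 * M) * v ^ 2) *
          Real.exp (-(κ / 2 * M * v ^ 2))) := by
        rw [hE₀, ← Real.exp_add, ← Real.exp_add]; ring_nf
      have e6 : κ / 2 * M * v ^ 2 * Real.exp (-(κ / 2 * M * v ^ 2)) ≤ 1 := by
        have := Real.add_one_le_exp (κ / 2 * M * v ^ 2)
        rw [Real.exp_neg, ← div_eq_mul_inv, div_le_one (Real.exp_pos _)]
        linarith
      rw [e5]
      calc _ ≤ E₀ * (Real.exp (-(κ / 2 * M) * v ^ 2) * Real.exp (-(κ / 2 * M * v ^ 2))) *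
            (M * (C * |v| ^ 3)) := by gcongr
        _ = E₀ * (2 * C / κ) * (|v| * Real.exp (-(κ / 2 * M) * v ^ 2)) *
            (κ / 2 * M * v ^ 2 * Real.exp (-(κ / 2 * M * v ^ 2))) := by
            rw [← sq_abs v]; field_simp
        _ ≤ E₀ * (2 * C / κ) * (|v| * Real.exp (-(κ / 2 * M) * v ^ 2)) * 1 := by gcongr
        _ ≤ _ := by
            rw [mul_one]; gcongr
            rw [hC']
            have : 0 < 1 / r := by positivity
            linarith
    · rw [hf, indicator_of_notMem hv, zero_sub, norm_neg, hg, norm_mul, hE₀', Complex.norm_real,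
        Real.norm_of_nonneg (Real.exp_pos _).le, mul_assoc]
      gcongr
      -- Off the segment only the Gaussian is left, and |v| ≥ r brings it under the same majorant.
      have h1 : 1 ≤ C' * |v| := by
        have h2 : 1 / r * r ≤ C' * |v| := by
          gcongr
          · rw [hC']
            have : 0 < 2 * C / κ := by positivity
            linarith
          · exact hrout v hv
        rwa [one_div_mul_cancel hr0.ne'] at h2
      have h3 := Real.exp_pos (-(κ / 2 * M) * v ^ 2)
      nlinarith
  have hκM : 0 < κ / 2 * M := by positivity
  refine (norm_integral_le_of_norm_le ((integrable_abs_mul_exp hκM).const_mul (E₀ * C'))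
    (Eventually.of_forall hpt)).trans_eq ?_
  rw [integral_const_mul, integral_abs_mul_exp hκM]
  field_simp

/-- The rate of decay on the horizontal parts of the contour. -/
theorem exists_horizontal_rate : ∃ b : ℝ, 0 < b ∧ ∀ x : ℝ, hi a * Real.sin (halfAngle a) ≤ x →
    -Real.exp x - Real.exp (-a * x) * Real.cos (a * Real.pi) / a ≤
      (psi a (path a 0)).re - b * (Real.exp x - Real.exp (hi a * Real.sin (halfAngle a))) := by
  set y := hi a * Real.sin (halfAngle a) with hy
  have hy0 : 0 < y := mul_pos (hi_pos ha) (sin_halfAngle_pos ha)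
  -- For x ≥ y, e^{-ax} ≤ e^{-(1+a)y} e^x = (1 - b) e^x, so Re psi on the horizontal line remains
  -- decreasing after b e^x is added. At x = y the line starts from the end of the segment, where Re
  -- psi is already below its saddle value.
  set b := 1 - Real.exp (-((1 + a) * y)) with hb
  have hb0 : 0 < b := by
    have : Real.exp (-((1 + a) * y)) < 1 := Real.exp_lt_one_iff.2 (by
      have : 0 < (1 + a) * y := by positivity
      linarith)
    linarith
  refine ⟨b, hb0, fun x hx => ?_⟩
  have hval : -Real.exp y - Real.exp (-a * y) * Real.cos (a * Real.pi) / a =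
      (psi a (path a (hi a))).re := by
    rw [path_hi ha, ← hy, psi, sub_re, exp_horizontal, div_ofReal_re, Complex.exp_re]
    simp [-ofReal_exp, -ofReal_mul]
  have hlt := psi_path_re_lt ha ⟨((lo_neg ha).trans (hi_pos ha)).le, le_rfl⟩ (hi_pos ha).ne'
  have hanti : AntitoneOn (fun x => -Real.exp x - Real.exp (-a * x) * Real.cos (a * Real.pi) / a +
      b * Real.exp x) (Ici y) := by
    have hd : ∀ x, HasDerivAt (fun x => -Real.exp x -
        Real.exp (-a * x) * Real.cos (a * Real.pi) / a + b * Real.exp x)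
        (-Real.exp x + Real.exp (-a * x) * Real.cos (a * Real.pi) + b * Real.exp x) x := by
      intro x
      have h1 := Real.hasDerivAt_exp x
      have h2 : HasDerivAt (fun x => Real.exp (-a * x)) (Real.exp (-a * x) * -a) x := by
        simpa using ((hasDerivAt_id x).const_mul (-a)).exp
      refine ((h1.neg.sub ((h2.mul_const (Real.cos (a * Real.pi))).div_const a)).add
        (h1.const_mul b)).congr_deriv ?_
      field_simp
      ring
    refine antitoneOn_of_deriv_nonpos (convex_Ici y)
      (fun x _ => (hd x).continuousAt.continuousWithinAt)
      (fun x _ => (hd x).differentiableAt.differentiableWithinAt) fun x hx => ?_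
    rw [interior_Ici, mem_Ioi] at hx
    rw [(hd x).deriv]
    have e1 : Real.exp (-a * x) * Real.cos (a * Real.pi) ≤ Real.exp (-a * x) := by
      have := Real.cos_le_one (a * Real.pi)
      have := Real.exp_pos (-a * x)
      nlinarith
    have e2 : Real.exp (-a * x) ≤ Real.exp (-((1 + a) * y)) * Real.exp x := by
      rw [← Real.exp_add]
      apply Real.exp_le_exp.2
      nlinarith
    rw [hb]
    nlinarith
  have h := hanti (mem_Ici.2 le_rfl) (mem_Ici.2 hx) hx
  simp only at h
  rw [hval] at h
  linarith

omit ha in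
-- The translation by Λ balances t e^w against c e^{-aw}, so that both carry the single large
-- parameter M. The imaginary part of t stays outside the phase as a separate factor.
theorem kern_shift (j : ℕ) {ℓ y Λ M : ℝ} (h1 : M = ℓ * Real.exp Λ)
    (h2 : M = a * -c * Real.exp (-a * Λ)) (ha' : a ≠ 0) (w : ℂ) :
    kern a c j (ℓ + y * I) (w + Λ) = (Complex.exp w * Real.exp Λ) ^ j *
      Complex.exp ((y * Real.exp Λ : ℝ) * (Complex.exp w * I)) * Complex.exp (M * psi a w) := by
  have h3 : (c : ℂ) * Complex.exp (-a * (w + Λ)) = -(M / a) * Complex.exp (-a * w) := by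
    have h4 : c * Real.exp (-a * Λ) = -(M / a) := by rw [h2]; field_simp
    have h5 : (c : ℂ) * Complex.exp (-a * Λ) = -(M / a) := by exact_mod_cast h4
    rw [mul_add, Complex.exp_add, ← h5]; ring
  rw [kern, h3, mul_assoc, ← Complex.exp_add, Complex.exp_add w, psi, ofReal_exp]
  congr 2
  have h6 : (M : ℂ) = ℓ * Complex.exp Λ := by rw [h1]; push_cast; ring
  push_cast
  linear_combination (-Complex.exp w) * h6

omit ha in
theorem kern_conj (j : ℕ) (t w : ℂ) :
    kern a c j (starRingEnd ℂ t) (starRingEnd ℂ w) = starRingEnd ℂ (kern a c j t w) := by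
  simp only [kern, map_mul, map_pow, ← Complex.exp_conj, map_add, map_neg, conj_ofReal]

/-- The representation of `wright` through the lines of steepest descent. -/
theorem wright_eq_path (j : ℕ) {t : ℂ} (ht : 0 < t.re) (Λ : ℝ) :
    wright a c j t = (2 * Real.pi * I)⁻¹ *
      ((∫ x in Ioi (hi a * Real.sin (halfAngle a) + Λ), (kern a c j t (x + Real.pi * I) -
        kern a c j t (x - Real.pi * I))) +
      (dir a * (∫ v in lo a..hi a, kern a c j t (path a v + Λ)) -
        starRingEnd ℂ (dir a * ∫ v in lo a..hi a,
          kern a c j (starRingEnd ℂ t) (path a v + Λ)))) := by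
  obtain ⟨F, hF⟩ := exists_primitive_kern a c j t
  rw [wright_eq_of_primitive ha j ht (hi a * Real.sin (halfAngle a) + Λ) hF]
  have hc := continuous_kern a c j t
  have h1 := intervalIntegral_line hF hc (lo a) (hi a)
    (((2 * halfAngle a : ℝ) : ℂ) * I + Λ) (dir a)
  have h2 := intervalIntegral_line hF hc (lo a) (hi a)
    (starRingEnd ℂ (((2 * halfAngle a : ℝ) : ℂ) * I + Λ)) (starRingEnd ℂ (dir a))
  have e1 : ∀ v : ℝ, ((2 * halfAngle a : ℝ) : ℂ) * I + Λ + v * dir a = path a v + Λ := by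
    intro v; rw [path]; ring
  have e2 : ∀ v : ℝ, starRingEnd ℂ (((2 * halfAngle a : ℝ) : ℂ) * I + Λ) +
      v * starRingEnd ℂ (dir a) = starRingEnd ℂ (path a v + Λ) := by
    intro v; rw [← e1]; simp
  have e3 : (∫ v in lo a..hi a, kern a c j t (starRingEnd ℂ (path a v + Λ))) =
      starRingEnd ℂ (∫ v in lo a..hi a, kern a c j (starRingEnd ℂ t) (path a v + Λ)) := by
    have : ∀ v : ℝ, kern a c j t (starRingEnd ℂ (path a v + Λ)) =
        starRingEnd ℂ (kern a c j (starRingEnd ℂ t) (path a v + Λ)) := by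
      intro v; rw [← kern_conj, Complex.conj_conj]
    simp only [this]
    rw [intervalIntegral.integral_of_le ((lo_neg ha).trans (hi_pos ha)).le,
      intervalIntegral.integral_of_le ((lo_neg ha).trans (hi_pos ha)).le, integral_conj]
  simp only [e1] at h1
  simp only [e2] at h2
  rw [e3, ← map_mul] at h2
  -- The segment and its conjugate issue from the same real point, so the value of the primitive
  -- there cancels; they end where the two horizontal half-lines begin.
  rw [h1, h2, path_lo ha, path_hi ha]
  congr 2
  simp only [map_add, map_mul, conj_ofReal, conj_I]
  push_cast
  ring_nf

/-- The rate b e^x makes the horizontal parts an explicitly computable integral; compared with the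
saddle contribution it is smaller by the order M^{-1/2}. The cases j = 0 and j = 1 serve W and W'.
-/
theorem exists_horizontal_bound : ∃ C : ℝ, 0 < C ∧ ∀ j ≤ 1, ∀ ℓ Λ M : ℝ, 0 < ℓ →
    M = ℓ * Real.exp Λ → M = a * -c * Real.exp (-a * Λ) → ∀ t : ℂ, t.re = ℓ →
    ‖∫ x in Ioi (hi a * Real.sin (halfAngle a) + Λ), (kern a c j t (x + Real.pi * I) -
        kern a c j t (x - Real.pi * I))‖ ≤
      C * Real.exp Λ ^ j * Real.exp (M * (psi a (path a 0)).re) / M := by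
  obtain ⟨b, hb, hrate⟩ := exists_horizontal_rate ha
  set y := hi a * Real.sin (halfAngle a) with hy
  have hy0 : 0 < y := mul_pos (hi_pos ha) (sin_halfAngle_pos ha)
  refine ⟨2 / b, by positivity, fun j hj ℓ Λ M hℓ h1 h2 t ht => ?_⟩
  set h₀ := (psi a (path a 0)).re with hh₀
  have hΛ := Real.exp_pos Λ
  have hM : 0 < M := by rw [h1]; positivity
  have hbound : ∀ x ∈ Ioi (y + Λ), ∀ w : ℂ, (w = x + Real.pi * I ∨ w = x - Real.pi * I) →
      ‖kern a c j t w‖ ≤ Real.exp (M * (h₀ + b * Real.exp y)) * (Real.exp Λ ^ j / Real.exp Λ) *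
        (Real.exp x * Real.exp (-(b * ℓ * Real.exp x))) := by
    intro x hx w hw
    have hx : y + Λ < x := hx
    have hre : w.re = x := by rcases hw with rfl | rfl <;> simp
    have hcos : Real.cos (a * w.im) = Real.cos (a * Real.pi) := by
      rcases hw with rfl | rfl
      · simp
      · simp
    have he : Complex.exp w = -Real.exp x := by
      rcases hw with rfl | rfl
      exacts [exp_horizontal x, exp_horizontal' x]
    have h3 : (t * -(Real.exp x : ℂ)).re = -(ℓ * Real.exp x) := by
      rw [← ofReal_neg, re_mul_ofReal, ht]; ring
    rw [norm_kern, he, hre, hcos, h3]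
    have h4 := hrate (x - Λ) (by linarith)
    have e1 : Real.exp x = Real.exp (x - Λ) * Real.exp Λ := by rw [← Real.exp_add]; ring_nf
    have e2 : Real.exp (-a * x) = Real.exp (-a * (x - Λ)) * Real.exp (-a * Λ) := by
      rw [← Real.exp_add]; ring_nf
    have e3 : -(ℓ * Real.exp x) + c * (Real.exp (-a * x) * Real.cos (a * Real.pi)) =
        M * (-Real.exp (x - Λ) - Real.exp (-a * (x - Λ)) * Real.cos (a * Real.pi) / a) := by
      have h5 : M * (Real.exp (-a * (x - Λ)) * Real.cos (a * Real.pi) / a) =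
          -c * Real.exp (-a * Λ) * (Real.exp (-a * (x - Λ)) * Real.cos (a * Real.pi)) := by
        rw [h2]; field_simp
      rw [mul_sub, h5, h1, e1, e2]; ring
    -- When j = 0 the missing factor e^x is supplied by e^{x - Λ} ≥ 1, valid since x > y + Λ with y
    -- > 0.
    have e4 : Real.exp x ^ j ≤ (Real.exp Λ ^ j / Real.exp Λ) * Real.exp x := by
      interval_cases j
      · rw [pow_zero, pow_zero, one_div, ← Real.exp_neg, ← Real.exp_add]
        exact Real.one_le_exp (by linarith)
      · rw [pow_one, pow_one, div_self hΛ.ne', one_mul]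
    have e5 : M * (-Real.exp (x - Λ) - Real.exp (-a * (x - Λ)) * Real.cos (a * Real.pi) / a) ≤
        M * (h₀ + b * Real.exp y) + -(b * ℓ * Real.exp x) := by
      have h6 : M * Real.exp (x - Λ) = ℓ * Real.exp x := by rw [h1, e1]; ring
      nlinarith
    rw [e3]
    calc _ ≤ ((Real.exp Λ ^ j / Real.exp Λ) * Real.exp x) *
          Real.exp (M * (h₀ + b * Real.exp y) + -(b * ℓ * Real.exp x)) := by gcongr
      _ = _ := by rw [Real.exp_add]; ring
  set K := Real.exp (M * (h₀ + b * Real.exp y)) * (Real.exp Λ ^ j / Real.exp Λ) with hK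
  have hbℓ : 0 < b * ℓ := by positivity
  have hfin : ‖∫ x in Ioi (y + Λ), (kern a c j t (x + Real.pi * I) -
      kern a c j t (x - Real.pi * I))‖ ≤
      ∫ x in Ioi (y + Λ), 2 * K * (Real.exp x * Real.exp (-(b * ℓ * Real.exp x))) := by
    refine norm_integral_le_of_norm_le ((integrableOn_exp_mul_exp_neg hbℓ _).const_mul _) ?_
    filter_upwards [ae_restrict_mem measurableSet_Ioi] with x hx
    refine (norm_sub_le _ _).trans
      ((add_le_add (hbound x hx _ (.inl rfl)) (hbound x hx _ (.inr rfl))).trans_eq ?_)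
    ring
  refine hfin.trans_eq ?_
  rw [integral_const_mul, integral_exp_mul_exp_neg hbℓ, hK]
  have e6 : Real.exp (M * (h₀ + b * Real.exp y)) * Real.exp (-(b * ℓ * Real.exp (y + Λ))) =
      Real.exp (M * h₀) := by
    rw [← Real.exp_add, Real.exp_add y, h1]; ring_nf
  rw [← e6, h1]
  field_simp

/-- The asymptotic expansion of `wright a c 0` on the positive reals. -/
theorem exists_wright_asymp : ∃ C : ℝ, 0 < C ∧ ∀ ℓ Λ M : ℝ, 0 < ℓ →
    M = ℓ * Real.exp Λ → M = a * -c * Real.exp (-a * Λ) →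
    ‖wright a c 0 ℓ - (Real.sqrt (2 / (Real.pi * (1 + a) * M)) *
      (Real.exp (M * (psi a (path a 0)).re) *
        Real.cos (M * (psi a (path a 0)).im - halfAngle a)) : ℝ)‖ ≤
      C * Real.exp (M * (psi a (path a 0)).re) / M := by
  obtain ⟨C₁, hC₁, hhor⟩ := exists_horizontal_bound (c := c) ha
  obtain ⟨C₂, hC₂, hlap⟩ := exists_integral_psi_path_sub_le ha
  refine ⟨C₁ + 2 * C₂, by positivity, fun ℓ Λ M hℓ h1 h2 => ?_⟩
  have hM : 0 < M := by rw [h1]; positivity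
  have h3 := hhor 0 (by norm_num) ℓ Λ M hℓ h1 h2 ℓ (ofReal_re ℓ)
  have h4 := hlap M hM
  have hk : ∀ v : ℝ, kern a c 0 ℓ (path a v + Λ) = Complex.exp (M * psi a (path a v)) := by
    intro v
    have := kern_shift (y := 0) 0 h1 h2 ha.ne' (path a v)
    simpa using this
  rw [wright_eq_path ha 0 (by simpa using hℓ) Λ, conj_ofReal]
  simp only [hk]
  set H := ∫ x in Ioi (hi a * Real.sin (halfAngle a) + Λ), (kern a c 0 ℓ (x + Real.pi * I) -
    kern a c 0 ℓ (x - Real.pi * I))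
  set S := ∫ v in lo a..hi a, Complex.exp (M * psi a (path a v))
  set G := Complex.exp (M * psi a (path a 0)) * (Real.sqrt (2 * Real.pi / ((1 + a) * M)) : ℝ)
    with hG
  set h₀ := (psi a (path a 0)).re with hh₀
  have hpi := Real.pi_pos
  -- The two saddles are conjugate, so only the imaginary part of one contribution counts. As `dir
  -- a` is i e^{-iβ}, with β the half angle, it turns a phase ϑ into cos (ϑ - β).
  have hGim : (dir a * G).im = Real.pi * (Real.sqrt (2 / (Real.pi * (1 + a) * M)) *
      (Real.exp (M * h₀) * Real.cos (M * (psi a (path a 0)).im - halfAngle a))) := by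
    have e1 : Real.sqrt (2 * Real.pi / ((1 + a) * M)) =
        Real.pi * Real.sqrt (2 / (Real.pi * (1 + a) * M)) := by
      rw [← Real.sqrt_sq hpi.le, ← Real.sqrt_mul (sq_nonneg _), Real.sqrt_sq hpi.le]
      congr 1; field_simp
    have e2 : Complex.exp (M * psi a (path a 0)) =
        Real.exp (M * h₀) * (Real.cos (M * (psi a (path a 0)).im) +
          Real.sin (M * (psi a (path a 0)).im) * I) := by
      rw [Complex.exp_eq_exp_re_mul_sin_add_cos, re_ofReal_mul, im_ofReal_mul]
      push_cast; rfl
    rw [hG, e1, e2, Real.cos_sub, dir]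
    set s := Real.sqrt (2 / (Real.pi * (1 + a) * M))
    set x := Real.exp (M * h₀)
    set C := Real.cos (M * (psi a (path a 0)).im)
    set D := Real.sin (M * (psi a (path a 0)).im)
    simp only [mul_im, mul_re, add_im, add_re, ofReal_re, ofReal_im, I_re, I_im]
    ring
  have hIm : ∀ w : ℂ, w - starRingEnd ℂ w = 2 * I * (w.im : ℂ) := by
    intro w; rw [Complex.sub_conj]; push_cast; ring
  have key : (2 * Real.pi * I)⁻¹ * (H + (dir a * S - starRingEnd ℂ (dir a * S))) -
      ((Real.sqrt (2 / (Real.pi * (1 + a) * M)) *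
      (Real.exp (M * h₀) * Real.cos (M * (psi a (path a 0)).im - halfAngle a)) : ℝ) : ℂ) =
      (2 * Real.pi * I)⁻¹ * (H + 2 * I * ((dir a * (S - G)).im : ℂ)) := by
    have e3 : (dir a * (S - G)).im = (dir a * S).im - (dir a * G).im := by rw [mul_sub, sub_im]
    have hpi' : (Real.pi : ℂ) ≠ 0 := by exact_mod_cast hpi.ne'
    rw [hIm, e3, hGim]
    push_cast
    field_simp
    ring
  rw [key, norm_mul, norm_inv]
  have e4 : ‖(2 * Real.pi * I : ℂ)‖ = 2 * Real.pi := by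
    rw [norm_mul, norm_mul, norm_I, Complex.norm_real, Real.norm_of_nonneg hpi.le]; simp
  have e5 : ‖H + 2 * I * ((dir a * (S - G)).im : ℂ)‖ ≤
      (C₁ + 2 * C₂) * Real.exp (M * h₀) / M := by
    refine (norm_add_le _ _).trans ?_
    rw [norm_mul, norm_mul, norm_I, Complex.norm_real, Complex.norm_ofNat, mul_one]
    have e6 : ‖(dir a * (S - G)).im‖ ≤ C₂ * Real.exp (M * h₀) / M := by
      refine (abs_im_le_norm _).trans ?_
      rw [norm_mul, norm_dir, one_mul]
      exact h4
    rw [pow_zero, mul_one] at h3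
    calc _ ≤ C₁ * Real.exp (M * h₀) / M + 2 * (C₂ * Real.exp (M * h₀) / M) := by gcongr
      _ = _ := by ring
  rw [e4]
  have e7 : (2 * Real.pi)⁻¹ ≤ 1 := inv_le_one_of_one_le₀ (by linarith [Real.pi_gt_three])
  calc _ ≤ 1 * ((C₁ + 2 * C₂) * Real.exp (M * h₀) / M) := by gcongr
    _ = _ := one_mul _

/-- Only a bound is needed, so a Gaussian majorant on the segment suffices. The factor e^Λ, of order
ℓ^{-1/(1+a)}, is the gain of W' over W. The strip |y| ≤ 1 is needed for the later shift of line;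
there exp(i y e^{w+Λ}) stays bounded on the segment because ℓ ≥ 1 bounds Λ from above. -/
theorem exists_wright_deriv_bound (hc : c < 0) : ∃ C : ℝ, 0 < C ∧ ∀ ℓ Λ M y : ℝ, 1 ≤ ℓ → |y| ≤ 1 →
    M = ℓ * Real.exp Λ → M = a * -c * Real.exp (-a * Λ) →
    ‖wright a c 1 (ℓ + y * I)‖ ≤
      C * Real.exp Λ * Real.exp (M * (psi a (path a 0)).re) / Real.sqrt M := by
  obtain ⟨C₁, hC₁, hhor⟩ := exists_horizontal_bound (c := c) ha
  obtain ⟨C₂, κ, hC₂, hκ, -, hbd⟩ := exists_psi_path_bounds ha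
  obtain ⟨Λ₀, hΛ₀⟩ : ∃ Λ₀ : ℝ, a * -c = Real.exp Λ₀ :=
    ⟨_, (Real.exp_log (by nlinarith)).symm⟩
  obtain ⟨R, hR⟩ : ∃ R, ∀ v ∈ Icc (lo a) (hi a), ‖Complex.exp (path a v)‖ ≤ R :=
    isCompact_Icc.exists_bound_of_continuousOn (by unfold path; fun_prop)
  have hR0 : 0 ≤ R := (norm_nonneg _).trans
    (hR _ ⟨le_rfl, ((lo_neg ha).trans (hi_pos ha)).le⟩)
  set L := Real.exp (Λ₀ / (1 + a)) with hL
  set D := R * Real.exp (L * R) * Real.sqrt (Real.pi / κ) with hD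
  refine ⟨C₁ / Real.sqrt L + 2 * D, by positivity, fun ℓ Λ M y hℓ hy h1 h2 => ?_⟩
  have hℓ0 : 0 < ℓ := by linarith
  have hM : 0 < M := by rw [h1]; positivity
  set h₀ := (psi a (path a 0)).re with hh₀
  -- the scale is bounded above, and `M` is bounded below
  have hΛL : Real.exp Λ ≤ L := by
    apply Real.exp_le_exp.2
    rw [le_div_iff₀ (by positivity)]
    have e1 : ℓ * Real.exp Λ = Real.exp (Λ₀ - a * Λ) := by
      rw [← h1, h2, hΛ₀, ← Real.exp_add]; ring_nf
    have e2 : Real.exp Λ ≤ Real.exp (Λ₀ - a * Λ) := by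
      rw [← e1]; nlinarith [Real.exp_pos Λ]
    have := Real.exp_le_exp.1 e2
    linarith
  have hML : L ≤ M := by
    have e1 : M = Real.exp (Λ₀ - a * Λ) := by rw [h2, hΛ₀, ← Real.exp_add]; ring_nf
    rw [e1, hL]
    apply Real.exp_le_exp.2
    have e2 := Real.exp_le_exp.1 hΛL
    rw [le_div_iff₀ (by positivity)] at e2
    rw [div_le_iff₀ (by positivity)]
    nlinarith
  have hline : ∀ y : ℝ, |y| ≤ 1 →
      ‖∫ v in lo a..hi a, kern a c 1 (ℓ + y * I) (path a v + Λ)‖ ≤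
        D * Real.exp Λ * Real.exp (M * h₀) / Real.sqrt M := by
    intro y hy
    have hpt : ∀ v ∈ Ioc (lo a) (hi a), ‖kern a c 1 (ℓ + y * I) (path a v + Λ)‖ ≤
        (R * Real.exp (L * R) * Real.exp Λ * Real.exp (M * h₀)) *
          Real.exp (-(κ * M) * v ^ 2) := by
      intro v hv
      have hv := Ioc_subset_Icc_self hv
      have e1 := hR v hv
      rw [kern_shift 1 h1 h2 ha.ne', norm_mul, norm_mul, pow_one, norm_mul, Complex.norm_real,
        Real.norm_of_nonneg (Real.exp_pos _).le]
      have e2 : ‖Complex.exp ((y * Real.exp Λ : ℝ) * (Complex.exp (path a v) * I))‖ ≤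
          Real.exp (L * R) := by
        refine (Complex.norm_exp_le_exp_norm _).trans (Real.exp_le_exp.2 ?_)
        rw [norm_mul, norm_mul, norm_I, mul_one, Complex.norm_real, Real.norm_eq_abs, abs_mul,
          abs_of_pos (Real.exp_pos Λ)]
        have : |y| * Real.exp Λ ≤ L := by nlinarith [Real.exp_pos Λ]
        gcongr
      have e3 : ‖Complex.exp (M * psi a (path a v))‖ ≤
          Real.exp (M * h₀) * Real.exp (-(κ * M) * v ^ 2) := by
        rw [Complex.norm_exp, re_ofReal_mul, ← Real.exp_add]
        apply Real.exp_le_exp.2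
        have := (hbd v hv).2
        nlinarith
      calc _ ≤ R * Real.exp Λ * Real.exp (L * R) *
            (Real.exp (M * h₀) * Real.exp (-(κ * M) * v ^ 2)) := by gcongr
        _ = _ := by ring
    have hgi : Integrable fun v : ℝ => (R * Real.exp (L * R) * Real.exp Λ * Real.exp (M * h₀)) *
          Real.exp (-(κ * M) * v ^ 2) := (integrable_exp_neg_mul_sq (by positivity)).const_mul _
    rw [intervalIntegral.integral_of_le ((lo_neg ha).trans (hi_pos ha)).le]
    refine (norm_integral_le_of_norm_le hgi.restrict ?_).trans ?_
    · filter_upwards [ae_restrict_mem measurableSet_Ioc] with v hv using hpt v hv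
    refine (setIntegral_le_integral hgi (Eventually.of_forall fun v => by positivity)).trans_eq ?_
    rw [integral_const_mul, integral_gaussian, hD, ← div_div, Real.sqrt_div (by positivity)]
    ring
  have hre : ((ℓ : ℂ) + y * I).re = ℓ := by simp
  have h3 := hhor 1 le_rfl ℓ Λ M hℓ0 h1 h2 (ℓ + y * I) hre
  have h4 := hline y hy
  have h5 := hline (-y) (by rwa [abs_neg])
  have hconj : starRingEnd ℂ ((ℓ : ℂ) + y * I) = ℓ + (-y : ℝ) * I := by
    simp
  rw [wright_eq_path ha 1 (by rw [hre]; exact hℓ0) Λ, hconj, norm_mul, norm_inv]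
  have hpi := Real.pi_pos
  have e4 : ‖(2 * Real.pi * I : ℂ)‖ = 2 * Real.pi := by
    rw [norm_mul, norm_mul, norm_I, Complex.norm_real, Real.norm_of_nonneg hpi.le]; simp
  have e7 : (2 * Real.pi)⁻¹ ≤ 1 := inv_le_one_of_one_le₀ (by linarith [Real.pi_gt_three])
  have e8 : C₁ * Real.exp Λ ^ 1 * Real.exp (M * h₀) / M ≤
      C₁ / Real.sqrt L * Real.exp Λ * Real.exp (M * h₀) / Real.sqrt M := by
    have hL0 : 0 < L := Real.exp_pos _
    rw [pow_one]
    have : ∀ x : ℝ, x / M = x / Real.sqrt M / Real.sqrt M := fun x => by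
      rw [div_div, Real.mul_self_sqrt hM.le]
    rw [this]
    calc _ = C₁ / Real.sqrt M * Real.exp Λ * Real.exp (M * h₀) / Real.sqrt M := by ring
      _ ≤ _ := by gcongr
  rw [e4]
  refine (mul_le_of_le_one_left (norm_nonneg _) e7).trans ?_
  refine (norm_add_le _ _).trans ((add_le_add (h3.trans e8) (norm_sub_le _ _)).trans ?_)
  rw [RCLike.norm_conj, norm_mul, norm_mul, norm_dir, one_mul, one_mul]
  calc _ ≤ C₁ / Real.sqrt L * Real.exp Λ * Real.exp (M * h₀) / Real.sqrt M +
        (D * Real.exp Λ * Real.exp (M * h₀) / Real.sqrt M +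
          D * Real.exp Λ * Real.exp (M * h₀) / Real.sqrt M) := by gcongr
    _ = _ := by ring

end


/-! ### Bounds for W in terms of powers of ℓ -/

/-- The logarithmic derivative -q/x + A p x^{p-1} tends to 0; once it is at most 1/4 in absolute
value, moving from ℓ to r costs at most e^{|r - ℓ|/4}. -/
theorem exists_rpow_mul_exp_rpow_le {p q A : ℝ} (hp0 : 0 < p) (hp1 : p < 1) (hq : 0 < q) :
    ∃ T : ℝ, 1 ≤ T ∧ ∀ r ≥ T, ∀ ℓ ≥ T, r ^ (-q) * Real.exp (A * r ^ p) ≤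
      ℓ ^ (-q) * Real.exp (A * ℓ ^ p) * Real.exp (|r - ℓ| / 4) := by
  have hlim : Tendsto (fun x : ℝ => (q + |A| * p) * x ^ (-(1 - p))) atTop (𝓝 0) := by
    simpa using (tendsto_rpow_neg_atTop (by linarith : 0 < 1 - p)).const_mul (q + |A| * p)
  obtain ⟨T₀, hT₀⟩ := eventually_atTop.1 (hlim.eventually_le_const (show (0 : ℝ) < 1 / 4 by norm_num))
  refine ⟨max T₀ 1, le_max_right _ _, fun r hr ℓ hℓ => ?_⟩
  set T := max T₀ 1
  have hT1 : 1 ≤ T := le_max_right _ _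
  set g : ℝ → ℝ := fun x => -q * Real.log x + A * x ^ p with hg
  have hexp : ∀ x ≥ T, x ^ (-q) * Real.exp (A * x ^ p) = Real.exp (g x) := by
    intro x hx
    have hx0 : 0 < x := by linarith
    rw [Real.rpow_def_of_pos hx0, ← Real.exp_add]
    simp only [hg]; ring_nf
  have hd : ∀ x ∈ Ici T, HasDerivWithinAt g (-q * x⁻¹ + A * (p * x ^ (p - 1))) (Ici T) x := by
    intro x hx
    have hx0 : 0 < x := by linarith [mem_Ici.1 hx]
    exact (((Real.hasDerivAt_log hx0.ne').const_mul (-q)).add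
      ((Real.hasDerivAt_rpow_const (.inl hx0.ne')).const_mul A)).hasDerivWithinAt
  have hb : ∀ x ∈ Ici T, ‖-q * x⁻¹ + A * (p * x ^ (p - 1))‖ ≤ 1 / 4 := by
    intro x hx
    have hx1 : 1 ≤ x := by linarith [mem_Ici.1 hx]
    have hx0 : 0 < x := by linarith
    have h1 := hT₀ x ((le_max_left _ _).trans hx)
    rw [neg_sub] at h1
    have h2 : x⁻¹ ≤ x ^ (p - 1) := by
      rw [← Real.rpow_neg_one]
      exact Real.rpow_le_rpow_of_exponent_le hx1 (by linarith)
    refine (norm_add_le _ _).trans ?_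
    rw [norm_mul, norm_neg, norm_mul, norm_mul, Real.norm_of_nonneg hq.le,
      Real.norm_of_nonneg hp0.le, Real.norm_of_nonneg (by positivity : 0 ≤ x⁻¹),
      Real.norm_of_nonneg (by positivity : 0 ≤ x ^ (p - 1)), Real.norm_eq_abs]
    nlinarith
  have h := (convex_Ici T).norm_image_sub_le_of_norm_hasDerivWithin_le hd hb hℓ hr
  rw [Real.norm_eq_abs, Real.norm_eq_abs] at h
  rw [hexp r hr, hexp ℓ hℓ, ← Real.exp_add]
  apply Real.exp_le_exp.2
  linarith [le_abs_self (g r - g ℓ)]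

/-- The exponent of `log z` in the phase. -/
def phaseExp (a : ℝ) : ℝ := a / (1 + a)

/-- The size of the derivative of `wright a c 0` on the real line. -/
def size (a c x : ℝ) : ℝ :=
  x ^ (-(1 / (1 + a) + phaseExp a / 2)) * Real.exp (A₂ c (-a) * x ^ phaseExp a)

section
variable {a c : ℝ} (ha : 0 < a)
include ha

theorem phaseExp_pos : 0 < phaseExp a := by unfold phaseExp; positivity

theorem phaseExp_eq : phaseExp a = 1 - 1 / (1 + a) := by unfold phaseExp; field_simp; ring

theorem phaseExp_lt : phaseExp a < 1 := by
  rw [phaseExp_eq ha]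
  have : 0 < 1 / (1 + a) := by positivity
  linarith

/-- The logarithm of the scale. -/
theorem exists_scale (hc : c < 0) {ℓ : ℝ} (hℓ : 0 < ℓ) : ∃ Λ M : ℝ,
    M = ℓ * Real.exp Λ ∧ M = a * -c * Real.exp (-a * Λ) ∧
    M = (a * -c) ^ (1 / (1 + a)) * ℓ ^ phaseExp a ∧
    Real.exp Λ = (a * -c) ^ (1 / (1 + a)) * ℓ ^ (-(1 / (1 + a))) := by
  have hac : 0 < a * -c := by nlinarith
  have h1 : Real.exp ((Real.log (a * -c) - Real.log ℓ) / (1 + a)) =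
      (a * -c) ^ (1 / (1 + a)) * ℓ ^ (-(1 / (1 + a))) := by
    rw [Real.rpow_def_of_pos hac, Real.rpow_def_of_pos hℓ, ← Real.exp_add]
    ring_nf
  have h2 : ℓ * Real.exp ((Real.log (a * -c) - Real.log ℓ) / (1 + a)) =
      (a * -c) ^ (1 / (1 + a)) * ℓ ^ phaseExp a := by
    rw [h1, phaseExp_eq ha, sub_eq_add_neg, Real.rpow_add hℓ, Real.rpow_one]
    ring
  refine ⟨(Real.log (a * -c) - Real.log ℓ) / (1 + a), _, rfl, ?_, h2, h1⟩
  have e1 : ℓ = Real.exp (Real.log ℓ) := (Real.exp_log hℓ).symm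
  have e2 : a * -c = Real.exp (Real.log (a * -c)) := (Real.exp_log hac).symm
  calc ℓ * Real.exp ((Real.log (a * -c) - Real.log ℓ) / (1 + a)) =
      Real.exp (Real.log ℓ) * Real.exp ((Real.log (a * -c) - Real.log ℓ) / (1 + a)) := by rw [← e1]
    _ = Real.exp (Real.log (a * -c)) *
        Real.exp (-a * ((Real.log (a * -c) - Real.log ℓ) / (1 + a))) := by
        rw [← Real.exp_add, ← Real.exp_add]; congr 1; field_simp; ring
    _ = _ := by rw [← e2]

/-- A₂ + iA₃ is (-ac)^{1/(1+a)} times the saddle value of psi, the prefactor being the constant in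
the relation between M and ℓ^{a/(1+a)}. -/
theorem A₂_eq : A₂ c (-a) = (a * -c) ^ (1 / (1 + a)) * (psi a (path a 0)).re := by
  rw [psi_path_zero_re ha, A₂, halfAngle, show c * -a = a * -c by ring,
    show 1 - -a = 1 + a by ring, inv_neg,
    show 2 * (Real.pi / (2 * (1 + a))) = Real.pi / (1 + a) by field_simp]
  ring

theorem A₃_eq : A₃ c (-a) = (a * -c) ^ (1 / (1 + a)) * (psi a (path a 0)).im := by
  rw [psi_path_zero_im ha, A₃, halfAngle, show c * -a = a * -c by ring,
    show 1 - -a = 1 + a by ring, inv_neg,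
    show 2 * (Real.pi / (2 * (1 + a))) = Real.pi / (1 + a) by field_simp]
  ring

omit ha in
theorem A₄_eq : A₄ (-a) = -halfAngle a := by
  rw [A₄, halfAngle, show 2 * (-a - 1) = -(2 * (1 + a)) by ring, div_neg]

theorem A₁_eq (hc : c < 0) : A₁ c (-a) =
    -(Real.sqrt (2 / (Real.pi * (1 + a))) / Real.sqrt ((a * -c) ^ (1 / (1 + a)))) := by
  have hac : 0 < a * -c := by nlinarith
  rw [A₁, show c * -a = a * -c by ring, show 1 - -a = 1 + a by ring,
    Real.sqrt_eq_rpow ((a * -c) ^ (1 / (1 + a))), ← Real.rpow_mul hac.le,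
    show 1 / (2 * (-a - 1)) = -(1 / (1 + a) * (1 / 2)) by
      rw [show 2 * (-a - 1) = -(2 * (1 + a)) by ring, div_neg]; field_simp,
    Real.rpow_neg hac.le]
  ring

omit ha in
theorem sqrt_rpow {x : ℝ} (hx : 0 < x) (p : ℝ) : Real.sqrt (x ^ p) = x ^ (p / 2) := by
  rw [Real.sqrt_eq_rpow, ← Real.rpow_mul hx.le]; ring_nf

theorem exists_norm_wright_one_le (hc : c < 0) : ∃ C : ℝ, 0 < C ∧ ∀ ℓ y : ℝ, 1 ≤ ℓ → |y| ≤ 1 →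
    ‖wright a c 1 (ℓ + y * I)‖ ≤ C * size a c ℓ := by
  obtain ⟨C, hC, hb⟩ := exists_wright_deriv_bound ha hc
  have hac : 0 < a * -c := by nlinarith
  set G := (a * -c) ^ (1 / (1 + a)) with hG
  have hG0 : 0 < G := by positivity
  refine ⟨C * G / Real.sqrt G, by positivity, fun ℓ y hℓ hy => ?_⟩
  have hℓ0 : 0 < ℓ := by linarith
  obtain ⟨Λ, M, h1, h2, h3, h4⟩ := exists_scale ha hc hℓ0
  refine (hb ℓ Λ M y hℓ hy h1 h2).trans_eq ?_
  rw [size, A₂_eq ha, ← hG, h4, h3, ← hG, Real.sqrt_mul hG0.le, sqrt_rpow hℓ0, neg_add,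
    Real.rpow_add hℓ0, Real.rpow_neg hℓ0.le (phaseExp a / 2)]
  field_simp

/-- The saddle point estimate with M expressed through ℓ. Since A₁ is negative, the plus sign is
really a difference between W and the saddle contribution. -/
theorem exists_norm_wright_zero_sub_le (hc : c < 0) : ∃ C : ℝ, 0 < C ∧ ∀ ℓ : ℝ, 0 < ℓ →
    ‖wright a c 0 ℓ + ((A₁ c (-a) * Real.exp (A₂ c (-a) * ℓ ^ phaseExp a) *
      ℓ ^ (-(phaseExp a / 2)) * Real.cos (A₃ c (-a) * ℓ ^ phaseExp a + A₄ (-a)) : ℝ) : ℂ)‖ ≤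
      C * (ℓ ^ (-phaseExp a) * Real.exp (A₂ c (-a) * ℓ ^ phaseExp a)) := by
  obtain ⟨C, hC, hb⟩ := exists_wright_asymp (c := c) ha
  have hac : 0 < a * -c := by nlinarith
  set G := (a * -c) ^ (1 / (1 + a)) with hG
  have hG0 : 0 < G := by positivity
  refine ⟨C / G, by positivity, fun ℓ hℓ0 => ?_⟩
  obtain ⟨Λ, M, h1, h2, h3, h4⟩ := exists_scale ha hc hℓ0
  have h := hb ℓ Λ M hℓ0 h1 h2
  have hpi := Real.pi_pos
  have e1 : Real.sqrt (2 / (Real.pi * (1 + a) * M)) = -A₁ c (-a) * ℓ ^ (-(phaseExp a / 2)) := by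
    rw [A₁_eq ha hc, ← hG, ← div_div, Real.sqrt_div (by positivity), h3, ← hG,
      Real.sqrt_mul hG0.le, sqrt_rpow hℓ0, Real.rpow_neg hℓ0.le]
    field_simp
  have e2 : M * (psi a (path a 0)).re = A₂ c (-a) * ℓ ^ phaseExp a := by
    rw [A₂_eq ha, h3]; ring
  have e3 : M * (psi a (path a 0)).im = A₃ c (-a) * ℓ ^ phaseExp a := by
    rw [A₃_eq ha, h3]; ring
  have e4 : A₃ c (-a) * ℓ ^ phaseExp a - halfAngle a =
      A₃ c (-a) * ℓ ^ phaseExp a + A₄ (-a) := by rw [A₄_eq]; ring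
  rw [e1, e2, e3, e4] at h
  refine (le_of_eq ?_).trans (h.trans_eq ?_)
  · congr 1; push_cast; ring
  · rw [h3, ← hG, Real.rpow_neg hℓ0.le]
    field_simp

theorem exists_size_le : ∃ T : ℝ, 1 ≤ T ∧ ∀ r ≥ T, ∀ ℓ ≥ T,
    size a c r ≤ size a c ℓ * Real.exp (|r - ℓ| / 4) := by
  have := phaseExp_pos ha
  exact exists_rpow_mul_exp_rpow_le (A := A₂ c (-a)) (phaseExp_pos ha) (phaseExp_lt ha)
    (q := 1 / (1 + a) + phaseExp a / 2) (by positivity)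

omit ha in
theorem size_pos {x : ℝ} (hx : 0 < x) : 0 < size a c x := by unfold size; positivity

/-- The increments of `wright a c 0`. -/
theorem exists_norm_wright_sub_le (hc : c < 0) : ∃ C T : ℝ, 0 < C ∧ 1 ≤ T ∧
    (∀ r ≥ T, ∀ ℓ ≥ T, ∀ y : ℝ, |y| ≤ 1 → ‖wright a c 0 (r + y * I) - wright a c 0 ℓ‖ ≤
      C * size a c ℓ * Real.exp (|r - ℓ| / 2)) ∧
    (∀ ℓ ≥ T, Real.exp (-ℓ / 4) ≤ C * size a c ℓ) := by
  obtain ⟨C, hC, hb⟩ := exists_norm_wright_one_le ha hc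
  obtain ⟨T, hT1, hT⟩ := exists_size_le (c := c) ha
  have hsT := size_pos (a := a) (c := c) (by linarith : 0 < T)
  refine ⟨max (4 * C) (1 / size a c T), T, lt_max_of_lt_left (by positivity), hT1, ?_, ?_⟩
  · intro r hr ℓ hℓ y hy
    have hsℓ := size_pos (a := a) (c := c) (by linarith : 0 < ℓ)
    set s : Set ℂ := uIcc ℓ r ×ℂ Icc (-1) 1 with hs
    have hconv : Convex ℝ s := 
      ((convex_uIcc ℓ r).linear_preimage Complex.reLm).inter
        ((convex_Icc (-1 : ℝ) 1).linear_preimage Complex.imLm)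
    have hre : ∀ w ∈ s, T ≤ w.re ∧ |w.re - ℓ| ≤ |r - ℓ| := by
      intro w hw
      have h1 : w.re ∈ uIcc ℓ r := hw.1
      exact ⟨(le_inf hℓ hr).trans h1.1, abs_sub_left_of_mem_uIcc h1⟩
    have hd : ∀ w ∈ s, HasDerivWithinAt (wright a c 0) (wright a c 1 w) s w := fun w hw =>
      (hasDerivAt_wright ha 0 (by linarith [(hre w hw).1])).hasDerivWithinAt
    have hbd : ∀ w ∈ s, ‖wright a c 1 w‖ ≤ C * (size a c ℓ * Real.exp (|r - ℓ| / 4)) := by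
      intro w hw
      have h1 := hb w.re w.im (by linarith [(hre w hw).1]) (abs_le.2 hw.2)
      rw [Complex.re_add_im] at h1
      refine h1.trans ?_
      gcongr
      refine (hT w.re (hre w hw).1 ℓ hℓ).trans ?_
      exact mul_le_mul_of_nonneg_left (Real.exp_le_exp.2 (by linarith [(hre w hw).2])) hsℓ.le
    have hmem1 : (ℓ : ℂ) ∈ s := by
      rw [hs, mem_reProdIm]
      simp
    have hmem2 : (r + y * I : ℂ) ∈ s := by
      rw [hs, mem_reProdIm]
      simpa using abs_le.1 hy
    have h := hconv.norm_image_sub_le_of_norm_hasDerivWithin_le hd hbd hmem1 hmem2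
    -- One factor e^{|r-ℓ|/4} comes from the length of the step, another from the variation of
    -- `size`. Their product e^{|r-ℓ|/2} is still beaten by the kernel's decay e^{-|r-ℓ|}.
    have hdist : ‖(r + y * I : ℂ) - ℓ‖ ≤ 4 * Real.exp (|r - ℓ| / 4) := by
      have e1 : (r + y * I : ℂ) - ℓ = ((r - ℓ : ℝ) : ℂ) + y * I := by push_cast; ring
      rw [e1]
      refine (norm_add_le _ _).trans ?_
      rw [norm_mul, norm_I, mul_one, Complex.norm_real, Complex.norm_real, Real.norm_eq_abs,
        Real.norm_eq_abs]
      linarith [Real.add_one_le_exp (|r - ℓ| / 4)]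
    calc _ ≤ C * (size a c ℓ * Real.exp (|r - ℓ| / 4)) * (4 * Real.exp (|r - ℓ| / 4)) :=
          h.trans (by gcongr)
      _ = (4 * C) * size a c ℓ * (Real.exp (|r - ℓ| / 4) * Real.exp (|r - ℓ| / 4)) := by ring
      _ = (4 * C) * size a c ℓ * Real.exp (|r - ℓ| / 2) := by rw [← Real.exp_add]; ring_nf
      _ ≤ _ := by gcongr; exact le_max_left _ _
  -- Comparison with the fixed point T shows that `size` decays no faster than e^{-ℓ/4}, so
  -- exponentially small errors may be absorbed in it.
  · intro ℓ hℓ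
    have hsℓ := size_pos (a := a) (c := c) (by linarith : 0 < ℓ)
    have h := hT T le_rfl ℓ hℓ
    rw [abs_sub_comm, abs_of_nonneg (by linarith)] at h
    have h2 : Real.exp ((ℓ - T) / 4) ≤ Real.exp (ℓ / 4) := Real.exp_le_exp.2 (by linarith)
    have h3 : size a c T ≤ size a c ℓ * Real.exp (ℓ / 4) := h.trans (by gcongr)
    calc Real.exp (-ℓ / 4) = 1 / size a c T * (size a c T * Real.exp (-ℓ / 4)) := by field_simp
      _ ≤ 1 / size a c T * ((size a c ℓ * Real.exp (ℓ / 4)) * Real.exp (-ℓ / 4)) := by gcongr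
      _ = 1 / size a c T * size a c ℓ * (Real.exp (ℓ / 4) * Real.exp (-ℓ / 4)) := by ring
      _ = 1 / size a c T * size a c ℓ := by
          rw [← Real.exp_add, show ℓ / 4 + -ℓ / 4 = 0 by ring, Real.exp_zero, mul_one]
      _ ≤ _ := by gcongr; exact le_max_right _ _

end


/-! ### Concentration of the kernel at t = log|z| -/

theorem exists_norm_fermi_le {z : ℂ} (hz : z ∈ slitDomain) :
    ∃ K : ℝ, 0 ≤ K ∧ ∀ t : ℝ, 0 < t → ‖fermi z t‖ ≤ K * Real.exp (-t) := by
  obtain ⟨m, hm, hlow⟩ := exists_lower_bound hz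
  refine ⟨‖z‖ / m ^ 2, by positivity, fun t ht => ?_⟩
  have h := hlow z (Metric.mem_ball_self hm) _ (exp_neg_mem_Icc ht)
  have hexp : Complex.exp (-(t : ℂ)) = (Real.exp (-t) : ℝ) := by push_cast; rfl
  rw [fermi, hexp, norm_div, norm_mul, norm_pow, Complex.norm_real,
    Real.norm_of_nonneg (Real.exp_pos _).le, mul_div_right_comm]
  gcongr

theorem one_add_mul_exp_ne_zero {z : ℂ} (hz : z ∈ slitDomain) {t : ℝ} (ht : 0 ≤ t) :
    1 + z * Complex.exp (-(t : ℂ)) ≠ 0 := by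
  have := one_add_mul_ne_zero hz (u := Real.exp (-t))
    ⟨(Real.exp_pos _).le, Real.exp_le_one_iff.2 (by linarith)⟩
  simpa using this

theorem integrableOn_fermi {z : ℂ} (hz : z ∈ slitDomain) :
    IntegrableOn (fun t : ℝ => fermi z t) (Ioi 0) := by
  obtain ⟨K, hK, hb⟩ := exists_norm_fermi_le hz
  have := (integrableOn_exp_neg_mul one_pos).const_mul K
  refine this.mono' (measurable_fermi z).aestronglyMeasurable ?_
  filter_upwards [ae_restrict_mem measurableSet_Ioi] with t ht
  rw [one_mul]
  exact hb t ht

theorem integrableOn_wright_mul_fermi {a c : ℝ} (ha : 0 < a) {z : ℂ} (hz : z ∈ slitDomain) :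
    IntegrableOn (fun t : ℝ => wright a c 0 t * fermi z t) (Ioi 0) := by
  obtain ⟨K, hK, hb⟩ := exists_norm_fermi_le hz
  have := (integrableOn_exp_mul_wright (c := c) ha).const_mul K
  refine this.mono' ((aestronglyMeasurable_wright ha 0).mul
    (measurable_fermi z).aestronglyMeasurable) ?_
  filter_upwards [ae_restrict_mem measurableSet_Ioi] with t ht
  rw [norm_mul]
  have := hb t ht
  calc _ ≤ ‖wright a c 0 t‖ * (K * Real.exp (-t)) := by gcongr
    _ = _ := by ring

/-- The kernel is the t-derivative of 1/(1 + z e^{-t}), which goes from 1/(1 + z) at t = 0 to 1 at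
infinity. -/
theorem integral_fermi {z : ℂ} (hz : z ∈ slitDomain) :
    ∫ t in Ioi (0 : ℝ), fermi z t = z / (1 + z) := by
  have hd : ∀ t ∈ Ici (0 : ℝ), HasDerivAt (fun t : ℝ => (1 + z * Complex.exp (-(t : ℂ)))⁻¹)
      (fermi z t) t := by
    intro t ht
    have h0 := one_add_mul_exp_ne_zero hz ht
    have h1 : HasDerivAt (fun t : ℝ => Complex.exp (-(t : ℂ))) (-Complex.exp (-(t : ℂ))) t := by
      simpa using ((ofRealCLM.hasDerivAt (x := t)).neg).cexp
    refine (((h1.const_mul z).const_add 1).fun_inv h0).congr_deriv ?_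
    rw [fermi]; ring
  have hlim : Tendsto (fun t : ℝ => (1 + z * Complex.exp (-(t : ℂ)))⁻¹) atTop (𝓝 1) := by
    have h1 : Tendsto (fun t : ℝ => Complex.exp (-(t : ℂ))) atTop (𝓝 0) := by
      rw [Complex.tendsto_exp_nhds_zero_iff]
      simpa using tendsto_neg_atTop_atBot
    have h2 := ((h1.const_mul z).const_add 1).inv₀ (by simp)
    simpa using h2
  rw [integral_Ioi_of_hasDerivAt_of_tendsto' hd (integrableOn_fermi hz) hlim]
  have h0 := one_add_mul_exp_ne_zero hz le_rfl
  simp only [ofReal_zero, neg_zero, Complex.exp_zero, mul_one] at h0 ⊢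
  field_simp
  ring

section
variable {z : ℂ} (hz : z ≠ 0)
include hz

theorem mul_exp_neg_eq (r y : ℝ) : z * Complex.exp (-(r + y * I)) =
    Real.exp (Real.log ‖z‖ - r) * (Real.cos (z.arg - y) + Real.sin (z.arg - y) * I) := by
  have h1 : z = Complex.exp (Real.log ‖z‖ + z.arg * I) := by
    conv_lhs => rw [← Complex.exp_log hz]
    congr 1
  conv_lhs => rw [h1]
  rw [← Complex.exp_add, show (Real.log ‖z‖ : ℂ) + z.arg * I + -(r + y * I) =
    ((Real.log ‖z‖ - r : ℝ) : ℂ) + ((z.arg - y : ℝ) : ℂ) * I by push_cast; ring, Complex.exp_add,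
    Complex.exp_mul_I, ofReal_exp, ofReal_cos, ofReal_sin]

theorem norm_mul_exp_neg (r y : ℝ) : ‖z * Complex.exp (-(r + y * I))‖ =
    Real.exp (Real.log ‖z‖ - r) := by
  rw [mul_exp_neg_eq hz, norm_mul, Complex.norm_add_mul_I, Real.cos_sq_add_sin_sq,
    Real.sqrt_one, mul_one, Complex.norm_real, Real.norm_of_nonneg (Real.exp_pos _).le]

theorem norm_fermi_eq (r y : ℝ) : ‖fermi z (r + y * I)‖ =
    Real.exp (Real.log ‖z‖ - r) / ‖1 + z * Complex.exp (-(r + y * I))‖ ^ 2 := by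
  rw [fermi, norm_div, norm_pow, norm_mul_exp_neg hz]

theorem norm_fermi_le_left {r : ℝ} (y : ℝ) (h : r + 1 ≤ Real.log ‖z‖) :
    ‖fermi z (r + y * I)‖ ≤ 4 * Real.exp (r - Real.log ‖z‖) := by
  rw [norm_fermi_eq hz]
  have h1 := norm_mul_exp_neg hz r y
  set ρ := Real.exp (Real.log ‖z‖ - r) with hρ
  have h2 : 2 ≤ ρ := by
    have := Real.add_one_le_exp (Real.log ‖z‖ - r)
    linarith
  have h3 : ρ / 2 ≤ ‖1 + z * Complex.exp (-(r + y * I))‖ := by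
    have := norm_sub_norm_le (z * Complex.exp (-(r + y * I))) (-1)
    rw [h1, norm_neg, norm_one, sub_neg_eq_add, add_comm (z * _)] at this
    linarith
  have h4 : Real.exp (r - Real.log ‖z‖) = 1 / ρ := by
    rw [hρ, one_div, ← Real.exp_neg, neg_sub]
  rw [h4]
  calc ρ / ‖1 + z * Complex.exp (-(r + y * I))‖ ^ 2 ≤ ρ / (ρ / 2) ^ 2 := by gcongr
    _ = _ := by field_simp; ring

theorem norm_fermi_le_right {r : ℝ} (y : ℝ) (h : Real.log ‖z‖ + 1 ≤ r) :
    ‖fermi z (r + y * I)‖ ≤ 4 * Real.exp (Real.log ‖z‖ - r) := by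
  rw [norm_fermi_eq hz]
  have h1 := norm_mul_exp_neg hz r y
  set ρ := Real.exp (Real.log ‖z‖ - r) with hρ
  have hρ0 : 0 < ρ := Real.exp_pos _
  have h2 : ρ ≤ 1 / 2 := by
    have := Real.add_one_le_exp (r - Real.log ‖z‖)
    rw [hρ, ← neg_sub, Real.exp_neg, ← one_div]
    exact one_div_le_one_div_of_le (by norm_num) (by linarith)
  have h3 : 1 / 2 ≤ ‖1 + z * Complex.exp (-(r + y * I))‖ := by
    have := norm_sub_norm_le 1 (-(z * Complex.exp (-(r + y * I))))
    rw [norm_neg, h1, norm_one, sub_neg_eq_add] at this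
    linarith
  calc ρ / ‖1 + z * Complex.exp (-(r + y * I))‖ ^ 2 ≤ ρ / (1 / 2) ^ 2 := by gcongr
    _ = _ := by ring

/-- Writing ρ = |z| e^{-r}, the squared denominator is 1 + 2ρ cos(arg z - y) + ρ². Keeping the
cosine away from -1 makes it comparable to 1 + ρ², even at ρ = 1, the modulus at which the poles
lie. -/
theorem norm_fermi_le_of_cos {r y : ℝ} (h : -Real.cos 1 ≤ Real.cos (z.arg - y)) :
    ‖fermi z (r + y * I)‖ ≤ 9 / 4 * Real.exp (-|r - Real.log ‖z‖|) := by
  rw [norm_fermi_eq hz]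
  have hsq : ‖1 + z * Complex.exp (-(r + y * I))‖ ^ 2 = 1 + 2 * Real.exp (Real.log ‖z‖ - r) *
      Real.cos (z.arg - y) + Real.exp (Real.log ‖z‖ - r) ^ 2 := by
    rw [mul_exp_neg_eq hz, Complex.sq_norm, Complex.normSq_apply]
    set ρ := Real.exp (Real.log ‖z‖ - r)
    set C := Real.cos (z.arg - y) with hC
    set S := Real.sin (z.arg - y) with hS
    have h1 : S ^ 2 + C ^ 2 = 1 := Real.sin_sq_add_cos_sq _
    simp only [mul_im, mul_re, add_im, add_re, ofReal_re, ofReal_im, I_re, I_im, one_re, one_im]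
    linear_combination ρ ^ 2 * h1
  rw [hsq]
  set ρ := Real.exp (Real.log ‖z‖ - r) with hρ
  have hρ0 : 0 < ρ := Real.exp_pos _
  have hc1 := Real.cos_one_le
  -- From 2ρ ≤ 1 + ρ² and cos 1 ≤ 5/9, with 4/9 = 1 - 5/9.
  have hlow : 4 / 9 * (1 + ρ ^ 2) ≤ 1 + 2 * ρ * Real.cos (z.arg - y) + ρ ^ 2 := by
    nlinarith [sq_nonneg (1 - ρ)]
  have h2 : ρ / (1 + 2 * ρ * Real.cos (z.arg - y) + ρ ^ 2) ≤ ρ / (4 / 9 * (1 + ρ ^ 2)) := by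
    gcongr
  refine h2.trans ?_
  rcases le_total (Real.log ‖z‖) r with h3 | h3
  · have e : Real.exp (-|r - Real.log ‖z‖|) = ρ := by
      rw [abs_of_nonneg (by linarith), neg_sub]
    rw [e, div_le_iff₀ (by positivity)]
    nlinarith [pow_pos hρ0 3]
  · have e : Real.exp (-|r - Real.log ‖z‖|) = 1 / ρ := by
      rw [abs_of_nonpos (by linarith), neg_neg, hρ, one_div, ← Real.exp_neg, neg_sub]
    rw [e, div_le_iff₀ (by positivity)]
    have : 9 / 4 * (1 / ρ) * (4 / 9 * (1 + ρ ^ 2)) = 1 / ρ + ρ := by field_simp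
    rw [this]
    have : 0 < 1 / ρ := by positivity
    linarith

theorem one_add_mul_exp_ne_zero' {r y : ℝ} (h1 : -Real.pi < z.arg - y) (h2 : z.arg - y < Real.pi) :
    1 + z * Complex.exp (-(r + y * I)) ≠ 0 := by
  intro h
  rw [mul_exp_neg_eq hz] at h
  set ρ := Real.exp (Real.log ‖z‖ - r) with hρ
  have hρ0 : 0 < ρ := Real.exp_pos _
  have hre := congrArg Complex.re h
  have him := congrArg Complex.im h
  simp only [mul_im, mul_re, add_im, add_re, ofReal_re, ofReal_im, I_re, I_im, one_re, one_im,
    zero_re, zero_im] at hre him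
  have hs : Real.sin (z.arg - y) = 0 := by
    have : ρ * Real.sin (z.arg - y) = 0 := by linarith
    exact (mul_eq_zero.1 this).resolve_left hρ0.ne'
  have h0 := (Real.sin_eq_zero_iff_of_lt_of_lt h1 h2).1 hs
  rw [h0, Real.cos_zero] at hre
  linarith

end

theorem mem_slitDomain_of_arg {z : ℂ} (hz : z ≠ 0) (h : z.arg ≠ Real.pi) : z ∈ slitDomain := by
  have h1 : z ∈ Complex.slitPlane := Complex.mem_slitPlane_iff_arg.2 ⟨h, hz⟩
  rw [slitDomain, mem_ofPred_eq, Complex.mem_slitPlane_iff, add_re, add_im, one_re, one_im, add_zero]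
  rcases Complex.mem_slitPlane_iff.1 h1 with h2 | h2
  · left; linarith
  · right; exact h2

theorem integrable_exp_neg_abs {b : ℝ} (hb : 0 < b) (ℓ : ℝ) :
    Integrable (fun r : ℝ => Real.exp (-(b * |r - ℓ|))) := by
  have h0 : Integrable (fun r : ℝ => Real.exp (-(b * |r|))) := by
    have h1 : IntegrableOn (fun r : ℝ => Real.exp (-(b * |r|))) (Ioi 0) := by
      refine (integrableOn_exp_neg_mul hb).congr_fun (fun r hr => ?_) measurableSet_Ioi
      rw [abs_of_pos hr]
    have h2 : IntegrableOn (fun r : ℝ => Real.exp (-(b * |r|))) (Iic 0) := by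
      refine (integrableOn_exp_mul_Iic hb 0).congr_fun (fun r hr => ?_) measurableSet_Iic
      rw [abs_of_nonpos hr, mul_neg, neg_neg]
    rw [← integrableOn_univ, ← Iic_union_Ioi (a := (0 : ℝ))]
    exact h2.union h1
  exact h0.comp_sub_right ℓ

theorem integral_exp_neg_abs {b : ℝ} (hb : 0 < b) (ℓ : ℝ) :
    ∫ r : ℝ, Real.exp (-(b * |r - ℓ|)) = 2 / b := by
  rw [integral_sub_right_eq_self (fun r : ℝ => Real.exp (-(b * |r|))) ℓ,
    integral_comp_abs (f := fun r => Real.exp (-(b * r)))]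
  have := integral_exp_mul_Ioi (neg_lt_zero.2 hb) 0
  simp only [neg_mul, mul_zero, Real.exp_zero] at this
  rw [this]
  field_simp

/-- The nearest poles of the kernel have imaginary parts φ ± π. For φ ≥ 0 the closer one lies below
the real line, so one moves up by 1, and for φ ≤ 0 down by 1. No pole is crossed and the cosine
stays at least cos(π - 1), uniformly in φ. -/
theorem cos_arg_sub_bounds (φ : ℝ) (h1 : -Real.pi < φ) (h2 : φ < Real.pi) :
    ∃ σ : ℝ, |σ| = 1 ∧ -Real.cos 1 ≤ Real.cos (φ - σ) ∧
      ∀ y ∈ uIcc 0 σ, |y| ≤ 1 ∧ -Real.pi < φ - y ∧ φ - y < Real.pi := by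
  have hpi := Real.pi_gt_three
  rw [← Real.cos_pi_sub]
  rcases le_total 0 φ with h | h
  · refine ⟨1, by simp, ?_, fun y hy => ?_⟩
    · rw [← Real.cos_abs (φ - 1)]
      exact Real.cos_le_cos_of_nonneg_of_le_pi (abs_nonneg _) (by linarith)
        (abs_le.2 ⟨by linarith, by linarith⟩)
    · rw [uIcc_of_le zero_le_one] at hy
      exact ⟨abs_le.2 ⟨by linarith [hy.1], hy.2⟩, by linarith [hy.2], by linarith [hy.1]⟩
  · refine ⟨-1, by simp, ?_, fun y hy => ?_⟩
    · rw [← Real.cos_abs (φ - -1)]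
      exact Real.cos_le_cos_of_nonneg_of_le_pi (abs_nonneg _) (by linarith)
        (abs_le.2 ⟨by linarith, by linarith⟩)
    · rw [uIcc_of_ge (by norm_num)] at hy
      exact ⟨abs_le.2 ⟨hy.1, by linarith [hy.2]⟩, by linarith [hy.2], by linarith [hy.1]⟩

/-- Shifting a half-line by `σ i`. -/
theorem norm_integral_Ioi_le_of_shift {Φ : ℂ → ℂ} {T σ K : ℝ} (hσ : |σ| = 1)
    (hd : ∀ r ≥ T, ∀ y ∈ uIcc 0 σ, DifferentiableAt ℂ Φ (r + y * I))
    (hint : IntegrableOn (fun r : ℝ => Φ r) (Ioi T)) {k : ℝ → ℝ} (hk : Integrable k)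
    (hk0 : ∀ r, 0 ≤ k r)
    (hline : ∀ r ≥ T, ‖Φ (r + σ * I)‖ ≤ k r)
    (hleft : ∀ y ∈ uIcc 0 σ, ‖Φ (T + y * I)‖ ≤ K) {m : ℝ → ℝ} (hm : Tendsto m atTop (𝓝 0))
    (hright : ∀ᶠ R : ℝ in atTop, ∀ y ∈ uIcc 0 σ, ‖Φ (R + y * I)‖ ≤ m R) :
    ‖∫ r in Ioi T, Φ r‖ ≤ (∫ r, k r) + K := by
  have hcl : ContinuousOn (fun r : ℝ => Φ (r + σ * I)) (Ioi T) := fun r hr =>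
    (ContinuousAt.comp (f := fun r : ℝ => (r : ℂ) + σ * I)
      (hd r (le_of_lt hr) σ right_mem_uIcc).continuousAt (by fun_prop)).continuousWithinAt
  have hil : IntegrableOn (fun r : ℝ => Φ (r + σ * I)) (Ioi T) := by
    refine hk.restrict.mono' (hcl.aestronglyMeasurable measurableSet_Ioi) ?_
    filter_upwards [ae_restrict_mem measurableSet_Ioi] with r hr using hline r (le_of_lt hr)
  have hrect : ∀ R ≥ T, (∫ x in T..R, Φ x) - (∫ x in T..R, Φ (x + σ * I)) +
      I * (∫ y in (0)..σ, Φ (R + y * I)) - I * (∫ y in (0)..σ, Φ (T + y * I)) = 0 := by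
    intro R hR
    have h := Complex.integral_boundary_rect_eq_zero_of_differentiableOn Φ T (R + σ * I) (by
      intro w hw
      rw [mem_reProdIm] at hw
      simp only [add_re, add_im, ofReal_re, ofReal_im, mul_re, mul_im, I_re, I_im, mul_zero,
        mul_one, sub_zero, add_zero, zero_add] at hw
      rw [uIcc_of_le hR] at hw
      have := hd w.re hw.1.1 w.im hw.2
      rw [Complex.re_add_im] at this
      exact this.differentiableWithinAt)
    simpa using h
  have hside : ∀ R : ℝ, ∀ b : ℝ, (∀ y ∈ uIcc 0 σ, ‖Φ (R + y * I)‖ ≤ b) →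
      ‖I * ∫ y in (0)..σ, Φ (R + y * I)‖ ≤ b := by
    intro R b hb
    rw [norm_mul, norm_I, one_mul]
    have := intervalIntegral.norm_integral_le_of_norm_le_const (a := 0) (b := σ)
      (f := fun y : ℝ => Φ (R + y * I)) (C := b) fun y hy => hb y (uIoc_subset_uIcc hy)
    rwa [sub_zero, hσ, mul_one] at this
  have hlim : Tendsto (fun R : ℝ => I * ∫ y in (0)..σ, Φ (R + y * I)) atTop (𝓝 0) := by
    refine squeeze_zero_norm' ?_ hm
    filter_upwards [hright] with R hR using hside R _ hR
  have h1 := intervalIntegral_tendsto_integral_Ioi T hint tendsto_id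
  have h2 := intervalIntegral_tendsto_integral_Ioi T hil tendsto_id
  have h3 := ((h1.sub h2).add hlim).sub_const (I * (∫ y in (0)..σ, Φ (T + y * I)))
  have h4 := tendsto_nhds_unique h3 (tendsto_const_nhds.congr' (f₁ := fun _ => (0 : ℂ)) (by
    filter_upwards [eventually_ge_atTop T] with R hR using (hrect R hR).symm))
  have h5 : ∫ r in Ioi T, Φ r = (∫ r in Ioi T, Φ (r + σ * I)) +
      I * (∫ y in (0)..σ, Φ (T + y * I)) := by linear_combination h4
  rw [h5]
  refine (norm_add_le _ _).trans (add_le_add ?_ (hside T K hleft))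
  refine (norm_integral_le_of_norm_le hk.restrict ?_).trans
    (setIntegral_le_integral hk (Eventually.of_forall hk0))
  filter_upwards [ae_restrict_mem measurableSet_Ioi] with r hr using hline r (le_of_lt hr)

/-- W is compared with its value at ℓ = log|z|. Beyond T the difference is integrated on the shifted
line, where increments of W cost `size` and the kernel decays at a fixed rate; before T the kernel
is O(e^{t-ℓ}). Neither C nor L depends on arg z, which gives uniformity up to the cut. -/
theorem exists_norm_genExp_add_wright_le {a c : ℝ} (ha : 0 < a) (hc : c < 0) :
    ∃ C L : ℝ, 0 < C ∧ 1 ≤ L ∧ ∀ z : ℂ, z ≠ 0 → z.arg ≠ Real.pi → L ≤ Real.log ‖z‖ →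
      ‖genExp a c z + wright a c 0 (Real.log ‖z‖ : ℝ)‖ ≤ C * size a c (Real.log ‖z‖) := by
  obtain ⟨C₀, T, hC₀, hT1, hsub, hexp⟩ := exists_norm_wright_sub_le ha hc
  obtain ⟨C₁, hC₁, hW⟩ := exists_wright_zero_bound (c := c) ha
  set J := ∫ t in Ioi (0 : ℝ), Real.exp (-t) * ‖wright a c 0 t‖ with hJ
  have hJi := integrableOn_exp_mul_wright (c := c) ha
  have hJ0 : 0 ≤ J := integral_nonneg fun t => by positivity
  set D := 4 * Real.exp (2 * T) * (J + 2 * C₁) with hD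
  have hD0 : 0 ≤ D := by positivity
  refine ⟨C₀ * (13 + D + 4 * C₁), T + 1, by positivity, by linarith, fun z hz hπ hL => ?_⟩
  have hzs := mem_slitDomain_of_arg hz hπ
  obtain ⟨σ, hσ, hcos, hσy⟩ := cos_arg_sub_bounds z.arg (Complex.neg_pi_lt_arg z)
    (lt_of_le_of_ne (Complex.arg_le_pi z) hπ)
  have hznorm : ‖z‖ = Real.exp (Real.log ‖z‖) := (Real.exp_log (norm_pos_iff.2 hz)).symm
  have hfl := fun (r y : ℝ) => norm_fermi_le_left hz (r := r) y
  have hfr := fun (r y : ℝ) => norm_fermi_le_right hz (r := r) y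
  have hfc := fun (r : ℝ) => norm_fermi_le_of_cos hz (r := r) (y := σ) hcos
  set ℓ := Real.log ‖z‖ with hℓ
  have hℓT : T ≤ ℓ := by linarith
  set B := C₀ * size a c ℓ with hB
  have hB0 : 0 < B := mul_pos hC₀ (size_pos (by linarith))
  have hWℓ : ‖wright a c 0 ℓ‖ ≤ 2 * C₁ * Real.exp (ℓ / 2) := by
    refine (hW ℓ (by linarith)).trans ?_
    have h1 : ℓ ^ (-(1 / 2) : ℝ) ≤ 1 := Real.rpow_le_one_of_one_le_of_nonpos (by linarith) (by norm_num)
    have h2 : 1 ≤ Real.exp (ℓ / 2) := Real.one_le_exp (by linarith)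
    nlinarith
  have hexpB : Real.exp (-ℓ / 2) ≤ B :=
    (Real.exp_le_exp.2 (by linarith)).trans (hexp ℓ hℓT)
  set Φ : ℂ → ℂ := fun t => (wright a c 0 t - wright a c 0 ℓ) * fermi z t with hΦ
  have hΦi : IntegrableOn (fun t : ℝ => Φ t) (Ioi 0) := by
    refine ((integrableOn_wright_mul_fermi (c := c) ha hzs).sub
      ((integrableOn_fermi hzs).const_mul (wright a c 0 ℓ))).congr
      (Eventually.of_forall fun t => ?_)
    simp only [hΦ, Pi.sub_apply]; ring
  -- The kernel has mass z/(1 + z) instead of 1; the defect leaves W(ℓ)/(1 + z), which is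
  -- O(e^{-ℓ/2}).
  have hgen : genExp a c z + wright a c 0 ℓ =
      -(∫ t in Ioi (0 : ℝ), Φ t) + wright a c 0 ℓ / (1 + z) := by
    have h1 : ∫ t in Ioi (0 : ℝ), Φ t = (∫ t in Ioi (0 : ℝ), wright a c 0 t * fermi z t) -
        wright a c 0 ℓ * (z / (1 + z)) := by
      rw [← integral_fermi hzs, ← integral_const_mul, ← integral_sub
        (integrableOn_wright_mul_fermi ha hzs) ((integrableOn_fermi hzs).const_mul _)]
      congr 1; ext t
      simp only [hΦ]; ring
    have h2 : 1 + z ≠ 0 := by simpa using one_add_mul_exp_ne_zero hzs le_rfl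
    rw [h1, genExp]
    field_simp
    ring
  -- Near 0 the increment bound is not available, but crude bounds do: the kernel is O(e^{-ℓ}) there
  -- and |W(ℓ)| is O(e^{ℓ/2}).
  have hnear : ‖∫ t in Ioc 0 T, Φ t‖ ≤ D * B := by
    have hi : IntegrableOn (fun t : ℝ => 4 * Real.exp (2 * T) * Real.exp (-ℓ) *
        (Real.exp (-t) * ‖wright a c 0 t‖ + ‖wright a c 0 ℓ‖ * Real.exp (-(1 * t)))) (Ioi 0) :=
      (hJi.add ((integrableOn_exp_neg_mul one_pos).const_mul _)).const_mul _
    refine (norm_integral_le_of_norm_le (hi.mono_set Ioc_subset_Ioi_self) ?_).trans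
      ((setIntegral_mono_set hi (Eventually.of_forall fun t => by positivity)
        (Ioc_subset_Ioi_self.eventuallyLE)).trans ?_)
    · filter_upwards [ae_restrict_mem measurableSet_Ioc] with t ht
      have h1 := hfl t 0 (by linarith [ht.2])
      rw [ofReal_zero, zero_mul, add_zero] at h1
      have h2 : Real.exp (t - ℓ) ≤ Real.exp (2 * T) * Real.exp (-ℓ) * Real.exp (-t) := by
        rw [← Real.exp_add, ← Real.exp_add]
        exact Real.exp_le_exp.2 (by linarith [ht.2])
      simp only [hΦ]
      rw [norm_mul]
      calc _ ≤ (‖wright a c 0 t‖ + ‖wright a c 0 ℓ‖) *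
            (4 * (Real.exp (2 * T) * Real.exp (-ℓ) * Real.exp (-t))) := by
            gcongr
            · exact norm_sub_le _ _
            · exact h1.trans (by gcongr)
        _ = _ := by rw [one_mul]; ring
    · have h3 := integral_exp_mul_Ioi (neg_lt_zero.2 one_pos) 0
      simp only [neg_mul, mul_zero, Real.exp_zero] at h3
      rw [integral_const_mul, integral_add hJi ((integrableOn_exp_neg_mul one_pos).const_mul _),
        integral_const_mul, h3, ← hJ]
      have h4 : Real.exp (-ℓ) * (J + ‖wright a c 0 ℓ‖ * (-1 / -1)) ≤ (J + 2 * C₁) * B := by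
        have h5 : Real.exp (-ℓ) ≤ B := (Real.exp_le_exp.2 (by linarith)).trans hexpB
        have h6 : Real.exp (-ℓ) * (2 * C₁ * Real.exp (ℓ / 2)) ≤ 2 * C₁ * B := by
          calc _ = 2 * C₁ * (Real.exp (-ℓ) * Real.exp (ℓ / 2)) := by ring
            _ = 2 * C₁ * Real.exp (-ℓ / 2) := by rw [← Real.exp_add]; ring_nf
            _ ≤ _ := by gcongr
        have h7 : Real.exp (-ℓ) * ‖wright a c 0 ℓ‖ ≤
            Real.exp (-ℓ) * (2 * C₁ * Real.exp (ℓ / 2)) := by gcongr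
        rw [show (-1 : ℝ) / -1 = 1 by norm_num, mul_one]
        nlinarith
      calc _ = 4 * Real.exp (2 * T) * (Real.exp (-ℓ) * (J + ‖wright a c 0 ℓ‖ * (-1 / -1))) := by
            ring
        _ ≤ 4 * Real.exp (2 * T) * ((J + 2 * C₁) * B) := by gcongr
        _ = _ := by rw [hD]; ring
  -- The shifted line gives (9/4) B ∫ e^{-|r-ℓ|/2} dr = 9B, and the short vertical side at T gives
  -- 4B.
  have hfar : ‖∫ t in Ioi T, Φ t‖ ≤ 9 * B + 4 * B := by
    have hk := (integrable_exp_neg_abs (show (0 : ℝ) < 1 / 2 by norm_num) ℓ).const_mul (9 / 4 * B)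
    have hm : Tendsto (fun R : ℝ => 4 * B * Real.exp (-(R - ℓ) / 2)) atTop (𝓝 0) := by
      have h1 : Tendsto (fun R : ℝ => (R - ℓ) / 2) atTop atTop :=
        (tendsto_atTop_add_const_right _ (-ℓ) tendsto_id).atTop_div_const two_pos
      have h2 := (Real.tendsto_exp_neg_atTop_nhds_zero.comp h1).const_mul (4 * B)
      have h3 : ∀ R : ℝ, -(R - ℓ) / 2 = -((R - ℓ) / 2) := fun R => neg_div _ _
      simpa only [h3, mul_zero, Function.comp_def] using h2
    have := norm_integral_Ioi_le_of_shift (Φ := Φ) (T := T) (K := 4 * B) hσ ?_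
      (hΦi.mono_set (Ioi_subset_Ioi (by linarith))) hk (fun r => by positivity) ?_ ?_ hm ?_
    · rw [integral_const_mul, integral_exp_neg_abs (by norm_num)] at this
      linarith
    · intro r hr y hy
      have hr0 : 0 < ((r : ℂ) + y * I).re := by simp; linarith
      have hne := one_add_mul_exp_ne_zero' hz (r := r) (hσy y hy).2.1 (hσy y hy).2.2
      refine ((hasDerivAt_wright ha 0 hr0).differentiableAt.sub_const _).mul ?_
      unfold fermi
      exact DifferentiableAt.div (by fun_prop) (by fun_prop) (pow_ne_zero 2 hne)
    · intro r hr
      have h1 := hsub r hr ℓ hℓT σ hσ.le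
      have h2 := hfc r
      simp only [hΦ]
      rw [norm_mul]
      calc _ ≤ B * Real.exp (|r - ℓ| / 2) * (9 / 4 * Real.exp (-|r - ℓ|)) := by gcongr
        _ = 9 / 4 * B * (Real.exp (|r - ℓ| / 2) * Real.exp (-|r - ℓ|)) := by ring
        _ = _ := by rw [← Real.exp_add]; ring_nf
    · intro y hy
      have h1 := hsub T le_rfl ℓ hℓT y (hσy y hy).1
      have h2 := hfl T y (by linarith)
      rw [abs_of_nonpos (by linarith)] at h1
      simp only [hΦ]
      rw [norm_mul]
      calc _ ≤ B * Real.exp (-(T - ℓ) / 2) * (4 * Real.exp (T - ℓ)) := by gcongr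
        _ = 4 * B * (Real.exp (-(T - ℓ) / 2) * Real.exp (T - ℓ)) := by ring
        _ = 4 * B * Real.exp ((T - ℓ) / 2) := by rw [← Real.exp_add]; ring_nf
        _ ≤ 4 * B * 1 := by gcongr; exact Real.exp_le_one_iff.2 (by linarith)
        _ = _ := mul_one _
    · filter_upwards [eventually_ge_atTop (ℓ + 1)] with R hR y hy
      have h1 := hsub R (by linarith) ℓ hℓT y (hσy y hy).1
      have h2 := hfr R y (by linarith)
      rw [abs_of_nonneg (by linarith)] at h1
      simp only [hΦ]
      rw [norm_mul]
      calc _ ≤ B * Real.exp ((R - ℓ) / 2) * (4 * Real.exp (ℓ - R)) := by gcongr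
        _ = 4 * B * (Real.exp ((R - ℓ) / 2) * Real.exp (ℓ - R)) := by ring
        _ = _ := by rw [← Real.exp_add]; ring_nf
  have hlast : ‖wright a c 0 ℓ / (1 + z)‖ ≤ 4 * C₁ * B := by
    have h1 : Real.exp ℓ / 2 ≤ ‖1 + z‖ := by
      have h2 := norm_sub_norm_le z (-1)
      rw [norm_neg, norm_one, sub_neg_eq_add, add_comm z, hznorm] at h2
      have h3 := Real.add_one_le_exp ℓ
      linarith
    rw [norm_div]
    calc _ ≤ 2 * C₁ * Real.exp (ℓ / 2) / (Real.exp ℓ / 2) := by gcongr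
      _ = 4 * C₁ * (Real.exp (ℓ / 2) / Real.exp ℓ) := by ring
      _ = 4 * C₁ * Real.exp (-ℓ / 2) := by rw [← Real.exp_sub]; ring_nf
      _ ≤ _ := by gcongr
  have hsplit : ∫ t in Ioi (0 : ℝ), Φ t = (∫ t in Ioc 0 T, Φ t) + ∫ t in Ioi T, Φ t := by
    rw [← Ioc_union_Ioi_eq_Ioi (show (0 : ℝ) ≤ T by linarith)]
    exact setIntegral_union (Ioc_disjoint_Ioi le_rfl) measurableSet_Ioi
      (hΦi.mono_set Ioc_subset_Ioi_self) (hΦi.mono_set (Ioi_subset_Ioi (by linarith)))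
  rw [hgen, hsplit]
  refine (norm_add_le _ _).trans ?_
  rw [norm_neg]
  have := norm_add_le (∫ t in Ioc 0 T, Φ t) (∫ t in Ioi T, Φ t)
  calc _ ≤ (D * B + (9 * B + 4 * B)) + 4 * C₁ * B := by linarith
    _ = _ := by rw [hB]; ring


/-! ### From log|z| to log z, and assembly of the estimate -/

theorem norm_exp_sub_one_le_mul_exp (x : ℂ) : ‖Complex.exp x - 1‖ ≤ ‖x‖ * Real.exp ‖x‖ := by
  simpa using Complex.norm_exp_sub_sum_le_norm_mul_exp x 1

/-- Powers of `ℓ + i φ`, for bounded `φ` and `ℓ → ∞`. -/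
theorem exists_cpow_bounds (s : ℝ) : ∃ C : ℝ, 0 < C ∧ ∀ ℓ φ : ℝ, 2 * Real.pi ≤ ℓ → |φ| ≤ Real.pi →
    ‖((ℓ : ℂ) + φ * I) ^ (s : ℂ) - (ℓ ^ s : ℝ)‖ ≤ C * ℓ ^ (s - 1) ∧
    ℓ ^ s ≤ C * ‖((ℓ : ℂ) + φ * I) ^ (s : ℂ)‖ := by
  have hpi := Real.pi_pos
  refine ⟨max (|s| * (3 / 2 * Real.pi) * Real.exp |s|) (Real.exp |s|),
    lt_max_of_lt_right (Real.exp_pos _), fun ℓ φ hℓ hφ => ?_⟩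
  have hℓ0 : 0 < ℓ := by linarith
  have hℓ' : (ℓ : ℂ) ≠ 0 := by exact_mod_cast hℓ0.ne'
  set u : ℂ := (φ / ℓ : ℝ) * I with hu
  have hun : ‖u‖ ≤ Real.pi / ℓ := by
    rw [hu, norm_mul, norm_I, mul_one, Complex.norm_real, Real.norm_eq_abs, abs_div,
      abs_of_pos hℓ0]
    gcongr
  -- The threshold ℓ ≥ 2π serves to make |φ|/ℓ ≤ 1/2, the range in which |log(1 + u)| ≤ (3/2)|u|.
  have hu2 : ‖u‖ ≤ 1 / 2 := hun.trans (by rw [div_le_iff₀ hℓ0]; linarith)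
  have hlog := Complex.norm_log_one_add_half_le_self hu2
  have hu1 : 1 + u ≠ 0 := by
    intro h
    have := norm_sub_norm_le 1 (-u)
    rw [sub_neg_eq_add, h, norm_zero, norm_one, norm_neg] at this
    linarith
  have hfac : (ℓ : ℂ) + φ * I = ℓ * (1 + u) := by
    rw [hu]; push_cast; field_simp
  have hpow : ((ℓ : ℂ) + φ * I) ^ (s : ℂ) = (ℓ ^ s : ℝ) * Complex.exp (s * Complex.log (1 + u)) := by
    rw [hfac, Complex.cpow_def_of_ne_zero (mul_ne_zero hℓ' hu1), Complex.log_ofReal_mul hℓ0 hu1,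
      add_mul, Complex.exp_add, Real.rpow_def_of_pos hℓ0]
    push_cast
    ring_nf
  have hx1 : ‖(s : ℂ) * Complex.log (1 + u)‖ ≤ |s| * (3 / 2 * Real.pi) * ℓ⁻¹ := by
    rw [norm_mul, Complex.norm_real, Real.norm_eq_abs, mul_assoc]
    gcongr
    refine hlog.trans ?_
    rw [mul_assoc, ← div_eq_mul_inv]
    gcongr
  have hx2 : ‖(s : ℂ) * Complex.log (1 + u)‖ ≤ |s| := by
    rw [norm_mul, Complex.norm_real, Real.norm_eq_abs]
    have : ‖Complex.log (1 + u)‖ ≤ 1 := hlog.trans (by linarith)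
    exact mul_le_of_le_one_right (abs_nonneg s) this
  have hs0 : 0 < ℓ ^ s := by positivity
  rw [hpow]
  constructor
  · have e1 : ((ℓ ^ s : ℝ) : ℂ) * Complex.exp (s * Complex.log (1 + u)) - (ℓ ^ s : ℝ) =
        (ℓ ^ s : ℝ) * (Complex.exp (s * Complex.log (1 + u)) - 1) := by ring
    rw [e1, norm_mul, Complex.norm_real, Real.norm_of_nonneg hs0.le]
    have h1 := norm_exp_sub_one_le_mul_exp (s * Complex.log (1 + u))
    calc _ ≤ ℓ ^ s * ((|s| * (3 / 2 * Real.pi) * ℓ⁻¹) * Real.exp |s|) := by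
          refine mul_le_mul_of_nonneg_left (h1.trans ?_) hs0.le
          gcongr
      _ = (|s| * (3 / 2 * Real.pi) * Real.exp |s|) * ℓ ^ (s - 1) := by
          rw [Real.rpow_sub_one hℓ0.ne']; ring
      _ ≤ _ := by gcongr; exact le_max_left _ _
  · rw [norm_mul, Complex.norm_real, Real.norm_of_nonneg hs0.le, Complex.norm_exp]
    have h1 := (abs_le.1 (Complex.abs_re_le_norm (s * Complex.log (1 + u)))).1
    have h2 : 1 ≤ Real.exp |s| * Real.exp (s * Complex.log (1 + u)).re := by
      rw [← Real.exp_add]; exact Real.one_le_exp (by linarith)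
    calc ℓ ^ s = ℓ ^ s * 1 := (mul_one _).symm
      _ ≤ ℓ ^ s * (Real.exp |s| * Real.exp (s * Complex.log (1 + u)).re) := by gcongr
      _ = Real.exp |s| * (ℓ ^ s * Real.exp (s * Complex.log (1 + u)).re) := by ring
      _ ≤ _ := by gcongr; exact le_max_right _ _

theorem norm_exp_mul_sub_le (κ P : ℂ) (x : ℝ) :
    ‖Complex.exp (κ * P) - Complex.exp (κ * x)‖ ≤
      Real.exp (κ.re * x) * (‖κ‖ * ‖P - x‖ * Real.exp (‖κ‖ * ‖P - x‖)) := by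
  have h : Complex.exp (κ * P) - Complex.exp (κ * x) =
      Complex.exp (κ * x) * (Complex.exp (κ * (P - x)) - 1) := by
    rw [mul_sub, mul_one, ← Complex.exp_add]; ring_nf
  rw [h, norm_mul, Complex.norm_exp, re_mul_ofReal, ← norm_mul]
  gcongr
  exact norm_exp_sub_one_le_mul_exp _

/-- The oscillating factor of the main term is stable under bounded perturbations. -/
theorem exists_osc_sub_le (A B D K : ℝ) : ∃ C : ℝ, 0 < C ∧ ∀ (P : ℂ) (x : ℝ), ‖P - x‖ ≤ K →
    ‖Complex.exp (A * P) * Complex.cos (B * P + D) -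
      ((Real.exp (A * x) * Real.cos (B * x + D) : ℝ) : ℂ)‖ ≤ C * Real.exp (A * x) * ‖P - x‖ := by
  set κ : ℂ := A + B * I with hκ
  set κ' : ℂ := A - B * I with hκ'
  have hre : κ.re = A := by simp [hκ]
  have hre' : κ'.re = A := by simp [hκ']
  refine ⟨‖κ‖ * Real.exp (‖κ‖ * K) + ‖κ'‖ * Real.exp (‖κ'‖ * K) + 1, by positivity,
    fun P x hP => ?_⟩
  -- The product is a combination of e^{(A ± iB)P}. Both have modulus e^{Ax} at real x, so the
  -- cosine at complex arguments costs only a constant while P - x is bounded.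
  have e : ∀ P : ℂ, Complex.exp (A * P) * Complex.cos (B * P + D) =
      (Complex.exp (D * I) * Complex.exp (κ * P) +
        Complex.exp (-(D * I)) * Complex.exp (κ' * P)) / 2 := by
    intro P
    rw [Complex.cos, ← Complex.exp_add, ← Complex.exp_add, mul_div_assoc', mul_add,
      ← Complex.exp_add, ← Complex.exp_add, hκ, hκ']
    ring_nf
  have e2 : ((Real.exp (A * x) * Real.cos (B * x + D) : ℝ) : ℂ) =
      Complex.exp (A * x) * Complex.cos (B * x + D) := by push_cast; ring
  rw [e2, e, e]
  have e3 : (Complex.exp (D * I) * Complex.exp (κ * P) +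
        Complex.exp (-(D * I)) * Complex.exp (κ' * P)) / 2 -
      (Complex.exp (D * I) * Complex.exp (κ * x) +
        Complex.exp (-(D * I)) * Complex.exp (κ' * x)) / 2 =
      (Complex.exp (D * I) * (Complex.exp (κ * P) - Complex.exp (κ * x)) +
        Complex.exp (-(D * I)) * (Complex.exp (κ' * P) - Complex.exp (κ' * x))) / 2 := by ring
  have n1 : ‖Complex.exp (D * I)‖ = 1 := Complex.norm_exp_ofReal_mul_I D
  have n2 : ‖Complex.exp (-(D * I))‖ = 1 := by
    rw [← neg_mul, ← ofReal_neg]; exact Complex.norm_exp_ofReal_mul_I (-D)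
  have h1 := norm_exp_mul_sub_le κ P x
  have h2 := norm_exp_mul_sub_le κ' P x
  rw [hre] at h1
  rw [hre'] at h2
  have h3 : ∀ k : ℂ, Real.exp (A * x) * (‖k‖ * ‖P - x‖ * Real.exp (‖k‖ * ‖P - x‖)) ≤
      (‖k‖ * Real.exp (‖k‖ * K)) * Real.exp (A * x) * ‖P - x‖ := by
    intro k
    calc _ ≤ Real.exp (A * x) * (‖k‖ * ‖P - x‖ * Real.exp (‖k‖ * K)) := by gcongr
      _ = _ := by ring
  rw [e3, norm_div, Complex.norm_ofNat]
  have h4 := norm_add_le (Complex.exp (D * I) * (Complex.exp (κ * P) - Complex.exp (κ * x)))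
    (Complex.exp (-(D * I)) * (Complex.exp (κ' * P) - Complex.exp (κ' * x)))
  rw [norm_mul, norm_mul, n1, n2, one_mul, one_mul] at h4
  have h5 := h3 κ
  have h6 := h3 κ'
  have h7 : 0 ≤ Real.exp (A * x) * ‖P - x‖ := by positivity
  rw [div_le_iff₀ two_pos]
  have h8 : 0 ≤ (‖κ‖ * Real.exp (‖κ‖ * K)) * Real.exp (A * x) * ‖P - x‖ := by positivity
  have h9 : 0 ≤ (‖κ'‖ * Real.exp (‖κ'‖ * K)) * Real.exp (A * x) * ‖P - x‖ := by positivity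
  nlinarith

section
variable {a c : ℝ} (ha : 0 < a)
include ha

omit ha in
theorem logPow_eq (z : ℂ) : logPow (-a) z = Complex.log z ^ (phaseExp a : ℂ) := by
  rw [logPow, phaseExp, show -a / (-a - 1) = a / (1 + a) by
    rw [show -a - 1 = -(1 + a) by ring, neg_div_neg_eq]]

theorem half_exponent_eq : -a / (2 * (1 - -a)) = -(phaseExp a / 2) := by
  rw [phaseExp, sub_neg_eq_add]; field_simp

/-- The two upper bounds a/(2(1+a)) and 1/(1+a) agree at a = 2; the case distinction at θ = -2
selects the smaller one, up to ε. -/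
theorem errorExponent_le {ε : ℝ} (hε : 0 < ε) :
    errorExponent (-a) ε ≤ phaseExp a / 2 ∧ errorExponent (-a) ε ≤ 1 / (1 + a) := by
  have h1 : -a / (2 * (-a - 1)) = phaseExp a / 2 := by
    rw [phaseExp, show 2 * (-a - 1) = -(2 * (1 + a)) by ring, neg_div_neg_eq]; field_simp
  have h2 : phaseExp a / 2 = a / 2 * (1 / (1 + a)) := by rw [phaseExp]; ring
  have h3 : 0 < 1 / (1 + a) := by positivity
  unfold errorExponent
  split_ifs with h
  · rw [h1]
    refine ⟨by linarith, ?_⟩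
    rw [h2]; nlinarith
  · rw [sub_neg_eq_add]
    refine ⟨?_, le_rfl⟩
    rw [h2]; nlinarith

/-- The main term, with `log z` replaced by its real part. -/
theorem exists_norm_mainTerm_sub_le : ∃ C : ℝ, 0 < C ∧ ∀ z : ℂ, 2 * Real.pi ≤ Real.log ‖z‖ →
    ‖mainTerm c (-a) z - ((A₁ c (-a) * Real.exp (A₂ c (-a) * Real.log ‖z‖ ^ phaseExp a) *
      Real.log ‖z‖ ^ (-(phaseExp a / 2)) *
      Real.cos (A₃ c (-a) * Real.log ‖z‖ ^ phaseExp a + A₄ (-a)) : ℝ) : ℂ)‖ ≤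
      C * size a c (Real.log ‖z‖) := by
  obtain ⟨C₁, hC₁, h1⟩ := exists_cpow_bounds (phaseExp a)
  obtain ⟨C₂, hC₂, h2⟩ := exists_cpow_bounds (-(phaseExp a / 2))
  obtain ⟨C₃, hC₃, h3⟩ := exists_osc_sub_le (A₂ c (-a)) (A₃ c (-a)) (A₄ (-a)) C₁
  have hp := phaseExp_pos ha
  have hp1 := phaseExp_lt ha
  refine ⟨|A₁ c (-a)| * ((C₃ * C₁) * (C₂ + 1) + C₂) + 1, by positivity, fun z hz => ?_⟩
  have hlog : Complex.log z = (Real.log ‖z‖ : ℝ) + z.arg * I := rfl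
  have hℓ1 : 1 ≤ Real.log ‖z‖ := by linarith [Real.pi_gt_three]
  have hP := (h1 _ _ hz (Complex.abs_arg_le_pi z)).1
  have hQ := (h2 _ _ hz (Complex.abs_arg_le_pi z)).1
  rw [mainTerm, logPow_eq, half_exponent_eq ha, hlog, size]
  set ℓ := Real.log ‖z‖ with hℓ
  have hℓ0 : 0 < ℓ := by linarith
  set P := ((ℓ : ℂ) + z.arg * I) ^ ((phaseExp a : ℝ) : ℂ) with hPdef
  set Q := ((ℓ : ℂ) + z.arg * I) ^ ((-(phaseExp a / 2) : ℝ) : ℂ) with hQdef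
  set x := ℓ ^ phaseExp a with hx
  set q := ℓ ^ (-(phaseExp a / 2)) with hq
  have hq0 : 0 < q := by positivity
  have hs1 : ℓ ^ (phaseExp a - 1) ≤ 1 :=
    Real.rpow_le_one_of_one_le_of_nonpos hℓ1 (by linarith)
  -- As the exponent p is below 1, replacing log z by its real part moves its p-th power by
  -- O(ℓ^{p-1}), which is bounded; this power ℓ^{p-1} = ℓ^{-1/(1+a)} is exactly the relative loss
  -- allowed by `size`.
  have hPK : ‖P - x‖ ≤ C₁ := hP.trans (by nlinarith)
  have hosc := (h3 P x hPK).trans (mul_le_mul_of_nonneg_left hP (by positivity))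
  have hQ' : ‖Q - q‖ ≤ C₂ * q * ℓ ^ (phaseExp a - 1) := by
    refine hQ.trans ?_
    have : ℓ ^ (-(phaseExp a / 2) - 1) ≤ q * ℓ ^ (phaseExp a - 1) := by
      rw [hq, ← Real.rpow_add hℓ0]
      exact Real.rpow_le_rpow_of_exponent_le hℓ1 (by linarith)
    calc _ ≤ C₂ * (q * ℓ ^ (phaseExp a - 1)) := by gcongr
      _ = _ := by ring
  have hQn : ‖Q‖ ≤ (C₂ + 1) * q := by
    have e1 := norm_add_le (Q - q) (q : ℂ)
    rw [sub_add_cancel, Complex.norm_real, Real.norm_of_nonneg hq0.le] at e1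
    have e2 : C₂ * q * ℓ ^ (phaseExp a - 1) ≤ C₂ * q * 1 := by gcongr
    linarith
  set A := A₂ c (-a)
  set B := A₃ c (-a)
  set D := A₄ (-a)
  have key : (A₁ c (-a) : ℂ) * Complex.exp (A * P) * Q * Complex.cos (B * P + D) -
      ((A₁ c (-a) * Real.exp (A * x) * q * Real.cos (B * x + D) : ℝ) : ℂ) =
      A₁ c (-a) * ((Complex.exp (A * P) * Complex.cos (B * P + D) -
        ((Real.exp (A * x) * Real.cos (B * x + D) : ℝ) : ℂ)) * Q +
        ((Real.exp (A * x) * Real.cos (B * x + D) : ℝ) : ℂ) * (Q - q)) := by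
    push_cast; ring
  rw [key, norm_mul, Complex.norm_real, Real.norm_eq_abs]
  have hexp0 := Real.exp_pos (A * x)
  have hosc2 : ‖((Real.exp (A * x) * Real.cos (B * x + D) : ℝ) : ℂ)‖ ≤ Real.exp (A * x) := by
    rw [Complex.norm_real, norm_mul, Real.norm_of_nonneg hexp0.le]
    exact mul_le_of_le_one_right hexp0.le (Real.abs_cos_le_one _)
  have hsize : ℓ ^ (-(1 / (1 + a) + phaseExp a / 2)) = q * ℓ ^ (phaseExp a - 1) := by
    rw [hq, ← Real.rpow_add hℓ0]
    congr 1
    rw [phaseExp_eq ha]; ring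
  rw [hsize]
  set w := ℓ ^ (phaseExp a - 1) with hw
  have hw0 : 0 < w := by positivity
  calc _ ≤ |A₁ c (-a)| * ((C₃ * Real.exp (A * x) * (C₁ * w)) * ((C₂ + 1) * q) +
        Real.exp (A * x) * (C₂ * q * w)) := by
        refine mul_le_mul_of_nonneg_left ((norm_add_le _ _).trans ?_) (abs_nonneg _)
        rw [norm_mul, norm_mul]
        gcongr
    _ = (|A₁ c (-a)| * ((C₃ * C₁) * (C₂ + 1) + C₂)) * (q * w * Real.exp (A * x)) := by ring
    _ ≤ _ := by
        have : 0 < q * w * Real.exp (A * x) := by positivity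
        nlinarith

/-- The error term is a complex function, so its modulus must be bounded below. Passing from log z
to log|z| changes the exponent by a bounded amount and the power by a bounded factor. -/
theorem exists_le_norm_errorTerm {ε : ℝ} : ∃ C : ℝ, 0 < C ∧
    ∀ z : ℂ, 2 * Real.pi ≤ Real.log ‖z‖ →
    Real.exp (A₂ c (-a) * Real.log ‖z‖ ^ phaseExp a) *
      Real.log ‖z‖ ^ (-(phaseExp a / 2) - errorExponent (-a) ε) ≤
      C * ‖errorTerm c (-a) ε z‖ := by
  obtain ⟨C₁, hC₁, h1⟩ := exists_cpow_bounds (phaseExp a)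
  obtain ⟨C₂, hC₂, h2⟩ := exists_cpow_bounds (-(phaseExp a / 2) - errorExponent (-a) ε)
  have hp1 := phaseExp_lt ha
  refine ⟨Real.exp (|A₂ c (-a)| * C₁) * C₂, by positivity, fun z hz => ?_⟩
  have hlog : Complex.log z = (Real.log ‖z‖ : ℝ) + z.arg * I := rfl
  have hℓ1 : 1 ≤ Real.log ‖z‖ := by linarith [Real.pi_gt_three]
  have hP := (h1 _ _ hz (Complex.abs_arg_le_pi z)).1
  have hQ := (h2 _ _ hz (Complex.abs_arg_le_pi z)).2
  rw [errorTerm, logPow_eq, half_exponent_eq ha, hlog]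
  set ℓ := Real.log ‖z‖ with hℓ
  set P := ((ℓ : ℂ) + z.arg * I) ^ ((phaseExp a : ℝ) : ℂ) with hPdef
  have hs1 : ℓ ^ (phaseExp a - 1) ≤ 1 :=
    Real.rpow_le_one_of_one_le_of_nonpos hℓ1 (by linarith)
  have hPK : ‖P - (ℓ ^ phaseExp a : ℝ)‖ ≤ C₁ := hP.trans (by nlinarith)
  set x := ℓ ^ phaseExp a
  set A := A₂ c (-a)
  have hre : |P.re - x| ≤ C₁ := by
    have := (Complex.abs_re_le_norm (P - x)).trans hPK
    rwa [sub_re, ofReal_re] at this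
  have hE : Real.exp (A * x) ≤ Real.exp (|A| * C₁) * ‖Complex.exp (A * P)‖ := by
    rw [Complex.norm_exp, re_ofReal_mul, ← Real.exp_add]
    apply Real.exp_le_exp.2
    have h3 : A * (x - P.re) ≤ |A| * C₁ := by
      refine (le_abs_self _).trans ?_
      rw [abs_mul, abs_sub_comm]
      gcongr
    linarith
  rw [norm_mul]
  calc _ ≤ (Real.exp (|A| * C₁) * ‖Complex.exp (A * P)‖) *
        (C₂ * ‖((ℓ : ℂ) + z.arg * I) ^ ((-(phaseExp a / 2) - errorExponent (-a) ε : ℝ) : ℂ)‖) := by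
        gcongr
    _ = _ := by ring

/-- Three errors add up: concentration of the kernel and replacement of log|z| by log z, both of
order `size`, and the saddle point error of order ℓ^{-p} against an amplitude ℓ^{-p/2}. The two
bounds on the error exponent cover them. -/
theorem genExp_sub_mainTerm_isBigO (hc : c < 0) {E : ℂ → ℂ} (hE : IsGeneralizedExp c (-a) E) {ε : ℝ}
    (hε : 0 < ε) (α : ℝ) {β : ℝ} (hβ : β ≤ Real.pi) :
    (fun z : ℂ => E z - mainTerm c (-a) z)
      =O[Bornology.cobounded ℂ ⊓ 𝓟 (sector α β)] errorTerm c (-a) ε := by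
  obtain ⟨C₁, L, hC₁, hL, h1⟩ := exists_norm_genExp_add_wright_le ha hc
  obtain ⟨C₂, hC₂, h2⟩ := exists_norm_wright_zero_sub_le ha hc
  obtain ⟨C₃, hC₃, h3⟩ := exists_norm_mainTerm_sub_le (c := c) ha
  obtain ⟨C₄, hC₄, h4⟩ := exists_le_norm_errorTerm (c := c) (ε := ε) ha
  obtain ⟨hμ1, hμ2⟩ := errorExponent_le ha hε
  refine IsBigO.of_bound ((C₁ + C₂ + C₃) * C₄) ?_
  rw [eventually_inf_principal]
  have hlarge : ∀ᶠ z : ℂ in Bornology.cobounded ℂ, max L (2 * Real.pi) ≤ Real.log ‖z‖ :=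
    (Real.tendsto_log_atTop.comp tendsto_norm_cobounded_atTop).eventually_ge_atTop _
  filter_upwards [hlarge] with z hz hzs
  have hz0 : z ≠ 0 := hzs.1
  have hzπ : z.arg ≠ Real.pi := (hzs.2.2.trans_le hβ).ne
  have hzL := (le_max_left _ _).trans hz
  have hz2 := (le_max_right _ _).trans hz
  have e1 := h1 z hz0 hzπ hzL
  have e2 := h2 (Real.log ‖z‖) (by linarith)
  have e3 := h3 z hz2
  have e4 := h4 z hz2
  rw [hE.eqOn_genExp ha (mem_slitDomain_of_arg hz0 hzπ)]
  rw [size] at e1 e3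
  have hℓ1 : 1 ≤ Real.log ‖z‖ := by linarith
  set ℓ := Real.log ‖z‖ with hℓ
  set X := Real.exp (A₂ c (-a) * ℓ ^ phaseExp a) with hX
  set Y := ℓ ^ (-(phaseExp a / 2) - errorExponent (-a) ε) with hY
  have hX0 : 0 < X := Real.exp_pos _
  have hY1 : ℓ ^ (-(1 / (1 + a) + phaseExp a / 2)) ≤ Y :=
    Real.rpow_le_rpow_of_exponent_le hℓ1 (by linarith)
  have hY2 : ℓ ^ (-phaseExp a) ≤ Y := Real.rpow_le_rpow_of_exponent_le hℓ1 (by linarith)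
  set R : ℂ := ((A₁ c (-a) * X * ℓ ^ (-(phaseExp a / 2)) *
    Real.cos (A₃ c (-a) * ℓ ^ phaseExp a + A₄ (-a)) : ℝ) : ℂ) with hR
  have hsplit : genExp a c z - mainTerm c (-a) z = (genExp a c z + wright a c 0 ℓ) -
      (wright a c 0 ℓ + R) - (mainTerm c (-a) z - R) := by ring
  rw [hsplit]
  calc _ ≤ C₁ * (Y * X) + C₂ * (Y * X) + C₃ * (Y * X) := by
        refine (norm_sub_le _ _).trans (add_le_add ((norm_sub_le _ _).trans (add_le_add ?_ ?_)) ?_)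
        · exact e1.trans (by gcongr)
        · exact e2.trans (by gcongr)
        · exact e3.trans (by gcongr)
    _ = (C₁ + C₂ + C₃) * (X * Y) := by ring
    _ ≤ (C₁ + C₂ + C₃) * (C₄ * ‖errorTerm c (-a) ε z‖) := by gcongr
    _ = _ := by ring

/-! ### The sign of A₂ and the case c = θ = -1 -/

theorem A₂_factor_pos (hc : c < 0) : 0 < (1 + 1 / a) * (a * -c) ^ (1 / (1 + a)) := by
  have : 0 < a * -c := by nlinarith
  positivity

omit ha in
theorem A₂_eq_cos : A₂ c (-a) =
    (1 + 1 / a) * (a * -c) ^ (1 / (1 + a)) * Real.cos (Real.pi / (1 + a)) := by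
  rw [A₂, show c * -a = a * -c by ring, show 1 - -a = 1 + a by ring, inv_neg]
  ring

/-- The sign of A₂ is that of cos(π/(1 + a)), and π/(1 + a) exceeds π/2 precisely for a < 1. -/
theorem A₂_neg (hc : c < 0) (h : a < 1) : A₂ c (-a) < 0 := by
  rw [A₂_eq_cos]
  have hpi := Real.pi_pos
  refine mul_neg_of_pos_of_neg (A₂_factor_pos ha hc) (Real.cos_neg_of_pi_div_two_lt_of_lt ?_ ?_)
  · exact div_lt_div_of_pos_left hpi (by positivity) (by linarith)
  · have : Real.pi / (1 + a) ≤ Real.pi := div_le_self hpi.le (by linarith)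
    linarith

theorem A₂_pos (hc : c < 0) (h : 1 < a) : 0 < A₂ c (-a) := by
  rw [A₂_eq_cos]
  have hpi := Real.pi_pos
  refine mul_pos (A₂_factor_pos ha hc) (Real.cos_pos_of_mem_Ioo ⟨?_, ?_⟩)
  · have : 0 < Real.pi / (1 + a) := by positivity
    linarith
  · exact div_lt_div_of_pos_left hpi (by positivity) (by linarith)

end

theorem A₂_eq_zero (c : ℝ) : A₂ c (-1) = 0 := by
  rw [A₂, show Real.pi / (1 - -1) = Real.pi / 2 by norm_num, Real.cos_pi_div_two, mul_zero]

theorem A₃_neg_one : A₃ (-1) (-1) = 2 := by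
  rw [A₃, show Real.pi / (1 - -1) = Real.pi / 2 by norm_num, Real.sin_pi_div_two]
  norm_num

theorem A₁_neg_one : A₁ (-1) (-1) = -(Real.pi ^ (-(1 / 2) : ℝ)) := by
  have hpi := Real.pi_pos
  rw [A₁, Real.rpow_neg hpi.le, ← Real.sqrt_eq_rpow, ← Real.sqrt_inv,
    show 2 / (Real.pi * (1 - -1)) = Real.pi⁻¹ by field_simp; norm_num]
  norm_num

theorem mainTerm_neg_one (z : ℂ) : mainTerm (-1) (-1) z =
    -((Real.pi ^ (-(1 / 2) : ℝ) : ℝ) : ℂ) * Complex.log z ^ (-(1 / 4) : ℂ)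
      * Complex.cos (2 * Complex.log z ^ (1 / 2 : ℂ) - (Real.pi : ℂ) / 4) := by
  rw [mainTerm, logPow, A₂_eq_zero, A₃_neg_one, A₁_neg_one, A₄,
    show (-1 : ℝ) / (-1 - 1) = 1 / 2 by norm_num,
    show (-1 : ℝ) / (2 * (1 - -1)) = -(1 / 4) by norm_num,
    show Real.pi / (2 * (-1 - 1)) = -(Real.pi / 4) by ring]
  push_cast
  rw [zero_mul, Complex.exp_zero, mul_one, ← sub_eq_add_neg]

/-- At θ = -1 the exponent is -1/4 - (1/4 - ε), by the branch θ ≥ -2. -/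
theorem errorTerm_neg_one {ε : ℝ} (z : ℂ) :
    errorTerm (-1) (-1) ε z = Complex.log z ^ ((-(1 / 2) + ε : ℝ) : ℂ) := by
  rw [errorTerm, A₂_eq_zero, errorExponent, if_pos (by norm_num), ofReal_zero, zero_mul,
    Complex.exp_zero, one_mul,
    show (-1 : ℝ) / (2 * (1 - -1)) - (-1 / (2 * (-1 - 1)) - ε) = -(1 / 2) + ε by ring]


end GenExp
end

/-! ### The theorem -/

theorem mainTheorem7 :
    (∀ c θ : ℝ, c < 0 → θ < 0 →
      (∃ E : ℂ → ℂ, GenExp.IsGeneralizedExp c θ E) ∧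
      (∀ E : ℂ → ℂ, GenExp.IsGeneralizedExp c θ E →
        ∀ ε : ℝ, 0 < ε → ∀ α β : ℝ, -Real.pi ≤ α → α < β → β ≤ Real.pi →
          (fun z : ℂ => E z - GenExp.mainTerm c θ z)
            =O[Bornology.cobounded ℂ ⊓ 𝓟 (GenExp.sector α β)] GenExp.errorTerm c θ ε) ∧
      (-1 < θ → GenExp.A₂ c θ < 0) ∧
      (θ = -1 → GenExp.A₂ c θ = 0) ∧
      (θ < -1 → 0 < GenExp.A₂ c θ)) ∧
    (∀ E : ℂ → ℂ, GenExp.IsGeneralizedExp (-1) (-1) E →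
      ∀ ε : ℝ, 0 < ε → ∀ α β : ℝ, -Real.pi ≤ α → α < β → β ≤ Real.pi →
        (fun z : ℂ => E z -
            -((Real.pi ^ (-(1 / 2) : ℝ) : ℝ) : ℂ) * Complex.log z ^ (-(1 / 4) : ℂ)
              * Complex.cos (2 * Complex.log z ^ (1 / 2 : ℂ) - (Real.pi : ℂ) / 4))
          =O[Bornology.cobounded ℂ ⊓ 𝓟 (GenExp.sector α β)]
            fun z : ℂ => Complex.log z ^ ((-(1 / 2) + ε : ℝ) : ℂ)) := by
  refine ⟨fun c θ hc hθ => ?_, fun E hE ε hε α β _ _ hβ => ?_⟩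
  · obtain ⟨a, rfl⟩ : ∃ a : ℝ, θ = -a := ⟨-θ, (neg_neg θ).symm⟩
    have ha : 0 < a := by linarith
    refine ⟨⟨_, GenExp.isGeneralizedExp_genExp ha⟩, fun E hE ε hε α β _ _ hβ =>
      GenExp.genExp_sub_mainTerm_isBigO ha hc hE hε α hβ,
      fun h => GenExp.A₂_neg ha hc (by linarith), fun h => ?_,
      fun h => GenExp.A₂_pos ha hc (by linarith)⟩
    rw [h]
    exact GenExp.A₂_eq_zero c
  · have h := GenExp.genExp_sub_mainTerm_isBigO one_pos (by norm_num) hE hε α hβ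
    simpa only [GenExp.mainTerm_neg_one, funext GenExp.errorTerm_neg_one] using h
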